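/- An a-graph is a near-triangulation of the plane (a finite simple plane graph) whose only non-triangular face has size $4$; its boundary is a $4$-cycle $u\,x\,v\,y$, with opposite pairs $(x,y)$ and $(u,v)$. If $x,y$ are non-adjacent, so that the parent $G+xy$ is a (simple) planar triangulation, then $G$ together with the designated pair $(x,y)$ is the parented a-graph $G_{xy}$; $G_{uv}$ is defined likewise. A state of $G$ is a partition of $V(G)$ into the colour classes of a proper coloring with at most $4$ colours. A Kempe exchange interchanges two colours $j,k$ on a non-empty proper subset of the set of $j$-$k$ Kempe chains (the connected components of the subgraph induced by the vertices coloured $j$ or $k$). The Kempe classes are the components of the graph whose vertices are the states and whose edges join distinct states related by one Kempe exchange. For $G_{xy}$, a state is a solution state if $x$ and $y$ have different colours and a non-solution state otherwise; a Kempe class is an $n$ class if all its states are non-solution states, an $s$ class if all are solution states, and an $n$-$s$ class if it has states of both kinds. $A^*$ is the family of all parented a-graphs $G_{xy}$ without an $n$-$s$ class. The Birkhoff diamond is the graph with a ring $r_0r_1r_2r_3r_4r_5$ (a $6$-cycle) and four inner vertices $a,b,c,d$, where $a,b$ are adjacent and both adjacent to $c$ and $d$, $c$ is adjacent to $r_5,r_0,r_1$,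 $a$ to $r_1,r_2$, $d$ to $r_2,r_3,r_4$, and $b$ to $r_4,r_5$. Let $G^*$ be the graph of order $12$ obtained from it by putting $x^*=r_0$, $y^*=r_3$ and adding a vertex $u^*$ adjacent to $r_0,r_1,r_2,r_3$ and a vertex $v^*$ adjacent to $r_3,r_4,r_5,r_0$. Then: 1. Every $G_{xy}\in A^*$ has order at least $12$. 2. $G^*_{xy}$ is, up to isomorphism (respecting $u,x,v,y$), the only member of $A^*$ of order $12$: $G^*$ is an a-graph with boundary cycle $u^*x^*v^*y^*$, the subgraph induced by the vertices other than $u^*,v^*$ is the Birkhoff diamond, $G^*_{xy}\in A^*$, and whenever $G_{xy}\in A^*$ has order $12$ and boundary cycle $u\,x\,v\,y$ there is an isomorphism $G\to G^*$ taking $u,x,v,y$ to $u^*,x^*,v^*,y^*$. 3. $G^*$ has exactly two Kempe classes. For $G^*_{xy}$ one is an $n$ class with $6$ states and the other is an $s$ class with $12$ states. 4. $G^*_{uv}$ is a parented a-graph whose parent $G^*+u^*v^*$ is the icosahedron, both Kempe classes are $n$-$s$ classes for $G^*_{uv}$, and hence $G^*_{uv}\notin A^*$. -/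

import Mathlib

namespace AGraph

/-! Plane graphs, given combinatorially by rotation systems of genus zero. -/

/-- A rotation system: a cyclic ordering of the darts (oriented edges) leaving each vertex. -/
structure RotationSystem {V : Type*} (G : SimpleGraph V) where
  next : Equiv.Perm G.Dart
  next_fst : ∀ d, (next d).fst = d.fst
  cyclic : ∀ d e : G.Dart, d.fst = e.fst → next.SameCycle d e

namespace RotationSystem

variable {V : Type*} {G : SimpleGraph V}

/-- The face permutation. A dart `a → b` is followed, along the boundary of the face on a fixed
side of it, by the successor at `b` of the reversed dart `b → a`. Its cycles are the faces. -/
def face (R : RotationSystem G) : Equiv.Perm G.Dart :=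
  (SimpleGraph.Dart.symm_involutive (G := G)).toPerm.trans R.next

/-- The number of faces. -/
noncomputable def numFaces (R : RotationSystem G) : ℕ :=
  Nat.card (Quotient (Equiv.Perm.SameCycle.setoid R.face))

/-- The rotation system describes an embedding of a connected graph in the sphere
(equivalently, the plane): the Euler relation `|V| - |E| + |F| = 2` holds. -/
def IsPlanar (R : RotationSystem G) : Prop :=
  G.Connected ∧ Nat.card V + R.numFaces = Nat.card G.edgeSet + 2

end RotationSystem

/-- A planar triangulation: a simple graph with a planar embedding all of whose faces are
delineated by three edges. -/
def IsPlanarTriangulation {V : Type*} (G : SimpleGraph V) : Prop :=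
  ∃ R : RotationSystem G, R.IsPlanar ∧ ∀ d, R.face (R.face (R.face d)) = d

/-- `G` is an a-graph with boundary cycle `u x v y`: a near-triangulation of the plane whose only
non-triangular face has size four and is bounded by the cycle `u x v y`. -/
def IsAGraph {V : Type*} (G : SimpleGraph V) (u x v y : V) : Prop :=
  u ≠ v ∧ x ≠ y ∧
  ∃ R : RotationSystem G, R.IsPlanar ∧
    ∃ d : G.Dart,
      d.toProd = (u, x) ∧
      (R.face d).toProd = (x, v) ∧
      (R.face (R.face d)).toProd = (v, y) ∧
      (R.face (R.face (R.face d))).toProd = (y, u) ∧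
      R.face (R.face (R.face (R.face d))) = d ∧
      ∀ e : G.Dart, ¬ R.face.SameCycle d e → R.face (R.face (R.face e)) = e

/-- The parented a-graph `G_xy`: an a-graph with boundary cycle `u x v y` and designated pair
`(x, y)` of opposite boundary vertices. Its applicable parent `G + xy` has to be a planar
triangulation (a simple one), from which `G` arises by deleting the edge `xy`. -/
def IsParentedAGraph {V : Type*} (G : SimpleGraph V) (u x v y : V) : Prop :=
  IsAGraph G u x v y ∧ ¬ G.Adj x y ∧ IsPlanarTriangulation (G ⊔ SimpleGraph.edge x y)

/-! Kempe exchanges and the state transformation graph. -/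

section Kempe

variable {V : Type*} (G : SimpleGraph V)

/-- The vertices coloured `j` or `k`. -/
def twoColored (c : G.Coloring (Fin 4)) (j k : Fin 4) : Set V :=
  {w | c w = j ∨ c w = k}

/-- The `j`-`k` Kempe chains: the components of the subgraph induced by the colours `j`, `k`. -/
abbrev KempeChain (c : G.Coloring (Fin 4)) (j k : Fin 4) : Type _ :=
  (G.induce (twoColored G c j k)).ConnectedComponent

/-- `c'` arises from `c` by exchanging two colours `j` and `k` on all chains of a non-empty proper
subset `S` of the set of all `j`-`k` Kempe chains. -/
def KempeExchange (c c' : G.Coloring (Fin 4)) : Prop :=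
  ∃ j k : Fin 4, j ≠ k ∧ ∃ S : Set (KempeChain G c j k), S.Nonempty ∧ S ≠ Set.univ ∧
    (∀ w : twoColored G c j k,
      (SimpleGraph.connectedComponentMk _ w ∈ S → c' w = Equiv.swap j k (c w)) ∧
      (SimpleGraph.connectedComponentMk _ w ∉ S → c' w = c w)) ∧
    ∀ w : V, w ∉ twoColored G c j k → c' w = c w

/-- A (coloring) state: a partition of the vertex set into the colour classes of a 4-coloring,
recorded as the relation "has the same colour as". -/
def State : Type _ :=
  {s : Setoid V // ∃ c : G.Coloring (Fin 4), s = Setoid.ker c}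

/-- The state transformation graph: two distinct states are adjacent if they are connected by a
single Kempe exchange. -/
def stateGraph : SimpleGraph (State G) :=
  SimpleGraph.fromRel fun s t =>
    ∃ c c' : G.Coloring (Fin 4), s.1 = Setoid.ker c ∧ t.1 = Setoid.ker c' ∧ KempeExchange G c c'

/-- A Kempe equivalence class of states: a component of the state transformation graph. -/
abbrev KempeClass : Type _ := (stateGraph G).ConnectedComponent

variable {G}

/-- All states of the class are non-solution states, that is, `x` and `y` have equal colours. -/
def IsNClass (C : KempeClass G) (x y : V) : Prop := ∀ s ∈ C.supp, s.1 x y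

/-- All states of the class are solution states. -/
def IsSClass (C : KempeClass G) (x y : V) : Prop := ∀ s ∈ C.supp, ¬ s.1 x y

/-- The class has both non-solution and solution states. -/
def IsNSClass (C : KempeClass G) (x y : V) : Prop :=
  (∃ s ∈ C.supp, s.1 x y) ∧ ∃ s ∈ C.supp, ¬ s.1 x y

end Kempe

/-- The parented a-graph `G_xy` with boundary cycle `u x v y` belongs to the family `A*`:
no Kempe class is an n-s class with respect to the pair `(x, y)`. -/
def InAStar {V : Type*} (G : SimpleGraph V) (u x v y : V) : Prop :=
  IsParentedAGraph G u x v y ∧ ∀ C : KempeClass G, ¬ IsNSClass C x y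

/-! The concrete graphs. -/

/-- The Birkhoff diamond: a ring `0, …, 5` and, inside it, a diamond with the vertices
`6, 7` (adjacent) and tips `8, 9`; each inner vertex has degree 5. -/
def birkhoffDiamond : SimpleGraph (Fin 10) :=
  SimpleGraph.fromRel fun a b => (a, b) ∈
    ([(0, 1), (1, 2), (2, 3), (3, 4), (4, 5), (5, 0),
      (6, 7), (6, 8), (6, 9), (7, 8), (7, 9),
      (8, 5), (8, 0), (8, 1), (6, 1), (6, 2),
      (9, 2), (9, 3), (9, 4), (7, 4), (7, 5)] : List (Fin 10 × Fin 10))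

/-- The a-graph `G*`: the vertices `0, …, 9` span a Birkhoff diamond, in which `x = 0` and `y = 3`
are opposite vertices of the ring; `u = 10` is joined to `0, 1, 2, 3` and `v = 11` is joined to
`3, 4, 5, 0`. -/
def gStar : SimpleGraph (Fin 12) :=
  SimpleGraph.fromRel fun a b => (a, b) ∈
    ([(0, 1), (1, 2), (2, 3), (3, 4), (4, 5), (5, 0),
      (6, 7), (6, 8), (6, 9), (7, 8), (7, 9),
      (8, 5), (8, 0), (8, 1), (6, 1), (6, 2),
      (9, 2), (9, 3), (9, 4), (7, 4), (7, 5),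
      (10, 0), (10, 1), (10, 2), (10, 3),
      (11, 3), (11, 4), (11, 5), (11, 0)] : List (Fin 12 × Fin 12))

/-- The left boundary vertex of `G*`. -/
def xStar : Fin 12 := 0
/-- The right boundary vertex of `G*`. -/
def yStar : Fin 12 := 3
/-- The bottom boundary vertex of `G*`. -/
def uStar : Fin 12 := 10
/-- The top boundary vertex of `G*`. -/
def vStar : Fin 12 := 11

/-- The icosahedron graph, as a pentagonal antiprism with two apexes: `(b, none)` are the apexes,
`(b, some i)` the vertices of the two pentagons. -/
def icosahedron : SimpleGraph (Bool × Option (ZMod 5)) :=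
  SimpleGraph.fromRel fun p q =>
    (∃ b i, p = (b, none) ∧ q = (b, some i)) ∨
    (∃ b i, p = (b, some i) ∧ q = (b, some (i + 1))) ∨
    (∃ i, p = (false, some i) ∧ (q = (true, some i) ∨ q = (true, some (i + 1))))

end AGraph

open AGraph

/-!
Let `P` be a plane triangulation with an edge `x y`. Call `x`, `y` unlocked in `G = P - x y` if some
4-colouring of `G` gives them the same colour and they lie on different Kempe chains for some pair of
colours (`Unlocked`). Every Kempe exchange between a non-solution and a solution state exhibits such
a colouring, and conversely an exchange on the chain of `x` leads to a solution state. So `G` has an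
n-s class for `x`, `y` exactly if they are unlocked (`Unlocked.exists_isNSClass`,
`not_isNSClass_of_not_unlocked`), and the parents of members of `A*` are the triangulations with a
locked edge.

Planarity enters through `IsFlat`: a graph is flat if it has an algebraic dual over the field of two
elements, a system of faces whose boundaries span the cycle space, as in Mac Lane's criterion. The
faces of a planar rotation system are such a system by the Euler relation and a rank count
(`RotationSystem.IsPlanar.isFaceSystem`). Flatness passes to minors (`IsFlat.mono`, `IsFlat.quot`)
and to the graph with a chord cutting off the corner of a face (`IsFaceSystem.isFlat_sup_edge`). A
dimension count gives `|E| ≤ 3 n - 6` (`IsFlat.sum_card_filter_le`), the absence of `K₅` and `K₃,₃`,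
and, when no corner can be cut off, cyclic neighbourhoods (`IsFlat.exists_link`).

The core is a study of a locked edge `x y` in a flat graph of smallest order `n ≤ 12`, with as many
other edges as possible (`Critical`).
* No clique separates it, as colourings of the two sides can be matched on a clique
  (`Critical.reachOff`).
* Off `x` and `y` no vertex has degree at most 3, and a vertex `w` of degree 4 is bad, that is, its
  neighbours form a path from `x` to `y` closed by the edge `x y`: otherwise two of its neighbours
  can be identified, and the exchange in the smaller graph lifts (`Critical.isBad`, `Unlocked.lift`).
* The ends `x` and `y` have degree at least 5, by the Kempe chains between the neighbours of `x`
  (`Critical.five_le_card_nbhd_left`), and at least 6 if there is a bad vertex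
  (`Critical.six_le_card_nbhd_left`). At most two vertices are bad, since there is no `K₃,₃`
  (`Critical.false_of_three_isBad`).

Comparing with the degree sum `6 n - 12`, one gets `n = 12` and either all degrees are 5, or there
are two bad vertices, `x` and `y` have degree 6 and all other degrees are 5
(`Critical.card_and_degrees`). This gives the lower bound 12. For a member `G` of order 12 apply this
to `P = G + x y`. The icosahedron is the only 5-regular flat graph of order 12, and it has enough
symmetries (`IsFlat.exists_iso_gStarUV`). In the first case `P` is therefore the icosahedron, in
which no edge is locked. In the second case the bad vertices are `u` and `v`, so that `G + u v` is
5-regular, hence the icosahedron, and `G` is `G*` (`InAStar.twelve_le`).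

For `G*` itself the drawings are given by cyclic lists of neighbours (`rotationOf`). Every colouring
agrees up to the names of the colours with one of 18 (`exists_perm_eq_gStarCol`). In six of these
`x*` and `y*` have equal colours, and Kempe chains in all three pairs of colours connect them
(`gStar_not_unlocked`), so the two kinds of states are not connected; within each kind a tree of
Kempe exchanges connects all states.
-/

namespace AGraph

/-! ### Face systems and flat graphs -/

theorem reflTransGen_mono {V : Type*} {r r' : V → V → Prop} (h : ∀ a b, r a b → r' a b) {a b : V}
    (hab : Relation.ReflTransGen r a b) : Relation.ReflTransGen r' a b :=
  Relation.ReflTransGen.lift id h _ _ hab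

section Flat

open scoped Classical

variable {V : Type*} [Fintype V] {F : Type*}

/-- A system of faces on a graph, in the spirit of Mac Lane's planarity criterion: `s a b` is the
face on the left of the oriented edge `a → b`, so that every edge lies on the two (possibly equal)
faces `s a b` and `s b a`. Modulo two, the boundary of every set of faces is a cycle (`closed`),
and every edge labelling orthogonal to all face boundaries is a coboundary (`exact`), which says
that the face boundaries span the cycle space. Sets of faces are encoded by their indicator
functions `h : F → ZMod 2`. Values of `s` at pairs of non-adjacent vertices are irrelevant. -/
structure IsFaceSystem (G : SimpleGraph V) (s : V → V → F) : Prop where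
  closed : ∀ (h : F → ZMod 2) (a : V),
    ∑ b, (if G.Adj a b then h (s a b) + h (s b a) else 0) = 0
  exact : ∀ g : Sym2 V → ZMod 2,
    (∀ h : F → ZMod 2, ∑ a, ∑ b, (if G.Adj a b then g s(a, b) * h (s a b) else 0) = 0) →
    ∃ φ : V → ZMod 2, ∀ a b, G.Adj a b → g s(a, b) = φ a + φ b

/-- A graph is flat if it has a finite system of faces. Every planar graph is flat, and unlike
rotation systems, flatness passes to minors by a short computation. The vertex type is never
changed: instead of removing a vertex one removes the edges at it. -/
def IsFlat (G : SimpleGraph V) : Prop :=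
  ∃ (m : ℕ) (s : V → V → Fin m), IsFaceSystem G s

theorem IsFaceSystem.isFlat [Finite F] {G : SimpleGraph V} {s : V → V → F}
    (hs : IsFaceSystem G s) : IsFlat G := by
  obtain ⟨m, ⟨e⟩⟩ := Finite.exists_equiv_fin F
  refine ⟨m, fun a b => e (s a b), ⟨fun h a => hs.closed (fun f => h (e f)) a, ?_⟩⟩
  intro g hg
  refine hs.exact g fun h => ?_
  simpa using hg (fun f => h (e.symm f))

theorem zmod_two_add_self (a : ZMod 2) : a + a = 0 := CharTwo.add_self_eq_zero a

/-- Deleting an edge merges the two faces at it. -/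
theorem IsFaceSystem.deleteEdge {G : SimpleGraph V} {s : V → V → F} (hs : IsFaceSystem G s)
    {a b : V} (hab : G.Adj a b) :
    IsFaceSystem (G.deleteEdges {s(a, b)})
      (fun p q => if s p q = s b a then s a b else s p q) := by
  have hne : a ≠ b := hab.ne
  constructor
  · intro h p
    refine Eq.trans ?_ (hs.closed (fun f => h (if f = s b a then s a b else f)) p)
    refine Finset.sum_congr rfl fun q _ => ?_
    by_cases hpq : G.Adj p q
    · by_cases he : s(p, q) = s(a, b)
      · have h1 : ¬ (G.deleteEdges {s(a, b)}).Adj p q := by simp [he]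
        rw [if_neg h1, if_pos hpq]
        rcases Sym2.eq_iff.1 he with ⟨rfl, rfl⟩ | ⟨rfl, rfl⟩ <;>
          · split_ifs <;> simp_all [zmod_two_add_self]
      · have h1 : (G.deleteEdges {s(a, b)}).Adj p q := by simp [he, hpq]
        rw [if_pos h1, if_pos hpq]
    · have h1 : ¬ (G.deleteEdges {s(a, b)}).Adj p q := by simp [hpq]
      rw [if_neg h1, if_neg hpq]
  · intro g hg
    generalize hG' : G.deleteEdges {s(a, b)} = G' at hg ⊢
    -- The deleted edge gets the value `c` for which the sum around the face `s b a` vanishes. As the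
    -- sum around the merged face is zero, the one around `s a b` vanishes as well.
    set c : ZMod 2 := ∑ p, ∑ q, (if G'.Adj p q then g s(p, q) * (if s p q = s b a then 1 else 0)
      else 0) with hc
    have key := hs.exact (fun e => if e = s(a, b) then c else g e) ?_
    · obtain ⟨φ, hφ⟩ := key
      refine ⟨φ, fun p q hpq => ?_⟩
      have h2 : G.Adj p q ∧ s(p, q) ≠ s(a, b) := by simpa [← hG'] using hpq
      have := hφ p q h2.1
      rwa [if_neg h2.2] at this
    · intro h
      have h1 : ∀ p q, (if G.Adj p q then (if s(p, q) = s(a, b) then c else g s(p, q)) *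
          h (s p q) else 0) =
          (if G'.Adj p q then g s(p, q) * h (if s p q = s b a then s a b else s p q) else 0) +
          (h (s b a) + h (s a b)) * (if G'.Adj p q then g s(p, q) *
            (if s p q = s b a then 1 else 0) else 0) +
          c * ((if p = a then if q = b then h (s a b) else 0 else 0) +
            (if p = b then if q = a then h (s b a) else 0 else 0)) := by
        intro p q
        by_cases hpq : G.Adj p q
        · by_cases he : s(p, q) = s(a, b)
          · have h1 : ¬ G'.Adj p q := by simp [← hG', he]
            simp only [hpq, he, if_true, h1, if_false]
            rcases Sym2.eq_iff.1 he with ⟨rfl, rfl⟩ | ⟨rfl, rfl⟩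
            · simp [hne]
            · simp [hne.symm]
          · have h1 : G'.Adj p q := by simp [← hG', he, hpq]
            have h2 : ¬ (p = a ∧ q = b) := fun h => he (by rw [h.1, h.2])
            have h3 : ¬ (p = b ∧ q = a) := fun h => he (by rw [h.1, h.2, Sym2.eq_swap])
            have h4 : (if p = a then if q = b then h (s a b) else 0 else 0) = 0 := by
              split_ifs <;> simp_all
            have h5 : (if p = b then if q = a then h (s b a) else 0 else 0) = 0 := by
              split_ifs <;> simp_all
            rw [h4, h5]
            simp only [hpq, he, if_true, h1, if_false]
            split_ifs with h6
            · rw [h6]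
              have := zmod_two_add_self (g s(p, q) * h (s a b))
              linear_combination -this
            · simp
        · have h1 : ¬ G'.Adj p q := by simp [← hG', hpq]
          have h4 : (if p = a then if q = b then h (s a b) else 0 else 0) = 0 := by
            split_ifs <;> simp_all
          have h5 : (if p = b then if q = a then h (s b a) else 0 else 0) = 0 := by
            split_ifs with h6 h7
            · subst h6 h7
              exact absurd hab.symm hpq
            · rfl
            · rfl
          rw [h4, h5]
          simp [hpq, h1]
      simp only [h1, Finset.sum_add_distrib, ← Finset.mul_sum]
      rw [hg h, ← hc]
      have h2 : ∀ z : ZMod 2, ∑ p : V, ∑ q : V, (if p = a then if q = b then z else 0 else 0) = z := by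
        intro z
        rw [Finset.sum_eq_single a] <;> simp +contextual
      have h3 : ∀ z : ZMod 2, ∑ p : V, ∑ q : V, (if p = b then if q = a then z else 0 else 0) = z := by
        intro z
        rw [Finset.sum_eq_single b] <;> simp +contextual
      rw [h2, h3]
      have := zmod_two_add_self (c * (h (s a b) + h (s b a)))
      linear_combination this

theorem IsFlat.deleteEdge {G : SimpleGraph V} (hG : IsFlat G) (a b : V) :
    IsFlat (G.deleteEdges {s(a, b)}) := by
  by_cases hab : G.Adj a b
  · obtain ⟨m, s, hs⟩ := hG
    exact ⟨m, _, hs.deleteEdge hab⟩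
  · rwa [SimpleGraph.deleteEdges_eq_self.2]
    simpa using hab

theorem IsFlat.mono {G H : SimpleGraph V} (hG : IsFlat G) (hHG : H ≤ G) : IsFlat H := by
  induction hn : (G.edgeSet \ H.edgeSet).ncard generalizing G with
  | zero =>
    have h1 : G.edgeSet \ H.edgeSet = ∅ := (Set.ncard_eq_zero (Set.toFinite _)).1 hn
    have h2 : G ≤ H := SimpleGraph.edgeSet_subset_edgeSet.1 (Set.sdiff_eq_empty.1 h1)
    rwa [le_antisymm hHG h2]
  | succ n ih =>
    obtain ⟨e, he⟩ := Set.nonempty_of_ncard_ne_zero (by omega : (G.edgeSet \ H.edgeSet).ncard ≠ 0)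
    induction e with
    | h a b =>
      refine ih (hG.deleteEdge a b) ?_ ?_
      · intro p q hpq
        rw [SimpleGraph.deleteEdges_adj]
        refine ⟨hHG hpq, fun h => he.2 ?_⟩
        rw [Set.mem_singleton_iff] at h
        rw [← h]
        exact hpq
      · have h1 : (G.deleteEdges {s(a, b)}).edgeSet \ H.edgeSet =
            (G.edgeSet \ H.edgeSet) \ {s(a, b)} := by
          rw [SimpleGraph.edgeSet_deleteEdges]
          ext e
          simp only [Set.mem_sdiff]
          tauto
        rw [h1, Set.ncard_sdiff_singleton_of_mem he, hn]
        rfl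

/-- The simple graph obtained from `G` by identifying vertices along `f`. -/
def quot (f : V → V) (G : SimpleGraph V) : SimpleGraph V where
  Adj p q := p ≠ q ∧ ∃ a b, G.Adj a b ∧ f a = p ∧ f b = q
  symm := ⟨fun _ _ ⟨h, a, b, hab, ha, hb⟩ => ⟨h.symm, b, a, hab.symm, hb, ha⟩⟩
  loopless := ⟨fun _ h => h.1 rfl⟩

/-- Contraction, for a map along which no two edges become parallel. The faces stay the same. The
boundaries at the vertices of a fibre add up to the boundary at its image. An edge labelling of the quotient, extended by 0 to
the contracted edges, is a coboundary, and its potential is constant on the fibres. -/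
theorem IsFlat.quot_of_injective {G : SimpleGraph V} (hG : IsFlat G) (f : V → V)
    (hf : ∀ z, Relation.ReflTransGen (fun p q => G.Adj p q ∧ f p = f q) (f z) z)
    (hinj : ∀ a b c d, G.Adj a b → G.Adj c d → f a ≠ f b → f a = f c → f b = f d →
      a = c ∧ b = d) : IsFlat (quot f G) := by
  obtain ⟨m, s, hs⟩ := hG
  set H := quot f G with hH
  obtain ⟨t, ht⟩ : ∃ t : V → V → Fin m, ∀ a b, G.Adj a b → f a ≠ f b →
      t (f a) (f b) = s a b := by
    refine ⟨fun p q => if h : ∃ a b, G.Adj a b ∧ p ≠ q ∧ f a = p ∧ f b = q then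
      s h.choose h.choose_spec.choose else s p q, fun a b hab hne => ?_⟩
    have h : ∃ a' b', G.Adj a' b' ∧ f a ≠ f b ∧ f a' = f a ∧ f b' = f b := ⟨a, b, hab, hne, rfl, rfl⟩
    simp only [dif_pos h]
    obtain ⟨h1, h2, h3, h4⟩ := h.choose_spec.choose_spec
    obtain ⟨h5, h6⟩ := hinj _ _ _ _ hab h1 hne h3.symm h4.symm
    rw [← h6, ← h5]
  have hsum : ∀ (p : V) (A B : V → V → ZMod 2),
      (∀ a b, G.Adj a b → f a ≠ f b → B (f a) (f b) = A a b) →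
      ∑ q, (if H.Adj p q then B p q else 0) =
        ∑ a, ∑ b, if f a = p ∧ G.Adj a b ∧ f a ≠ f b then A a b else 0 := by
    intro p A B hAB
    have h1 : ∀ q, (if H.Adj p q then B p q else 0) =
        ∑ x : V × V, if f x.1 = p ∧ f x.2 = q ∧ G.Adj x.1 x.2 ∧ f x.1 ≠ f x.2 then A x.1 x.2
          else 0 := by
      intro q
      by_cases h : H.Adj p q
      · obtain ⟨hne, a, b, hab, rfl, rfl⟩ := h
        rw [if_pos ⟨hne, a, b, hab, rfl, rfl⟩, hAB a b hab hne, Finset.sum_eq_single (a, b)]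
        · simp [hab, hne]
        · rintro ⟨c, d⟩ - hcd
          rw [if_neg]
          rintro ⟨h1, h2, h3, h4⟩
          obtain ⟨h5, h6⟩ := hinj _ _ _ _ hab h3 hne h1.symm h2.symm
          exact hcd (by rw [h5, h6])
        · simp
      · rw [if_neg h, Finset.sum_eq_zero]
        rintro ⟨c, d⟩ -
        rw [if_neg]
        rintro ⟨h1, h2, h3, h4⟩
        exact h ⟨by rw [← h1, ← h2]; exact h4, c, d, h3, h1, h2⟩
    simp only [h1]
    rw [Finset.sum_comm, ← Finset.univ_product_univ, Finset.sum_product]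
    refine Finset.sum_congr rfl fun a _ => Finset.sum_congr rfl fun b _ => ?_
    rw [Finset.sum_eq_single (f b)]
    · simp
    · intro q _ hq
      rw [if_neg]
      rintro ⟨-, h, -⟩
      exact hq h.symm
    · simp
  refine ⟨m, t, ⟨fun h p => ?_, fun g hg => ?_⟩⟩
  · rw [hsum p (fun a b => h (s a b) + h (s b a)) (fun a b => h (t a b) + h (t b a))]
    · have h1 : ∀ a, ∑ b, (if f a = p ∧ G.Adj a b ∧ f a ≠ f b then h (s a b) + h (s b a) else 0) =
          ∑ b, (if f a = p ∧ f b = p ∧ G.Adj a b then h (s a b) else 0) +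
          ∑ b, (if f a = p ∧ f b = p ∧ G.Adj a b then h (s b a) else 0) := by
        intro a
        by_cases ha : f a = p
        · have := hs.closed h a
          rw [← CharTwo.add_eq_zero]
          refine Eq.trans ?_ this
          rw [← Finset.sum_add_distrib, ← Finset.sum_add_distrib]
          refine Finset.sum_congr rfl fun b _ => ?_
          by_cases hb : f b = p <;> by_cases hab : G.Adj a b <;>
            simp [ha, hb, hab, eq_comm (a := p)]
        · simp [ha]
      simp only [h1]
      rw [Finset.sum_add_distrib]
      have h2 : ∑ a, ∑ b, (if f a = p ∧ f b = p ∧ G.Adj a b then h (s b a) else 0) =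
          ∑ a, ∑ b, (if f a = p ∧ f b = p ∧ G.Adj a b then h (s a b) else 0) := by
        rw [Finset.sum_comm]
        refine Finset.sum_congr rfl fun a _ => Finset.sum_congr rfl fun b _ => ?_
        simp only [G.adj_comm b a]
        congr 1
        simp only [eq_iff_iff]
        tauto
      rw [h2, zmod_two_add_self]
    · intro a b hab hne
      rw [ht a b hab hne, ht b a hab.symm hne.symm]
  · obtain ⟨φ, hφ⟩ := hs.exact (fun e => if (e.map f).IsDiag then 0 else g (e.map f)) (by
      intro h
      refine Eq.trans (Eq.symm ?_) (hg h)
      have h1 : ∀ p, ∑ q, (if H.Adj p q then g s(p, q) * h (t p q) else 0) = _ := fun p =>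
        hsum p (fun a b => g s(f a, f b) * h (s a b)) (fun a b => g s(a, b) * h (t a b))
          (fun a b hab hne => by rw [ht a b hab hne])
      simp only [h1]
      rw [Finset.sum_comm]
      refine Finset.sum_congr rfl fun a _ => ?_
      rw [Finset.sum_comm]
      refine Finset.sum_congr rfl fun b _ => ?_
      by_cases hab : G.Adj a b <;> by_cases hne : f a = f b <;> simp [hab, hne])
    refine ⟨φ, ?_⟩
    have h1 : ∀ z, φ (f z) = φ z := by
      intro z
      have := hf z
      generalize f z = r at this
      induction this with
      | refl => rfl
      | tail _ h ih =>
        rw [ih]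
        have h2 := hφ _ _ h.1
        simp only [Sym2.map_mk, h.2, Sym2.mk_isDiag_iff, if_true] at h2
        exact (CharTwo.add_eq_zero.1 h2.symm)
    rintro p q ⟨hne, a, b, hab, rfl, rfl⟩
    have h2 := hφ a b hab
    rw [h1, h1, ← h2]
    simp [hne]

/-- Contraction of connected sets: flatness passes to the quotient along `f` if every fibre
contains its label `f z` and is connected. -/
theorem IsFlat.quot {G : SimpleGraph V} (hG : IsFlat G) (f : V → V)
    (hf : ∀ z, Relation.ReflTransGen (fun p q => G.Adj p q ∧ f p = f q) (f z) z) :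
    IsFlat (quot f G) := by
  -- of every class of edges that become parallel, only one is kept
  have h1 : ∀ e : Sym2 V, ∃ r : Sym2 V, (∃ r' ∈ G.edgeSet, r'.map f = e) →
      r ∈ G.edgeSet ∧ r.map f = e := by
    intro e
    by_cases h : ∃ r' ∈ G.edgeSet, r'.map f = e
    · exact ⟨h.choose, fun _ => h.choose_spec⟩
    · exact ⟨e, fun h' => absurd h' h⟩
  choose rep hrep using h1
  let G' : SimpleGraph V :=
    { Adj := fun a b => G.Adj a b ∧ (f a = f b ∨ rep s(f a, f b) = s(a, b))
      symm := ⟨fun a b h => ⟨h.1.symm, by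
        rcases h.2 with h2 | h2
        · exact Or.inl h2.symm
        · exact Or.inr (by rw [Sym2.eq_swap, h2, Sym2.eq_swap])⟩⟩
      loopless := ⟨fun a h => h.1.ne rfl⟩ }
  have hG' : IsFlat G' := hG.mono fun a b h => h.1
  have h2 := hG'.quot_of_injective f ?_ ?_
  · refine h2.mono ?_
    rintro p q ⟨hne, a, b, hab, rfl, rfl⟩
    obtain ⟨h3, h4⟩ := hrep s(f a, f b) ⟨s(a, b), hab, rfl⟩
    refine ⟨hne, ?_⟩
    generalize hr : rep s(f a, f b) = r at h3 h4
    induction r with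
    | h c d =>
      rw [Sym2.map_mk] at h4
      rcases Sym2.eq_iff.1 h4 with ⟨h5, h6⟩ | ⟨h5, h6⟩
      · exact ⟨c, d, ⟨h3, Or.inr (by rw [h5, h6, hr])⟩, h5, h6⟩
      · exact ⟨d, c, ⟨h3.symm, Or.inr (by rw [h5, h6, hr, Sym2.eq_swap])⟩, h6, h5⟩
  · intro z
    exact reflTransGen_mono (fun p q h => ⟨⟨h.1, Or.inl h.2⟩, h.2⟩) (hf z)
  · rintro a b c d ⟨hab, h3⟩ ⟨hcd, h4⟩ hne hac hbd
    rw [← hac, ← hbd] at h4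
    have h5 := h3.resolve_left hne
    have h6 := h4.resolve_left hne
    rcases Sym2.eq_iff.1 (h5.symm.trans h6) with h7 | h7
    · exact h7
    · rw [h7.1, ← hbd] at hne
      exact absurd rfl hne

end Flat

end AGraph
namespace AGraph

/-! ### Edge bounds and the non-flat graphs `K₅` and `K₃,₃` -/

section EdgeBound

open scoped Classical

variable {V : Type*} [Fintype V] {F : Type*}

theorem sum_sum_symm_eq_zero (T : V → V → ZMod 2) (hT : ∀ a b, T a b = T b a)
    (h0 : ∀ a, T a a = 0) : ∑ a, ∑ b, T a b = 0 := by
  rw [← Fintype.sum_prod_type' (f := T)]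
  refine Finset.sum_involution (fun p _ => p.swap) ?_ ?_ (fun _ _ => Finset.mem_univ _) ?_
  · rintro ⟨a, b⟩ -
    rw [hT]
    exact zmod_two_add_self _
  · rintro ⟨a, b⟩ - h1 h2
    obtain rfl : b = a := congrArg Prod.fst h2
    exact h1 (h0 b)
  · simp

/-- The Euler inequality: with `F'` the set of faces with a non-zero boundary,
`|E| + 2 ≤ |S| + |F'|`, up to a truncated subtraction for the case of no such face. -/
theorem IsFaceSystem.euler [Fintype F] {G : SimpleGraph V} {s : V → V → F}
    (hs : IsFaceSystem G s) {S : Finset V} (hS : ∀ a b, G.Adj a b → a ∈ S) (hne : S.Nonempty)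
    {F' : Finset F} (hF' : ∀ f, f ∈ F' ↔ ∃ a b, G.Adj a b ∧ s a b = f ∧ s b a ≠ f) :
    G.edgeFinset.card + 1 ≤ S.card + (F'.card - 1) := by
  -- the sum of `g` around a face
  set fs : (Sym2 V → ZMod 2) → F → ZMod 2 := fun g f =>
    ∑ a, ∑ b, (if G.Adj a b ∧ s a b = f then g s(a, b) else 0) with hfs
  have hadd : ∀ g g' f, fs (fun e => g e + g' e) f = fs g f + fs g' f := by
    intro g g' f
    simp only [hfs, ← Finset.sum_add_distrib]
    refine Finset.sum_congr rfl fun a _ => Finset.sum_congr rfl fun b _ => ?_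
    split_ifs <;> simp
  have htot : ∀ g, ∑ f, fs g f = 0 := by
    intro g
    simp only [hfs]
    rw [Finset.sum_comm]
    rw [Finset.sum_congr rfl fun a _ => Finset.sum_comm]
    have : ∀ a b, ∑ f, (if G.Adj a b ∧ s a b = f then g s(a, b) else 0) =
        if G.Adj a b then g s(a, b) else 0 := by
      intro a b
      by_cases hab : G.Adj a b <;> simp [hab]
    simp only [this]
    refine sum_sum_symm_eq_zero _ (fun a b => ?_) (by simp)
    simp only [G.adj_comm a b, Sym2.eq_swap (a := a)]
  have htriv : ∀ g f, f ∉ F' → fs g f = 0 := by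
    intro g f hf
    refine sum_sum_symm_eq_zero _ (fun a b => ?_) (by simp)
    have hf' : ∀ a b, G.Adj a b → s a b = f → s b a = f := by simpa [hF'] using hf
    have : (G.Adj a b ∧ s a b = f) ↔ (G.Adj b a ∧ s b a = f) :=
      ⟨fun h => ⟨h.1.symm, hf' _ _ h.1 h.2⟩, fun h => ⟨h.1.symm, hf' _ _ h.1 h.2⟩⟩
    simp only [this, Sym2.eq_swap (a := a)]
  -- one of the face sums is determined by the others
  obtain ⟨F'', hcard, hF''⟩ : ∃ F'' : Finset F, F''.card = F'.card - 1 ∧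
      ∀ g, (∀ f ∈ F'', fs g f = 0) → ∀ f, fs g f = 0 := by
    rcases F'.eq_empty_or_nonempty with h | ⟨f0, hf0⟩
    · exact ⟨∅, by simp [h], fun g _ f => htriv g f (by simp [h])⟩
    · refine ⟨F'.erase f0, Finset.card_erase_of_mem hf0, fun g hg => ?_⟩
      have h1 : ∀ f, f ≠ f0 → fs g f = 0 := fun f hf => by
        by_cases hfF : f ∈ F'
        · exact hg f (Finset.mem_erase.2 ⟨hf, hfF⟩)
        · exact htriv g f hfF
      intro f
      by_cases hf : f = f0
      · rw [hf, ← htot g, Finset.sum_eq_single f0 (fun f _ h => h1 f h) (by simp)]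
      · exact h1 f hf
  obtain ⟨v0, hv0⟩ := hne
  let ext : (G.edgeSet → ZMod 2) → Sym2 V → ZMod 2 := fun g e =>
    if h : e ∈ G.edgeSet then g ⟨e, h⟩ else 0
  have hrep : ∀ σ : F'' → ZMod 2, ∃ r : G.edgeSet → ZMod 2,
      (∃ r', (fun f : F'' => fs (ext r') f) = σ) → (fun f : F'' => fs (ext r) f) = σ := by
    intro σ
    by_cases h : ∃ r', (fun f : F'' => fs (ext r') f) = σ
    · exact ⟨h.choose, fun _ => h.choose_spec⟩
    · exact ⟨0, fun h' => absurd h' h⟩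
  choose rep hrep using hrep
  -- labellings are given by their face sums up to coboundaries
  let δ : (V → ZMod 2) → Sym2 V → ZMod 2 := fun φ =>
    Sym2.lift ⟨fun a b => φ a + φ b, fun a b => add_comm _ _⟩
  -- Such a labelling is therefore determined by `|F'| - 1` face sums and a potential on `S` that
  -- vanishes at `v0`; comparing cardinalities gives the inequality.
  let Ψ : (F'' → ZMod 2) × (↥(S.erase v0) → ZMod 2) → (G.edgeSet → ZMod 2) := fun x e =>
    rep x.1 e + δ (fun v => if h : v ∈ S.erase v0 then x.2 ⟨v, h⟩ else 0) e
  have hsurj : Function.Surjective Ψ := by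
    intro g
    set σ : F'' → ZMod 2 := fun f => fs (ext g) f with hσ
    have h1 : ∀ f, fs (fun e => ext g e + ext (rep σ) e) f = 0 := by
      refine hF'' (fun e => ext g e + ext (rep σ) e) fun f hf => ?_
      rw [hadd]
      have := congrFun (hrep σ ⟨g, rfl⟩) ⟨f, hf⟩
      simp only [hσ] at this
      rw [← this]
      exact zmod_two_add_self _
    obtain ⟨φ, hφ⟩ := hs.exact (fun e => ext g e + ext (rep σ) e) (by
      intro h
      have h2 : ∀ a b, (if G.Adj a b then (ext g s(a, b) + ext (rep σ) s(a, b)) * h (s a b) else 0) =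
          ∑ f, h f * (if G.Adj a b ∧ s a b = f then ext g s(a, b) + ext (rep σ) s(a, b) else 0) := by
        intro a b
        by_cases hab : G.Adj a b
        · simp [hab, mul_comm]
        · simp [hab]
      simp only [h2]
      rw [Finset.sum_congr rfl fun a _ => Finset.sum_comm, Finset.sum_comm]
      refine Finset.sum_eq_zero fun f _ => ?_
      simp only [← Finset.mul_sum]
      rw [show ∑ a, ∑ b, _ = fs (fun e => ext g e + ext (rep σ) e) f from rfl, h1, mul_zero])
    refine ⟨(σ, fun v => φ v + φ v0), ?_⟩
    funext ⟨e, he⟩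
    induction e with
    | h a b =>
      have hab : G.Adj a b := he
      have h3 := hφ a b hab
      have h4 : ∀ v ∈ S, (if h : v ∈ S.erase v0 then φ v + φ v0 else 0) = φ v + φ v0 := by
        intro v hv
        by_cases h : v = v0
        · simp [h, zmod_two_add_self]
        · simp [h, hv]
      have h5 : ∀ r : G.edgeSet → ZMod 2, ext r s(a, b) = r ⟨s(a, b), he⟩ := fun r => by
        simp [ext, hab]
      simp only [h5] at h3
      simp only [Ψ, δ, Sym2.lift_mk]
      rw [h4 a (hS a b hab), h4 b (hS b a hab.symm)]
      have h6 := zmod_two_add_self (rep σ ⟨s(a, b), he⟩)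
      have h7 := zmod_two_add_self (φ v0)
      linear_combination h6 + h7 - h3
  have h1 := Fintype.card_le_of_surjective Ψ hsurj
  simp only [Fintype.card_prod, Fintype.card_fun, ZMod.card, Fintype.card_coe, hcard,
    Finset.card_erase_of_mem hv0, ← pow_add] at h1
  have h2 := (Nat.pow_le_pow_iff_right (by norm_num : 1 < 2)).1 h1
  rw [← SimpleGraph.edgeFinset_card] at h2
  have := Finset.card_pos.2 ⟨v0, hv0⟩
  omega

/-- At every vertex an even number of edges have exactly one side on a given face. -/
theorem IsFaceSystem.exists_other {G : SimpleGraph V} {s : V → V → F} (hs : IsFaceSystem G s)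
    {f : F} {a b : V} (hab : G.Adj a b) (h : ¬ (s a b = f ↔ s b a = f)) :
    ∃ c, c ≠ b ∧ G.Adj a c ∧ ¬ (s a c = f ↔ s c a = f) := by
  by_contra! hcon
  have h1 := hs.closed (fun f' => if f' = f then 1 else 0) a
  rw [Finset.sum_eq_single b] at h1
  · rw [if_pos hab] at h1
    by_cases h2 : s a b = f <;> by_cases h3 : s b a = f <;> simp_all
  · intro c _ hc
    by_cases hac : G.Adj a c
    · have h2 := hcon c hc hac
      rw [if_pos hac]
      by_cases h3 : s a c = f
      · rw [if_pos h3, if_pos (h2.1 h3)]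
        exact zmod_two_add_self 1
      · rw [if_neg h3, if_neg (mt h2.2 h3), add_zero]
    · rw [if_neg hac]
  · simp

/-- The ordered edges with exactly one side on the face `f`. -/
noncomputable def faceDarts (G : SimpleGraph V) (s : V → V → F) (f : F) : Finset (V × V) :=
  Finset.univ.filter fun p => G.Adj p.1 p.2 ∧ ¬ (s p.1 p.2 = f ↔ s p.2 p.1 = f)

theorem mem_faceDarts {G : SimpleGraph V} {s : V → V → F} {f : F} {a b : V} (hab : G.Adj a b)
    (h : ¬ (s a b = f ↔ s b a = f)) : (a, b) ∈ faceDarts G s f ∧ (b, a) ∈ faceDarts G s f := by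
  simp only [faceDarts, Finset.mem_filter, Finset.mem_univ, true_and]
  exact ⟨⟨hab, h⟩, hab.symm, fun h2 => h h2.symm⟩

theorem IsFaceSystem.six_le_card_faceDarts {G : SimpleGraph V} {s : V → V → F}
    (hs : IsFaceSystem G s) {f : F} {a b : V} (hab : G.Adj a b) (h : ¬ (s a b = f ↔ s b a = f)) :
    6 ≤ (faceDarts G s f).card := by
  obtain ⟨c, hca, hbc, hc⟩ := hs.exists_other hab.symm fun h2 => h h2.symm
  obtain ⟨d, hdb, had, hd⟩ := hs.exists_other hab h
  have h1 : ({(a, b), (b, a), (b, c), (c, b), (a, d), (d, a)} : Finset (V × V)).card = 6 := by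
    repeat rw [Finset.card_insert_of_notMem]
    · simp
    all_goals simp [hca, hca.symm, hdb.symm, hab.ne, hab.ne', hbc.ne, hbc.ne', had.ne, had.ne']
  rw [← h1]
  refine Finset.card_le_card ?_
  simp [Finset.insert_subset_iff, mem_faceDarts hab h, mem_faceDarts hbc hc, mem_faceDarts had hd]

theorem IsFaceSystem.eight_le_card_faceDarts {G : SimpleGraph V} {s : V → V → F}
    (hs : IsFaceSystem G s) (htri : ∀ a b c, G.Adj a b → G.Adj b c → ¬ G.Adj a c)
    {f : F} {a b : V} (hab : G.Adj a b) (h : ¬ (s a b = f ↔ s b a = f)) :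
    8 ≤ (faceDarts G s f).card := by
  obtain ⟨c, hca, hbc, hc⟩ := hs.exists_other hab.symm fun h2 => h h2.symm
  obtain ⟨d, hdb, had, hd⟩ := hs.exists_other hab h
  obtain ⟨e, heb, hce, he⟩ := hs.exists_other hbc.symm fun h2 => hc h2.symm
  have hcd : c ≠ d := by
    rintro rfl
    exact htri a b c hab hbc had
  have h1 : ({(a, b), (b, a), (b, c), (c, b), (a, d), (d, a), (c, e), (e, c)} :
      Finset (V × V)).card = 8 := by
    repeat rw [Finset.card_insert_of_notMem]
    · simp
    all_goals simp [hca, hca.symm, hdb.symm, hab.ne, hab.ne', hbc.ne, hbc.ne', had.ne, had.ne',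
      hcd, hcd.symm, hce.ne, hce.ne', heb.symm]
  rw [← h1]
  refine Finset.card_le_card ?_
  simp [Finset.insert_subset_iff, mem_faceDarts hab h, mem_faceDarts hbc hc, mem_faceDarts had hd,
    mem_faceDarts hce he]

/-- Every edge lies on two faces, so the lengths of the faces add up to at most `2 |E|`. -/
theorem sum_card_faceDarts_le [Fintype F] (G : SimpleGraph V) (s : V → V → F) (F' : Finset F) :
    ∑ f ∈ F', (faceDarts G s f).card ≤ 4 * G.edgeFinset.card := by
  have h1 : ∑ f, (faceDarts G s f).card ≤ 4 * G.edgeFinset.card := by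
    have h2 : ∀ f, (faceDarts G s f).card =
        ∑ a, ∑ b, if G.Adj a b ∧ ¬ (s a b = f ↔ s b a = f) then 1 else 0 := by
      intro f
      rw [faceDarts, Finset.card_filter, ← Finset.univ_product_univ, Finset.sum_product]
    simp only [h2]
    rw [Finset.sum_comm, Finset.sum_congr rfl fun a _ => Finset.sum_comm]
    calc ∑ a, ∑ b, ∑ f, (if G.Adj a b ∧ ¬ (s a b = f ↔ s b a = f) then 1 else 0)
        ≤ ∑ a, ∑ b, 2 * (if G.Adj a b then 1 else 0) := by
          refine Finset.sum_le_sum fun a _ => Finset.sum_le_sum fun b _ => ?_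
          by_cases hab : G.Adj a b
          · calc _ ≤ ∑ f, ((if s a b = f then 1 else 0) + (if s b a = f then 1 else 0)) := by
                  refine Finset.sum_le_sum fun f _ => ?_
                  by_cases h3 : s a b = f <;> by_cases h4 : s b a = f <;> simp [h3, h4, hab]
              _ = _ := by simp [Finset.sum_add_distrib, hab]
          · simp [hab]
      _ = 2 * ∑ a, G.degree a := by
          simp only [← Finset.mul_sum]
          congr 1
          refine Finset.sum_congr rfl fun a _ => ?_
          rw [← SimpleGraph.card_neighborFinset_eq_degree, Finset.sum_boole]
          simp only [Nat.cast_id]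
          congr 1
          ext b
          simp
      _ = 4 * G.edgeFinset.card := by
          rw [SimpleGraph.sum_degrees_eq_twice_card_edges]
          ring
  exact (Finset.sum_le_univ_sum_of_nonneg (by simp)).trans h1

/-- The subgraph of edges inside `S`, on the same vertex type. -/
def restrictTo {V : Type*} (G : SimpleGraph V) (S : Finset V) : SimpleGraph V where
  Adj a b := G.Adj a b ∧ a ∈ S ∧ b ∈ S
  symm := ⟨fun _ _ h => ⟨h.1.symm, h.2.2, h.2.1⟩⟩
  loopless := ⟨fun _ h => h.1.ne rfl⟩

@[simp] theorem restrictTo_adj {V : Type*} {G : SimpleGraph V} {S : Finset V} {a b : V} :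
    (restrictTo G S).Adj a b ↔ G.Adj a b ∧ a ∈ S ∧ b ∈ S := Iff.rfl

theorem restrictTo_le {V : Type*} (G : SimpleGraph V) (S : Finset V) : restrictTo G S ≤ G :=
  fun _ _ h => h.1

theorem two_mul_card_edgeFinset_restrictTo (G : SimpleGraph V) (S : Finset V) :
    2 * (restrictTo G S).edgeFinset.card = ∑ a ∈ S, (S.filter (G.Adj a)).card := by
  rw [← SimpleGraph.sum_degrees_eq_twice_card_edges, ← Finset.sum_subset (Finset.subset_univ S)]
  · refine Finset.sum_congr rfl fun a ha => ?_
    rw [← SimpleGraph.card_neighborFinset_eq_degree]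
    congr 1
    ext b
    simp [ha, and_comm]
  · intro a _ ha
    rw [← SimpleGraph.card_neighborFinset_eq_degree, Finset.card_eq_zero]
    ext b
    simp [ha]

/-- A flat graph has at most `3 n - 6` edges on any `n ≥ 3` vertices. -/
theorem IsFlat.sum_card_filter_le {G : SimpleGraph V} (hG : IsFlat G) {S : Finset V}
    (hS : 3 ≤ S.card) : ∑ a ∈ S, (S.filter (G.Adj a)).card + 12 ≤ 6 * S.card := by
  rw [← two_mul_card_edgeFinset_restrictTo]
  obtain ⟨m, s, hs⟩ := hG.mono (restrictTo_le G S)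
  obtain ⟨F', hF'⟩ : ∃ F' : Finset (Fin m), ∀ f, f ∈ F' ↔
      ∃ a b, (restrictTo G S).Adj a b ∧ s a b = f ∧ s b a ≠ f :=
    ⟨Finset.univ.filter fun f => ∃ a b, (restrictTo G S).Adj a b ∧ s a b = f ∧ s b a ≠ f,
      fun f => by simp⟩
  have h1 := hs.euler (S := S) (fun a b h => h.2.1) (Finset.card_pos.1 (by omega)) hF'
  have h2 : F'.card * 6 ≤ 4 * (restrictTo G S).edgeFinset.card := by
    refine le_trans ?_ (sum_card_faceDarts_le (restrictTo G S) s F')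
    rw [← smul_eq_mul]
    refine Finset.card_nsmul_le_sum _ _ _ fun f hf => ?_
    obtain ⟨a, b, hab, h3, h4⟩ := (hF' f).1 hf
    exact hs.six_le_card_faceDarts hab (by simp [h3, h4])
  omega

/-- A triangle-free flat graph has at most `2 n - 4` edges on any `n ≥ 3` vertices. -/
theorem IsFlat.sum_card_filter_le_of_triangleFree {G : SimpleGraph V} (hG : IsFlat G)
    (htri : ∀ a b c, G.Adj a b → G.Adj b c → ¬ G.Adj a c) {S : Finset V}
    (hS : 3 ≤ S.card) : ∑ a ∈ S, (S.filter (G.Adj a)).card + 8 ≤ 4 * S.card := by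
  rw [← two_mul_card_edgeFinset_restrictTo]
  obtain ⟨m, s, hs⟩ := hG.mono (restrictTo_le G S)
  obtain ⟨F', hF'⟩ : ∃ F' : Finset (Fin m), ∀ f, f ∈ F' ↔
      ∃ a b, (restrictTo G S).Adj a b ∧ s a b = f ∧ s b a ≠ f :=
    ⟨Finset.univ.filter fun f => ∃ a b, (restrictTo G S).Adj a b ∧ s a b = f ∧ s b a ≠ f,
      fun f => by simp⟩
  have h1 := hs.euler (S := S) (fun a b h => h.2.1) (Finset.card_pos.1 (by omega)) hF'
  have h2 : F'.card * 8 ≤ 4 * (restrictTo G S).edgeFinset.card := by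
    refine le_trans ?_ (sum_card_faceDarts_le (restrictTo G S) s F')
    rw [← smul_eq_mul]
    refine Finset.card_nsmul_le_sum _ _ _ fun f hf => ?_
    obtain ⟨a, b, hab, h3, h4⟩ := (hF' f).1 hf
    exact hs.eight_le_card_faceDarts (fun a b c h5 h6 h7 => htri a b c h5.1 h6.1 h7.1) hab
      (by simp [h3, h4])
  omega

/-- A flat graph does not contain `K₅`. -/
theorem IsFlat.no_K5 {G : SimpleGraph V} (hG : IsFlat G) {a b c d e : V}
    (hab : G.Adj a b) (hac : G.Adj a c) (had : G.Adj a d) (hae : G.Adj a e)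
    (hbc : G.Adj b c) (hbd : G.Adj b d) (hbe : G.Adj b e)
    (hcd : G.Adj c d) (hce : G.Adj c e) (hde : G.Adj d e) : False := by
  have hS : ({a, b, c, d, e} : Finset V).card = 5 := by
    repeat rw [Finset.card_insert_of_notMem]
    · simp
    all_goals simp [hab.ne, hac.ne, had.ne, hae.ne, hbc.ne, hbd.ne, hbe.ne, hcd.ne, hce.ne, hde.ne]
  have h1 := hG.sum_card_filter_le (S := {a, b, c, d, e}) (by omega)
  have h2 : ∀ p ∈ ({a, b, c, d, e} : Finset V),
      4 ≤ (({a, b, c, d, e} : Finset V).filter (G.Adj p)).card := by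
    intro p hp
    have h3 : ({a, b, c, d, e} : Finset V).erase p ⊆
        ({a, b, c, d, e} : Finset V).filter (G.Adj p) := by
      intro q hq
      rw [Finset.mem_erase] at hq
      refine Finset.mem_filter.2 ⟨hq.2, ?_⟩
      simp only [Finset.mem_insert, Finset.mem_singleton] at hp hq
      rcases hp with rfl | rfl | rfl | rfl | rfl <;>
        rcases hq with ⟨hne, rfl | rfl | rfl | rfl | rfl⟩ <;>
        first | exact absurd rfl hne | assumption | (apply SimpleGraph.Adj.symm; assumption)
    have := Finset.card_le_card h3
    rwa [Finset.card_erase_of_mem hp, hS] at this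
  have h3 := Finset.card_nsmul_le_sum _ _ _ h2
  rw [hS] at h3 h1
  simp only [smul_eq_mul] at h3
  omega

/-- A flat graph does not contain `K₃,₃`. -/
theorem IsFlat.no_K33 {G : SimpleGraph V} (hG : IsFlat G) {A B : Finset V} (hA : A.card = 3)
    (hB : B.card = 3) (h : ∀ a ∈ A, ∀ b ∈ B, G.Adj a b) : False := by
  have hdisj : Disjoint A B := Finset.disjoint_left.2 fun a ha hb => (h a ha a hb).ne rfl
  obtain ⟨H, hH'⟩ : ∃ H : SimpleGraph V, ∀ p q, H.Adj p q ↔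
      G.Adj p q ∧ (p ∈ A ∧ q ∈ B ∨ p ∈ B ∧ q ∈ A) :=
    ⟨{ Adj := fun p q => G.Adj p q ∧ (p ∈ A ∧ q ∈ B ∨ p ∈ B ∧ q ∈ A)
       symm := ⟨fun p q h => ⟨h.1.symm, by tauto⟩⟩
       loopless := ⟨fun _ h => h.1.ne rfl⟩ }, fun _ _ => Iff.rfl⟩
  have hH : IsFlat H := hG.mono fun _ _ h => ((hH' _ _).1 h).1
  have hS : (A ∪ B).card = 6 := by rw [Finset.card_union_of_disjoint hdisj, hA, hB]
  have hAB : ∀ a, a ∈ A → a ∉ B := fun a ha hb => Finset.disjoint_left.1 hdisj ha hb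
  have h1 := hH.sum_card_filter_le_of_triangleFree (S := A ∪ B) (by
    intro a b c
    simp only [hH']
    rintro ⟨-, h1⟩ ⟨-, h2⟩ ⟨-, h3⟩
    have := hAB a
    have := hAB b
    have := hAB c
    tauto) (by omega)
  have h2 : ∀ p ∈ A ∪ B, 3 ≤ ((A ∪ B).filter (H.Adj p)).card := by
    intro p hp
    rcases Finset.mem_union.1 hp with hp | hp
    · rw [← hB]
      refine Finset.card_le_card fun q hq => ?_
      exact Finset.mem_filter.2 ⟨Finset.mem_union_right _ hq, (hH' _ _).2 ⟨h p hp q hq, Or.inl ⟨hp, hq⟩⟩⟩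
    · rw [← hA]
      refine Finset.card_le_card fun q hq => ?_
      exact Finset.mem_filter.2 ⟨Finset.mem_union_left _ hq, (hH' _ _).2 ⟨(h q hq p hp).symm, Or.inr ⟨hp, hq⟩⟩⟩
  have h3 := Finset.card_nsmul_le_sum _ _ _ h2
  rw [hS] at h3 h1
  simp only [smul_eq_mul] at h3
  omega

end EdgeBound

end AGraph
namespace AGraph

/-! ### Cutting off the corner of a face -/

section Links

open scoped Classical

variable {V : Type*} [Fintype V] {F : Type*}

theorem sum_ite_sym2_eq (z : ZMod 2) {a b : V} (hab : a ≠ b) (p : V) :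
    ∑ q, (if s(p, q) = s(a, b) then z else 0) = (if p = a ∨ p = b then z else 0) := by
  by_cases h1 : p = a
  · subst h1
    rw [Finset.sum_eq_single b]
    · simp
    · intro q _ hq
      rw [if_neg]
      intro h
      rcases Sym2.eq_iff.1 h with ⟨-, h⟩ | ⟨h1, h2⟩
      exacts [hq h, hq (h2.trans h1)]
    · simp
  · by_cases h2 : p = b
    · subst h2
      rw [Finset.sum_eq_single a]
      · simp [Sym2.eq_swap]
      · intro q _ hq
        rw [if_neg]
        intro h
        rcases Sym2.eq_iff.1 h with ⟨h1, h2⟩ | ⟨-, h⟩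
        exacts [hq (h2.trans h1), hq h]
      · simp
    · rw [if_neg (by tauto), Finset.sum_eq_zero]
      intro q _
      rw [if_neg]
      simp [h1, h2]

/-- A corner of a face can be cut off: if the edges `w a` and `w b` lie on a common face, then
the edge `a b` may be added. -/
theorem IsFaceSystem.isFlat_sup_edge [Finite F] {G : SimpleGraph V} {s : V → V → F}
    (hs : IsFaceSystem G s) {w a b : V} {f : F} (hwa : G.Adj w a) (hwb : G.Adj w b) (hab : a ≠ b)
    (hnab : ¬ G.Adj a b) (hfa : s w a = f ∨ s a w = f) (hfb : s w b = f ∨ s b w = f) :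
    IsFlat (G ⊔ SimpleGraph.edge a b) := by
  -- the oriented edges `d₁`, `d₂` along the corner get the new face `none`
  obtain ⟨d₁, hd₁, hd₁f⟩ : ∃ d : V × V, (d = (w, a) ∨ d = (a, w)) ∧ s d.1 d.2 = f := by
    rcases hfa with h | h
    · exact ⟨(w, a), Or.inl rfl, h⟩
    · exact ⟨(a, w), Or.inr rfl, h⟩
  obtain ⟨d₂, hd₂, hd₂f⟩ : ∃ d : V × V, (d = (w, b) ∨ d = (b, w)) ∧ s d.1 d.2 = f := by
    rcases hfb with h | h
    · exact ⟨(w, b), Or.inl rfl, h⟩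
    · exact ⟨(b, w), Or.inr rfl, h⟩
  set t : V → V → Option F := fun p q =>
    if (p, q) = (a, b) then some f else if (p, q) = (b, a) ∨ (p, q) = d₁ ∨ (p, q) = d₂ then none
    else some (s p q) with ht
  obtain ⟨H, hH⟩ : ∃ H, H = G ⊔ SimpleGraph.edge a b := ⟨_, rfl⟩
  rw [← hH]
  have hadj : ∀ p q, H.Adj p q ↔ G.Adj p q ∨ s(p, q) = s(a, b) := by
    intro p q
    rw [hH, SimpleGraph.sup_adj, SimpleGraph.edge_adj]
    constructor
    · rintro (h | ⟨h, -⟩)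
      · exact Or.inl h
      · exact Or.inr (by simpa using h)
    · rintro (h | h)
      · exact Or.inl h
      · rcases Sym2.eq_iff.1 h with ⟨rfl, rfl⟩ | ⟨rfl, rfl⟩
        · exact Or.inr ⟨by simp, hab⟩
        · exact Or.inr ⟨by simp, hab.symm⟩
  have hwa' := hwa.ne
  have hwb' := hwb.ne
  have hG : ∀ p q, G.Adj p q → s(p, q) ≠ s(a, b) := by
    intro p q h h'
    rcases Sym2.eq_iff.1 h' with ⟨rfl, rfl⟩ | ⟨rfl, rfl⟩
    · exact hnab h
    · exact hnab h.symm
  have htG : ∀ p q, G.Adj p q → t p q = if (p, q) = d₁ ∨ (p, q) = d₂ then none else some (s p q) := by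
    intro p q h
    have h1 : (p, q) ≠ (a, b) := fun h' => hG p q h (by
      rw [(Prod.mk.inj h').1, (Prod.mk.inj h').2])
    have h2 : (p, q) ≠ (b, a) := fun h' => hG p q h (by
      rw [(Prod.mk.inj h').1, (Prod.mk.inj h').2, Sym2.eq_swap])
    simp only [ht, if_neg h1, h2, false_or]
  have hd₁₂ : d₁ ≠ d₂ := by
    rcases hd₁ with rfl | rfl <;> rcases hd₂ with rfl | rfl <;> simp [hab, hwb', hwa'.symm]
  have hts : IsFaceSystem H t := by
    constructor
    · intro h p
      -- Modulo two, the boundary at `p` changes by `D` on each edge of the triangle `w a b`, and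
      -- `p` lies on none or two of these.
      set D := h none + h (some f) with hD
      have h1 : ∀ q, (if H.Adj p q then h (t p q) + h (t q p) else 0) =
          (if G.Adj p q then h (some (s p q)) + h (some (s q p)) else 0) +
          ((if s(p, q) = s(w, a) then D else 0) + (if s(p, q) = s(w, b) then D else 0) +
            (if s(p, q) = s(a, b) then D else 0)) := by
        intro q
        by_cases hpq : G.Adj p q
        · rw [if_pos ((hadj p q).2 (Or.inl hpq)), if_pos hpq, if_neg (hG p q hpq),
            htG p q hpq, htG q p hpq.symm]
          have hc := zmod_two_add_self (h (some f))
          by_cases h2 : s(p, q) = s(w, a)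
          · have h3 : s(p, q) ≠ s(w, b) := by
              rw [h2]
              simp [hab, hwb']
            rw [if_pos h2, if_neg h3]
            have h4 : ((p, q) = d₁ ∧ (q, p) ≠ d₁) ∨ ((p, q) ≠ d₁ ∧ (q, p) = d₁) := by
              rcases Sym2.eq_iff.1 h2 with ⟨rfl, rfl⟩ | ⟨rfl, rfl⟩ <;>
                rcases hd₁ with rfl | rfl <;> simp [hwa', hwa'.symm]
            have h5 : (p, q) ≠ d₂ ∧ (q, p) ≠ d₂ := by
              rcases Sym2.eq_iff.1 h2 with ⟨rfl, rfl⟩ | ⟨rfl, rfl⟩ <;>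
                rcases hd₂ with rfl | rfl <;> simp [hab, hwb', hwa'.symm]
            rcases h4 with ⟨h4, h6⟩ | ⟨h6, h4⟩
            · rw [if_pos (Or.inl h4), if_neg (by tauto)]
              have : s p q = f := by rw [← hd₁f, ← h4]
              rw [this]
              linear_combination -hc
            · rw [if_neg (by tauto), if_pos (Or.inl h4)]
              have : s q p = f := by rw [← hd₁f, ← h4]
              rw [this]
              linear_combination -hc
          · rw [if_neg h2]
            have h4 : (p, q) ≠ d₁ ∧ (q, p) ≠ d₁ := by
              constructor
              · rintro rfl
                rcases hd₁ with h5 | h5 <;> obtain ⟨rfl, rfl⟩ := Prod.mk.inj h5 <;> simp at h2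
              · rintro rfl
                rcases hd₁ with h5 | h5 <;> obtain ⟨rfl, rfl⟩ := Prod.mk.inj h5 <;> simp at h2
            by_cases h3 : s(p, q) = s(w, b)
            · rw [if_pos h3]
              have h5 : ((p, q) = d₂ ∧ (q, p) ≠ d₂) ∨ ((p, q) ≠ d₂ ∧ (q, p) = d₂) := by
                rcases Sym2.eq_iff.1 h3 with ⟨rfl, rfl⟩ | ⟨rfl, rfl⟩ <;>
                  rcases hd₂ with rfl | rfl <;> simp [hwb', hwb'.symm]
              rcases h5 with ⟨h5, h6⟩ | ⟨h6, h5⟩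
              · rw [if_pos (Or.inr h5), if_neg (by tauto)]
                have : s p q = f := by rw [← hd₂f, ← h5]
                rw [this]
                linear_combination -hc
              · rw [if_neg (by tauto), if_pos (Or.inr h5)]
                have : s q p = f := by rw [← hd₂f, ← h5]
                rw [this]
                linear_combination -hc
            · rw [if_neg h3]
              have h5 : (p, q) ≠ d₂ ∧ (q, p) ≠ d₂ := by
                constructor
                · rintro rfl
                  rcases hd₂ with h5 | h5 <;> obtain ⟨rfl, rfl⟩ := Prod.mk.inj h5 <;> simp at h3
                · rintro rfl
                  rcases hd₂ with h5 | h5 <;> obtain ⟨rfl, rfl⟩ := Prod.mk.inj h5 <;> simp at h3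
              rw [if_neg (by tauto), if_neg (by tauto)]
              ring
        · rw [if_neg hpq]
          have h2 : s(p, q) ≠ s(w, a) := by
            intro h'
            rcases Sym2.eq_iff.1 h' with ⟨rfl, rfl⟩ | ⟨rfl, rfl⟩
            exacts [hpq hwa, hpq hwa.symm]
          have h3 : s(p, q) ≠ s(w, b) := by
            intro h'
            rcases Sym2.eq_iff.1 h' with ⟨rfl, rfl⟩ | ⟨rfl, rfl⟩
            exacts [hpq hwb, hpq hwb.symm]
          rw [if_neg h2, if_neg h3]
          by_cases h4 : s(p, q) = s(a, b)
          · rw [if_pos ((hadj p q).2 (Or.inr h4)), if_pos h4]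
            rcases Sym2.eq_iff.1 h4 with ⟨rfl, rfl⟩ | ⟨rfl, rfl⟩
            · simp [ht, hab, hab.symm, hD, add_comm]
            · simp [ht, hab, hab.symm, hD]
          · rw [if_neg h4, if_neg]
            · ring
            · rw [hadj]
              tauto
      simp only [h1, Finset.sum_add_distrib]
      rw [sum_ite_sym2_eq D hwa', sum_ite_sym2_eq D hwb', sum_ite_sym2_eq D hab,
        hs.closed (fun f' => h (some f')) p]
      have hc := zmod_two_add_self D
      by_cases h2 : p = w
      · subst h2
        simp [hwa', hwb', hc]
      · by_cases h3 : p = a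
        · subst h3
          simp [hab, hwa'.symm, hc]
        · by_cases h4 : p = b
          · subst h4
            simp [hab.symm, hwb'.symm, hc]
          · simp [h2, h3, h4]
    · intro g hg
      obtain ⟨φ, hφ⟩ := hs.exact g (by
        intro h
        refine Eq.trans ?_ (hg fun o => o.elim (h f) h)
        have h1 : ∀ p q, (if H.Adj p q then g s(p, q) * (fun o : Option F => o.elim (h f) h) (t p q)
            else 0) = (if G.Adj p q then g s(p, q) * h (s p q) else 0) +
              (if s(p, q) = s(a, b) then g s(a, b) * h f else 0) := by
          intro p q
          by_cases hpq : G.Adj p q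
          · rw [if_pos ((hadj p q).2 (Or.inl hpq)), if_pos hpq, if_neg (hG p q hpq), htG p q hpq,
              add_zero]
            split_ifs with h2
            · have : s p q = f := by
                rcases h2 with h2 | h2
                · rw [← hd₁f, ← h2]
                · rw [← hd₂f, ← h2]
              simp [this]
            · simp
          · rw [if_neg hpq]
            by_cases h4 : s(p, q) = s(a, b)
            · rw [if_pos ((hadj p q).2 (Or.inr h4)), if_pos h4, h4]
              rcases Sym2.eq_iff.1 h4 with ⟨rfl, rfl⟩ | ⟨rfl, rfl⟩
              · simp [ht]
              · simp [ht, hab.symm]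
            · rw [if_neg h4, if_neg, add_zero]
              rw [hadj]
              tauto
        simp only [h1, Finset.sum_add_distrib]
        simp only [sum_ite_sym2_eq _ hab]
        rw [Finset.sum_ite, Finset.sum_const_zero, add_zero, Finset.sum_const,
          show (Finset.univ.filter fun p => p = a ∨ p = b) = {a, b} by ext; simp,
          Finset.card_pair hab, two_nsmul, zmod_two_add_self, add_zero])
      have h2 := hg fun o => if o = none then 1 else 0
      have h1 : ∀ p q, (if H.Adj p q then g s(p, q) * (fun o : Option F => if o = none then (1 : ZMod 2)
            else 0) (t p q) else 0) = (if (p, q) = (b, a) then g s(a, b) else 0) +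
              ((if (p, q) = d₁ then g s(w, a) else 0) + (if (p, q) = d₂ then g s(w, b) else 0)) := by
        intro p q
        have e1 : (p, q) = d₁ → G.Adj p q ∧ s(p, q) = s(w, a) := by
          rintro rfl
          rcases hd₁ with h5 | h5 <;> obtain ⟨rfl, rfl⟩ := Prod.mk.inj h5
          · exact ⟨hwa, rfl⟩
          · exact ⟨hwa.symm, Sym2.eq_swap⟩
        have e2 : (p, q) = d₂ → G.Adj p q ∧ s(p, q) = s(w, b) := by
          rintro rfl
          rcases hd₂ with h5 | h5 <;> obtain ⟨rfl, rfl⟩ := Prod.mk.inj h5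
          · exact ⟨hwb, rfl⟩
          · exact ⟨hwb.symm, Sym2.eq_swap⟩
        by_cases hpq : G.Adj p q
        · have e3 : (p, q) ≠ (b, a) := fun h' => hG p q hpq (by
            rw [(Prod.mk.inj h').1, (Prod.mk.inj h').2, Sym2.eq_swap])
          rw [if_pos ((hadj p q).2 (Or.inl hpq)), if_neg e3, htG p q hpq, zero_add]
          by_cases h3 : (p, q) = d₁
          · have h4 : (p, q) ≠ d₂ := fun h' => hd₁₂ (h3.symm.trans h')
            rw [if_pos h3, if_neg h4, (e1 h3).2]
            simp [h3]
          · by_cases h4 : (p, q) = d₂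
            · rw [if_neg h3, if_pos h4, (e2 h4).2]
              simp [h4]
            · rw [if_neg h3, if_neg h4, if_neg (by tauto)]
              simp
        · rw [if_neg fun h' => hpq (e1 h').1, if_neg fun h' => hpq (e2 h').1]
          by_cases h4 : s(p, q) = s(a, b)
          · rw [if_pos ((hadj p q).2 (Or.inr h4)), h4]
            rcases Sym2.eq_iff.1 h4 with ⟨rfl, rfl⟩ | ⟨rfl, rfl⟩
            · simp [ht, hab]
            · simp [ht, hab.symm]
          · rw [if_neg, if_neg]
            · simp
            · intro h'
              exact h4 (by rw [(Prod.mk.inj h').1, (Prod.mk.inj h').2, Sym2.eq_swap])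
            · rw [hadj]
              tauto
      have h3 : ∀ (d : V × V) (z : ZMod 2), ∑ p, ∑ q, (if (p, q) = d then z else 0) = z := by
        intro d z
        rw [← Fintype.sum_prod_type' (f := fun p q => if (p, q) = d then z else 0)]
        simp
      simp only [h1, Finset.sum_add_distrib, h3] at h2
      refine ⟨φ, ?_⟩
      have h4 : g s(a, b) = φ a + φ b := by
        have h5 := hφ w a hwa
        have h6 := hφ w b hwb
        have h7 := zmod_two_add_self (φ w)
        have h8 := zmod_two_add_self (φ a)
        have h9 := zmod_two_add_self (φ b)
        linear_combination h2 - h5 - h6 - h7 - h8 - h9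
      intro p q hpq
      rcases (hadj p q).1 hpq with h | h
      · exact hφ p q h
      · rw [h]
        rcases Sym2.eq_iff.1 h with ⟨rfl, rfl⟩ | ⟨rfl, rfl⟩
        · exact h4
        · rw [h4, add_comm]
  exact hts.isFlat

end Links

end AGraph
namespace AGraph

/-! ### The neighbours of a vertex of a maximal flat graph -/

section Links

open scoped Classical

variable {V : Type*} [Fintype V]

/-- The neighbours of a vertex, as a finset. -/
noncomputable def nbhd (G : SimpleGraph V) (w : V) : Finset V := Finset.univ.filter (G.Adj w)

@[simp] theorem mem_nbhd {G : SimpleGraph V} {w a : V} : a ∈ nbhd G w ↔ G.Adj w a := by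
  simp [nbhd]

/-- There is a path from `a` to `b` all of whose vertices after `a` avoid `K`. -/
def ReachOff (G : SimpleGraph V) (K : Finset V) (a b : V) : Prop :=
  Relation.ReflTransGen (fun p q => G.Adj p q ∧ q ∉ K) a b

/-- No edge can be added at corners: the form of maximality of a flat graph that makes all links
cycles. -/
def IsCornerClosed (G : SimpleGraph V) : Prop :=
  ∀ w a b, G.Adj w a → G.Adj w b → a ≠ b → ¬ G.Adj a b → ¬ IsFlat (G ⊔ SimpleGraph.edge a b)

/-- In a graph to which no corner chord can be added, the faces at a vertex `w` that is not a cut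
vertex induce on its neighbours a connected 2-regular relation `L` contained in adjacency, so the
neighbours form a cycle. -/
theorem IsFlat.exists_link {G : SimpleGraph V} (hG : IsFlat G) (hmax : IsCornerClosed G) {w : V}
    (hdeg : 3 ≤ (nbhd G w).card)
    (hcut : ∀ a b, G.Adj w a → G.Adj w b → ReachOff G {w} a b) :
    ∃ L : V → V → Prop, (∀ a b, L a b → L b a) ∧ (∀ a b, L a b → G.Adj w a ∧ G.Adj w b ∧ G.Adj a b) ∧
      (∀ a, G.Adj w a → ∃ b c, b ≠ c ∧ ∀ z, L a z ↔ z = b ∨ z = c) ∧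
      ∀ A : Finset V, A.Nonempty → A ⊆ nbhd G w → (∀ a ∈ A, ∀ b, L a b → b ∈ A) → A = nbhd G w := by
  obtain ⟨m, s, hs⟩ := hG
  -- `single f a`: the edge `w a` has exactly one side on the face `f`
  set single : Fin m → V → Prop := fun f a => G.Adj w a ∧ ¬ (s w a = f ↔ s a w = f) with hsingle
  have hcorner : ∀ f a b, single f a → single f b → a ≠ b → G.Adj a b := by
    intro f a b ha hb hab
    by_contra hnab
    exact hmax w a b ha.1 hb.1 hab hnab (hs.isFlat_sup_edge (f := f) ha.1 hb.1 hab hnab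
      (by have := ha.2; tauto) (by have := hb.2; tauto))
  -- modulo two, the number of sides on `f` only counts the edges with a single side on `f`
  have hpar : ∀ (A : Finset V) (f : Fin m), A ⊆ nbhd G w →
      ∑ a ∈ A, ((if s w a = f then 1 else 0) + (if s a w = f then 1 else 0) : ZMod 2) =
        ((A.filter (single f)).card : ZMod 2) := by
    intro A f hA
    rw [Finset.card_filter, Nat.cast_sum]
    refine Finset.sum_congr rfl fun a ha => ?_
    have hwa := mem_nbhd.1 (hA ha)
    by_cases h1 : s w a = f <;> by_cases h2 : s a w = f <;> simp [hwa, h1, h2]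
    exact zmod_two_add_self 1
  have heven : ∀ f, Even ((nbhd G w).filter (single f)).card := by
    intro f
    rw [← ZMod.natCast_eq_zero_iff_even, ← hpar _ f subset_rfl]
    refine Eq.trans ?_ (hs.closed (fun f' => if f' = f then 1 else 0) w)
    rw [nbhd, Finset.sum_filter]
  -- four neighbours at the same face would be pairwise adjacent and form a `K₅` with `w`
  have htwo : ∀ f a, single f a → ((nbhd G w).filter (single f)).card = 2 := by
    intro f a ha
    have h1 : 0 < ((nbhd G w).filter (single f)).card :=
      Finset.card_pos.2 ⟨a, by simp [ha, ha.1]⟩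
    by_contra h2
    have h3 : 4 ≤ ((nbhd G w).filter (single f)).card := by
      obtain ⟨k, hk⟩ := heven f
      omega
    obtain ⟨t, ht, ht4⟩ := Finset.exists_subset_card_eq h3
    obtain ⟨p, t', hp, rfl, ht3⟩ := Finset.card_eq_succ.1 ht4
    obtain ⟨q, r, u, hqr, hqu, hru, rfl⟩ := Finset.card_eq_three.1 ht3
    have hm : ∀ z ∈ insert p ({q, r, u} : Finset V), single f z := fun z hz =>
      (Finset.mem_filter.1 (ht hz)).2
    simp only [Finset.mem_insert, Finset.mem_singleton, not_or] at hp
    have hp' := hm p (by simp)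
    have hq' := hm q (by simp)
    have hr' := hm r (by simp)
    have hu' := hm u (by simp)
    exact IsFlat.no_K5 ⟨m, s, hs⟩ hp'.1 hq'.1 hr'.1 hu'.1 (hcorner f _ _ hp' hq' hp.1)
      (hcorner f _ _ hp' hr' hp.2.1) (hcorner f _ _ hp' hu' hp.2.2) (hcorner f _ _ hq' hr' hqr)
      (hcorner f _ _ hq' hu' hqu) (hcorner f _ _ hr' hu' hru)
  have hother : ∀ f a, single f a → ∃ b, b ≠ a ∧ ∀ z, single f z ↔ z = a ∨ z = b := by
    intro f a ha
    obtain ⟨p, q, hpq, h⟩ := Finset.card_eq_two.1 (htwo f a ha)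
    have h1 : ∀ z, single f z ↔ z = p ∨ z = q := by
      intro z
      have h2 : z ∈ (nbhd G w).filter (single f) ↔ z = p ∨ z = q := by
        rw [h]
        simp
      rw [← h2, Finset.mem_filter, mem_nbhd]
      exact ⟨fun hz => ⟨hz.1, hz⟩, fun hz => hz.2⟩
    rcases (h1 a).1 ha with rfl | rfl
    · exact ⟨q, hpq.symm, h1⟩
    · exact ⟨p, hpq, fun z => (h1 z).trans or_comm⟩
  set L : V → V → Prop := fun a b => a ≠ b ∧ ∃ f, single f a ∧ single f b with hL
  -- The labelling of the edges from `w` to a closed set `A` of neighbours is orthogonal to all face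
  -- boundaries, so these edges form a cut. As the neighbours of `w` are connected off `w`, the cut
  -- contains all edges at `w`.
  have hclosed : ∀ A : Finset V, A.Nonempty → A ⊆ nbhd G w → (∀ a ∈ A, ∀ b, L a b → b ∈ A) →
      A = nbhd G w := by
    intro A hne hA hcl
    obtain ⟨φ, hφ⟩ := hs.exact (fun e => if ∃ a ∈ A, e = s(w, a) then 1 else 0) (by
      intro h
      have h1 : ∀ p q, (if G.Adj p q then (if ∃ a ∈ A, s(p, q) = s(w, a) then (1 : ZMod 2) else 0) *
          h (s p q) else 0) = (if p = w ∧ q ∈ A then h (s p q) else 0) +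
            (if q = w ∧ p ∈ A then h (s p q) else 0) := by
        intro p q
        by_cases hpq : G.Adj p q
        · have h2 : (∃ a ∈ A, s(p, q) = s(w, a)) ↔ (p = w ∧ q ∈ A) ∨ (q = w ∧ p ∈ A) := by
            constructor
            · rintro ⟨a, ha, h2⟩
              rcases Sym2.eq_iff.1 h2 with ⟨rfl, rfl⟩ | ⟨rfl, rfl⟩
              · exact Or.inl ⟨rfl, ha⟩
              · exact Or.inr ⟨rfl, ha⟩
            · rintro (⟨rfl, h2⟩ | ⟨rfl, h2⟩)
              · exact ⟨q, h2, rfl⟩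
              · exact ⟨p, h2, Sym2.eq_swap⟩
          simp only [h2]
          have h3 : ¬ ((p = w ∧ q ∈ A) ∧ (q = w ∧ p ∈ A)) := by
            rintro ⟨⟨rfl, -⟩, rfl, -⟩
            exact hpq.ne rfl
          by_cases h4 : p = w ∧ q ∈ A <;> by_cases h5 : q = w ∧ p ∈ A
          · exact absurd ⟨h4, h5⟩ h3
          · rw [if_pos hpq, if_pos (Or.inl h4), if_pos h4, if_neg h5]
            ring
          · rw [if_pos hpq, if_pos (Or.inr h5), if_neg h4, if_pos h5]
            ring
          · rw [if_pos hpq, if_neg (by tauto), if_neg h4, if_neg h5]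
            ring
        · rw [if_neg hpq, if_neg, if_neg, add_zero]
          · rintro ⟨rfl, h2⟩
            exact hpq (mem_nbhd.1 (hA h2)).symm
          · rintro ⟨rfl, h2⟩
            exact hpq (mem_nbhd.1 (hA h2))
      simp only [h1, Finset.sum_add_distrib]
      have h2 : ∑ p, ∑ q, (if p = w ∧ q ∈ A then h (s p q) else 0) = ∑ a ∈ A, h (s w a) := by
        rw [Finset.sum_eq_single w]
        · simp
        · intro p _ hp
          simp [hp]
        · simp
      have h3 : ∑ p, ∑ q, (if q = w ∧ p ∈ A then h (s p q) else 0) = ∑ a ∈ A, h (s a w) := by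
        rw [Finset.sum_comm, Finset.sum_eq_single w]
        · simp
        · intro p _ hp
          simp [hp]
        · simp
      rw [h2, h3, ← Finset.sum_add_distrib]
      have h4 : ∀ f, h f = ∑ f', h f' * (if f = f' then 1 else 0) := by
        intro f
        simp
      have h5 : ∀ a, h (s w a) + h (s a w) = ∑ f', h f' * ((if s w a = f' then 1 else 0) +
          (if s a w = f' then 1 else 0)) := by
        intro a
        simp only [mul_add, Finset.sum_add_distrib, ← h4]
      simp only [h5]
      rw [Finset.sum_comm]
      refine Finset.sum_eq_zero fun f _ => ?_
      rw [← Finset.mul_sum, hpar A f hA]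
      by_cases h6 : ∃ a ∈ A, single f a
      · obtain ⟨a, ha, haf⟩ := h6
        have h7 : A.filter (single f) = (nbhd G w).filter (single f) := by
          ext z
          simp only [Finset.mem_filter]
          refine ⟨fun hz => ⟨hA hz.1, hz.2⟩, fun hz => ⟨?_, hz.2⟩⟩
          by_cases haz : a = z
          · rwa [← haz]
          · exact hcl a ha z ⟨haz, f, haf, hz.2⟩
        rw [h7, htwo f a haf]
        rw [show ((2 : ℕ) : ZMod 2) = 0 from rfl, mul_zero]
      · push Not at h6
        rw [Finset.filter_false_of_mem h6]
        simp)
    refine Finset.Subset.antisymm hA fun b hb => ?_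
    by_contra hbA
    obtain ⟨a, ha⟩ := hne
    have h1 : φ a = φ b := by
      have := hcut a b (mem_nbhd.1 (hA ha)) (mem_nbhd.1 hb)
      clear hb hbA
      have haw : a ≠ w := (mem_nbhd.1 (hA ha)).ne'
      have h2 : φ a = φ b ∧ b ≠ w := by
        induction this with
        | refl => exact ⟨rfl, haw⟩
        | tail _ h ih =>
          obtain ⟨ih1, ih2⟩ := ih
          have h3 := hφ _ _ h.1
          have h5 := h.2
          rw [Finset.mem_singleton] at h5
          rw [if_neg] at h3
          · exact ⟨ih1.trans (CharTwo.add_eq_zero.1 h3.symm), h5⟩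
          · rintro ⟨c, -, hc⟩
            rcases Sym2.eq_iff.1 hc with ⟨h4, -⟩ | ⟨-, h4⟩
            · exact ih2 h4
            · exact h5 h4
      exact h2.1
    have h2 := hφ w a (mem_nbhd.1 (hA ha))
    rw [if_pos ⟨a, ha, rfl⟩] at h2
    have h3 := hφ w b (mem_nbhd.1 hb)
    rw [if_neg] at h3
    · rw [h1, ← h3] at h2
      exact one_ne_zero h2
    · rintro ⟨c, hc, h4⟩
      rcases Sym2.eq_iff.1 h4 with ⟨-, rfl⟩ | ⟨h5, h6⟩
      · exact hbA hc
      · rw [h6] at hb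
        exact (mem_nbhd.1 hb).ne rfl
  have hLadj : ∀ a b, L a b → G.Adj w a ∧ G.Adj w b ∧ G.Adj a b := by
    rintro a b ⟨hne, f, ha, hb⟩
    exact ⟨ha.1, hb.1, hcorner f a b ha hb hne⟩
  refine ⟨L, fun a b ⟨h, f, h1, h2⟩ => ⟨h.symm, f, h2, h1⟩, hLadj, fun a ha => ?_, hclosed⟩
  have hsides : s w a ≠ s a w := by
    intro h
    have h1 := hclosed {a} (by simp) (by simpa using ha) (by
      intro z hz b hzb
      rw [Finset.mem_singleton] at hz
      subst hz
      obtain ⟨-, f, h2, -⟩ := hzb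
      exact absurd (by rw [h]) h2.2)
    rw [← h1] at hdeg
    simp at hdeg
  have h1 : single (s w a) a := ⟨ha, by simp [hsides.symm]⟩
  have h2 : single (s a w) a := ⟨ha, by simp [hsides]⟩
  obtain ⟨b, hba, hb⟩ := hother _ _ h1
  obtain ⟨c, hca, hc⟩ := hother _ _ h2
  have hLa : ∀ z, L a z ↔ z = b ∨ z = c := by
    intro z
    constructor
    · rintro ⟨hne, f, h3, h4⟩
      have h5 : f = s w a ∨ f = s a w := by
        have := h3.2
        by_cases h6 : s w a = f
        · exact Or.inl h6.symm
        · exact Or.inr (by tauto)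
      rcases h5 with rfl | rfl
      · exact Or.inl (((hb z).1 h4).resolve_left hne.symm)
      · exact Or.inr (((hc z).1 h4).resolve_left hne.symm)
    · rintro (rfl | rfl)
      · exact ⟨hba.symm, _, h1, (hb z).2 (Or.inr rfl)⟩
      · exact ⟨hca.symm, _, h2, (hc z).2 (Or.inr rfl)⟩
  refine ⟨b, c, ?_, hLa⟩
  rintro rfl
  have h3 := hclosed {a, b} (by simp) (by
    intro z hz
    rw [Finset.mem_insert, Finset.mem_singleton] at hz
    rcases hz with rfl | rfl
    · simpa using ha
    · simpa using ((hb z).2 (Or.inr rfl)).1) (by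
    intro z hz y hzy
    rw [Finset.mem_insert, Finset.mem_singleton] at hz ⊢
    rcases hz with rfl | rfl
    · exact Or.inr (by simpa using (hLa y).1 hzy)
    · obtain ⟨-, f, h4, h5⟩ := hzy
      -- both sides of the second edge are sides of the first one
      have h6 := (hb z).2 (Or.inr rfl)
      have h7 := (hc z).2 (Or.inr rfl)
      have h8 : f = s w a ∨ f = s a w := by
        have h9 := h4.2
        have h10 := h6.2
        have h11 := h7.2
        by_contra! hcon
        by_cases h12 : s w z = f
        · have h13 : s w z ≠ s w a := by rw [h12]; exact hcon.1
          have h14 : s w z ≠ s a w := by rw [h12]; exact hcon.2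
          have h15 : s z w = s w a := by tauto
          have h16 : s z w = s a w := by tauto
          exact hsides (h15.symm.trans h16)
        · have h17 : s z w = f := by tauto
          have h13 : s z w ≠ s w a := by rw [h17]; exact hcon.1
          have h14 : s z w ≠ s a w := by rw [h17]; exact hcon.2
          have h15 : s w z = s w a := by tauto
          have h16 : s w z = s a w := by tauto
          exact hsides (h15.symm.trans h16)
      rcases h8 with rfl | rfl
      · exact (hb y).1 h5
      · exact (hc y).1 h5)
  rw [← h3] at hdeg
  have := Finset.card_le_two (a := a) (b := b)
  omega

/-- The neighbours of a vertex of degree 4 form a 4-cycle. -/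
theorem IsFlat.exists_link_four {G : SimpleGraph V} (hG : IsFlat G) (hmax : IsCornerClosed G)
    {w a : V} (hdeg : (nbhd G w).card = 4) (ha : G.Adj w a)
    (hcut : ∀ a b, G.Adj w a → G.Adj w b → ReachOff G {w} a b) :
    ∃ b c d, nbhd G w = {a, b, c, d} ∧ a ≠ b ∧ a ≠ c ∧ a ≠ d ∧ b ≠ c ∧ b ≠ d ∧ c ≠ d ∧
      G.Adj a b ∧ G.Adj b c ∧ G.Adj c d ∧ G.Adj d a := by
  obtain ⟨L, hsymm, hadj, htwo, -⟩ := hG.exists_link hmax (by omega) hcut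
  obtain ⟨b, d, hbd, hLa⟩ := htwo a ha
  obtain ⟨hwa, hwb, hab⟩ := hadj a b ((hLa b).2 (Or.inl rfl))
  obtain ⟨-, hwd, had⟩ := hadj a d ((hLa d).2 (Or.inr rfl))
  have h3 : ({a, b, d} : Finset V).card = 3 :=
    Finset.card_eq_three.2 ⟨a, b, d, hab.ne, had.ne, hbd, rfl⟩
  obtain ⟨c, hc, hc'⟩ := Finset.exists_mem_notMem_of_card_lt_card
    (show ({a, b, d} : Finset V).card < (nbhd G w).card by omega)
  simp only [Finset.mem_insert, Finset.mem_singleton, not_or] at hc'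
  obtain ⟨hca, hcb, hcd⟩ := hc'
  have hN : nbhd G w = {a, b, c, d} := by
    symm
    refine Finset.eq_of_subset_of_card_le ?_ ?_
    · intro z hz
      simp only [Finset.mem_insert, Finset.mem_singleton] at hz
      rcases hz with rfl | rfl | rfl | rfl
      exacts [mem_nbhd.2 hwa, mem_nbhd.2 hwb, hc, mem_nbhd.2 hwd]
    · have : ({a, b, c, d} : Finset V) = insert c {a, b, d} := by
        ext z
        simp only [Finset.mem_insert, Finset.mem_singleton]
        tauto
      rw [this, Finset.card_insert_of_notMem (by simp [hca, hcb, hcd]), h3, hdeg]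
  have hmem : ∀ z, G.Adj w z → z = a ∨ z = b ∨ z = c ∨ z = d := by
    intro z hz
    have := mem_nbhd.2 hz
    rw [hN] at this
    simpa using this
  obtain ⟨p, q, hpq, hLc⟩ := htwo c (mem_nbhd.1 hc)
  have h4 : ∀ z, L c z → z = b ∨ z = d := by
    intro z hz
    obtain ⟨-, hwz, hcz⟩ := hadj c z hz
    rcases hmem z hwz with rfl | rfl | rfl | rfl
    · have := (hLa c).1 (hsymm _ _ hz)
      tauto
    · exact Or.inl rfl
    · exact absurd rfl hcz.ne
    · exact Or.inr rfl
  have hLp := (hLc p).2 (Or.inl rfl)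
  have hLq := (hLc q).2 (Or.inr rfl)
  have h5 : G.Adj c b ∧ G.Adj c d := by
    rcases h4 p hLp with rfl | rfl <;> rcases h4 q hLq with rfl | rfl
    · exact absurd rfl hpq
    · exact ⟨(hadj _ _ hLp).2.2, (hadj _ _ hLq).2.2⟩
    · exact ⟨(hadj _ _ hLq).2.2, (hadj _ _ hLp).2.2⟩
    · exact absurd rfl hpq
  exact ⟨b, c, d, hN, hab.ne, Ne.symm hca, had.ne, Ne.symm hcb, hbd, hcd, hab, h5.1.symm, h5.2,
    had.symm⟩

/-- The neighbours of a vertex of degree 5 form a 5-cycle. -/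
theorem IsFlat.exists_link_five {G : SimpleGraph V} (hG : IsFlat G) (hmax : IsCornerClosed G)
    {w a : V} (hdeg : (nbhd G w).card = 5) (ha : G.Adj w a)
    (hcut : ∀ a b, G.Adj w a → G.Adj w b → ReachOff G {w} a b) :
    ∃ b c d e, nbhd G w = {a, b, c, d, e} ∧ [a, b, c, d, e].Nodup ∧
      G.Adj a b ∧ G.Adj b c ∧ G.Adj c d ∧ G.Adj d e ∧ G.Adj e a := by
  obtain ⟨L, hsymm, hadj, htwo, hcl⟩ := hG.exists_link hmax (by omega) hcut
  have hirr : ∀ z, ¬ L z z := fun z h => (hadj z z h).2.2.ne rfl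
  obtain ⟨b, e, hbe, hLa⟩ := htwo a ha
  have hLab := (hLa b).2 (Or.inl rfl)
  have hLae := (hLa e).2 (Or.inr rfl)
  obtain ⟨hwa, hwb, hab⟩ := hadj a b hLab
  obtain ⟨-, hwe, hae⟩ := hadj a e hLae
  -- the second link neighbour of a vertex one of whose link neighbours is known
  have hsnd : ∀ p q, L p q → ∃ r, r ≠ q ∧ ∀ z, L p z ↔ z = q ∨ z = r := by
    intro p q hpq
    obtain ⟨r, r', hrr, h⟩ := htwo p (hadj p q hpq).1
    rcases (h q).1 hpq with rfl | rfl
    · exact ⟨r', hrr.symm, h⟩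
    · exact ⟨r, hrr, fun z => (h z).trans or_comm⟩
  obtain ⟨c, hca, hLb⟩ := hsnd b a (hsymm _ _ hLab)
  obtain ⟨d, hda, hLe⟩ := hsnd e a (hsymm _ _ hLae)
  have hLbc := (hLb c).2 (Or.inr rfl)
  have hLed := (hLe d).2 (Or.inr rfl)
  obtain ⟨-, hwc, hbc⟩ := hadj b c hLbc
  obtain ⟨-, hwd, hed⟩ := hadj e d hLed
  have hsub : ∀ A : Finset V, (∀ z ∈ A, G.Adj w z) → A ⊆ nbhd G w := fun A h z hz =>
    mem_nbhd.2 (h z hz)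
  have hce : c ≠ e := by
    rintro rfl
    have h1 : d = b := by
      have := (hLe b).1 (hsymm _ _ hLbc)
      exact (this.resolve_left hab.ne').symm
    have h2 := hcl {a, b, c} (by simp) (hsub _ (by simp [hwa, hwb, hwc])) (by
      intro z hz y hy
      simp only [Finset.mem_insert, Finset.mem_singleton] at hz ⊢
      rcases hz with rfl | rfl | rfl
      · exact Or.inr ((hLa y).1 hy)
      · have := (hLb y).1 hy
        tauto
      · have := (hLe y).1 hy
        rw [h1] at this
        tauto)
    have h3 := Finset.card_le_three (a := a) (b := b) (c := c)
    rw [h2] at h3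
    omega
  have hdb : d ≠ b := by
    rintro rfl
    have := (hLb e).1 (hsymm _ _ hLed)
    rcases this with h | h
    · exact hae.ne' h
    · exact hce h.symm
  have hcd : c ≠ d := by
    rintro rfl
    have hLcb := hsymm _ _ hLbc
    have hLce := hsymm _ _ hLed
    obtain ⟨r, hrb, hLc⟩ := hsnd c b hLcb
    have hr : e = r := ((hLc e).1 hLce).resolve_left hbe.symm
    subst hr
    have h2 := hcl {a, b, c, e} (by simp) (hsub _ (by simp [hwa, hwb, hwc, hwe])) (by
      intro z hz y hy
      simp only [Finset.mem_insert, Finset.mem_singleton] at hz ⊢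
      rcases hz with rfl | rfl | rfl | rfl
      · have := (hLa y).1 hy
        tauto
      · have := (hLb y).1 hy
        tauto
      · have := (hLc y).1 hy
        tauto
      · have := (hLe y).1 hy
        tauto)
    have h3 := Finset.card_le_four (a := a) (b := b) (c := c) (d := e)
    rw [h2] at h3
    omega
  have hnd : [a, b, c, d, e].Nodup := by
    simp [hab.ne, hca.symm, hda.symm, hae.ne, hbc.ne, hdb.symm, hbe, hcd, hce, hed.ne']
  have hN : nbhd G w = {a, b, c, d, e} := by
    symm
    refine Finset.eq_of_subset_of_card_le (hsub _ (by simp [hwa, hwb, hwc, hwd, hwe])) ?_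
    have : ({a, b, c, d, e} : Finset V) = [a, b, c, d, e].toFinset := by simp
    rw [this, List.toFinset_card_of_nodup hnd, hdeg]
    simp
  obtain ⟨r, hre, hLd⟩ := hsnd d e (hsymm _ _ hLed)
  have hLdr := (hLd r).2 (Or.inr rfl)
  have hr : r = c := by
    obtain ⟨-, hwr, hdr⟩ := hadj d r hLdr
    have h1 := mem_nbhd.2 hwr
    rw [hN] at h1
    simp only [Finset.mem_insert, Finset.mem_singleton] at h1
    rcases h1 with rfl | rfl | h1 | rfl | rfl
    · rcases (hLa d).1 (hsymm _ _ hLdr) with h | h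
      · exact absurd h hdb
      · exact absurd h hed.ne'
    · rcases (hLb d).1 (hsymm _ _ hLdr) with h | h
      · exact absurd h hda
      · exact absurd h.symm hcd
    · exact h1
    · exact absurd rfl hdr.ne
    · exact absurd rfl hre
  subst hr
  exact ⟨b, r, d, e, hN, hnd, hab, hbc, (hadj _ _ hLdr).2.2.symm, hed.symm, hae.symm⟩

end Links

end AGraph
namespace AGraph

/-! ### Colourings, Kempe chains and unlocked pairs -/

section Colorings

open scoped Classical

variable {V : Type*}

/-- Proper colourings with the four colours, as plain functions. -/
def IsProper (G : SimpleGraph V) (c : V → Fin 4) : Prop := ∀ a b, G.Adj a b → c a ≠ c b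

theorem IsProper.mono {G H : SimpleGraph V} {c : V → Fin 4} (hc : IsProper G c) (h : H ≤ G) :
    IsProper H c := fun a b hab => hc a b (h hab)

/-- `a` and `b` are equal, or lie on a common Kempe chain in the colours `j` and `k`. -/
def Linked (G : SimpleGraph V) (c : V → Fin 4) (j k : Fin 4) (a b : V) : Prop :=
  Relation.ReflTransGen
    (fun p q => G.Adj p q ∧ (c p = j ∨ c p = k) ∧ (c q = j ∨ c q = k)) a b

/-- There is a colouring in which `x` and `y` have the same colour and are separated by one Kempe
exchange. This is what an n-s class amounts to. -/
def Unlocked (G : SimpleGraph V) (x y : V) : Prop :=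
  ∃ c, IsProper G c ∧ c x = c y ∧ ∃ k, k ≠ c x ∧ ¬ Linked G c (c x) k x y

theorem Linked.symm {G : SimpleGraph V} {c : V → Fin 4} {j k : Fin 4} {a b : V}
    (h : Linked G c j k a b) : Linked G c j k b a := by
  have : Std.Symm fun p q => G.Adj p q ∧ (c p = j ∨ c p = k) ∧ (c q = j ∨ c q = k) :=
    ⟨fun p q h => ⟨h.1.symm, h.2.2, h.2.1⟩⟩
  exact Relation.ReflTransGen.stdSymm.symm _ _ h

theorem Linked.map {G G' : SimpleGraph V} {c c' : V → Fin 4} {j k j' k' : Fin 4} (ρ : V → V)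
    (h : ∀ p q, G.Adj p q → (c p = j ∨ c p = k) → (c q = j ∨ c q = k) →
      ρ p = ρ q ∨ G'.Adj (ρ p) (ρ q) ∧ (c' (ρ p) = j' ∨ c' (ρ p) = k') ∧
        (c' (ρ q) = j' ∨ c' (ρ q) = k'))
    {a b : V} (hab : Linked G c j k a b) : Linked G' c' j' k' (ρ a) (ρ b) := by
  induction hab with
  | refl => exact Relation.ReflTransGen.refl
  | tail _ hs ih =>
    rcases h _ _ hs.1 hs.2.1 hs.2.2 with h1 | h1
    · rwa [← h1]
    · exact ih.tail h1

theorem Unlocked.mono {G H : SimpleGraph V} {x y : V} (hG : Unlocked G x y) (h : H ≤ G) :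
    Unlocked H x y := by
  obtain ⟨c, hc, hxy, k, hk, hl⟩ := hG
  exact ⟨c, hc.mono h, hxy, k, hk, fun hl' => hl (Linked.map id
    (fun p q hpq hp hq => Or.inr ⟨h hpq, hp, hq⟩) hl')⟩

theorem exists_other_colors (i k : Fin 4) (h : k ≠ i) :
    ∃ m n : Fin 4, m ≠ n ∧ m ≠ i ∧ m ≠ k ∧ n ≠ i ∧ n ≠ k ∧ ∀ z, z = i ∨ z = k ∨ z = m ∨ z = n := by
  decide +revert

/-- A colouring extends to a vertex whose neighbours have at most three images. -/
theorem IsProper.exists_lift [Fintype V] {G G' : SimpleGraph V} {c' : V → Fin 4}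
    (hc' : IsProper G' c') (π : V → V) (w : V)
    (hπ : ∀ p q, G.Adj p q → p ≠ w → q ≠ w → G'.Adj (π p) (π q))
    (hcard : ((nbhd G w).image π).card ≤ 3) :
    ∃ c, IsProper G c ∧ ∀ p, p ≠ w → c p = c' (π p) := by
  obtain ⟨m, hm⟩ : ∃ m, m ∉ ((nbhd G w).image π).image c' := by
    by_contra! h
    have h1 := Finset.card_le_card (fun z _ => h z : Finset.univ ⊆ ((nbhd G w).image π).image c')
    have h2 := Finset.card_image_le (s := (nbhd G w).image π) (f := c')
    rw [Finset.card_univ, Fintype.card_fin] at h1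
    omega
  have hm' : ∀ p, G.Adj w p → c' (π p) ≠ m := by
    intro p hp h
    exact hm (Finset.mem_image.2 ⟨π p, Finset.mem_image_of_mem _ (mem_nbhd.2 hp), h⟩)
  refine ⟨fun p => if p = w then m else c' (π p), ?_, fun p hp => if_neg hp⟩
  intro p q hpq
  by_cases hp : p = w
  · subst hp
    simpa [hpq.ne'] using (hm' q hpq).symm
  · by_cases hq : q = w
    · subst hq
      simpa [hp] using hm' p hpq.symm
    · simpa [hp, hq] using hc' _ _ (hπ p q hpq hp hq)

/-- Reducibility of vertices of degree at most 4: a vertex `w` whose neighbours have at most three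
images never helps to lock `x` and `y`. Either `w` gets one of the colours not involved in the
exchange, or its neighbours in the two colours involved have a common image, and `w` does not
connect chains. -/
theorem Unlocked.lift [Fintype V] {G G' : SimpleGraph V} (π : V → V) (w : V) {x y : V}
    (hxw : x ≠ w) (hyw : y ≠ w) (h : Unlocked G' (π x) (π y))
    (hπ : ∀ p q, G.Adj p q → p ≠ w → q ≠ w → G'.Adj (π p) (π q))
    (hcard : ((nbhd G w).image π).card ≤ 3) : Unlocked G x y := by
  obtain ⟨c', hc', hxy, k, hk, hl⟩ := h
  set i := c' (π x) with hi
  -- `z` is the colour for `w`; if it takes part in the exchange, then `π p = t` for all neighbours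
  -- `p` of `w` in the two colours, so that a chain through `w` can bypass it at `t`
  obtain ⟨z, t, hz⟩ : ∃ (z : Fin 4) (t : V), (∀ p, G.Adj w p → c' (π p) ≠ z) ∧
      (z = i ∨ z = k → ∀ p, G.Adj w p → c' (π p) = i ∨ c' (π p) = k → π p = t) := by
    by_cases h1 : ∃ m, m ≠ i ∧ m ≠ k ∧ ∀ p, G.Adj w p → c' (π p) ≠ m
    · obtain ⟨m, hmi, hmk, hm⟩ := h1
      exact ⟨m, w, hm, fun h => by tauto⟩
    · push Not at h1
      obtain ⟨m, n, hmn, hmi, hmk, hni, hnk, -⟩ := exists_other_colors i k hk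
      obtain ⟨p₁, hp₁, hm⟩ := h1 m hmi hmk
      obtain ⟨p₂, hp₂, hn⟩ := h1 n hni hnk
      have h2 : ∀ p q, G.Adj w p → G.Adj w q → (c' (π p) = i ∨ c' (π p) = k) →
          (c' (π q) = i ∨ c' (π q) = k) → π p = π q := by
        intro p q hp hq hpc hqc
        by_contra hne
        have h3 : [π p₁, π p₂, π p, π q].Nodup := by
          have e1 : π p₁ ≠ π p₂ := fun e => hmn (by rw [← hm, ← hn, e])
          have e2 : π p₁ ≠ π p := fun e => by rw [← e, hm] at hpc; tauto
          have e3 : π p₁ ≠ π q := fun e => by rw [← e, hm] at hqc; tauto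
          have e4 : π p₂ ≠ π p := fun e => by rw [← e, hn] at hpc; tauto
          have e5 : π p₂ ≠ π q := fun e => by rw [← e, hn] at hqc; tauto
          simp [e1, e2, e3, e4, e5, hne]
        have h4 : [π p₁, π p₂, π p, π q].toFinset ⊆ (nbhd G w).image π := by
          intro r hr
          simp only [List.mem_toFinset, List.mem_cons, List.not_mem_nil, or_false] at hr
          rcases hr with rfl | rfl | rfl | rfl <;>
            exact Finset.mem_image_of_mem _ (mem_nbhd.2 (by assumption))
        have h5 := Finset.card_le_card h4
        rw [List.toFinset_card_of_nodup h3] at h5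
        simp at h5
        omega
      by_cases h3 : ∃ p, G.Adj w p ∧ (c' (π p) = i ∨ c' (π p) = k)
      · obtain ⟨p, hp, hpc⟩ := h3
        refine ⟨if c' (π p) = i then k else i, π p, ?_, fun _ q hq hqc => h2 q p hq hp hqc hpc⟩
        intro q hq
        by_cases hqc : c' (π q) = i ∨ c' (π q) = k
        · rw [h2 q p hq hp hqc hpc]
          split_ifs with h4
          · rw [h4]
            exact hk.symm
          · exact h4
        · push Not at hqc
          split_ifs
          · exact hqc.2
          · exact hqc.1
      · push Not at h3
        exact ⟨i, w, fun p hp => (h3 p hp).1, fun _ p hp hpc => by have := h3 p hp; tauto⟩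
  refine ⟨fun p => if p = w then z else c' (π p), ?_, ?_, k, ?_, ?_⟩
  · intro p q hpq
    by_cases hp : p = w
    · subst hp
      simpa [hpq.ne'] using (hz.1 q hpq).symm
    · by_cases hq : q = w
      · subst hq
        simpa [hp] using hz.1 p hpq.symm
      · simpa [hp, hq] using hc' _ _ (hπ p q hpq hp hq)
  · simp [hxw, hyw, hxy, ← hi]
  · simpa [hxw] using hk
  · simp only [if_neg hxw]
    intro hl'
    refine hl ?_
    have := Linked.map (G' := G') (c' := c') (j' := i) (k' := k)
      (fun p => if p = w then t else π p) ?_ hl'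
    · simpa [hxw, hyw] using this
    · intro p q hpq hpc hqc
      by_cases hp : p = w
      · subst hp
        have hq := hpq.ne'
        simp only [if_true, if_neg hq] at hpc hqc ⊢
        exact Or.inl (hz.2 hpc q hpq hqc).symm
      · by_cases hq : q = w
        · subst hq
          simp only [if_true, if_neg hp] at hpc hqc ⊢
          exact Or.inl (hz.2 hqc p hpq.symm hpc)
        · simp only [if_neg hp, if_neg hq] at hpc hqc ⊢
          exact Or.inr ⟨hπ p q hpq hp hq, hpc, hqc⟩

/-- A partial matching of colours extends to a permutation of the colours. -/
theorem exists_perm_of_pairs (R : Finset (Fin 4 × Fin 4))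
    (h : ∀ p ∈ R, ∀ q ∈ R, p.1 = q.1 ↔ p.2 = q.2) :
    ∃ σ : Equiv.Perm (Fin 4), ∀ p ∈ R, σ p.1 = p.2 := by
  have h1 : ∀ i : Fin 4, ∃ j, ∀ p ∈ R, p.1 = i → p.2 = j := by
    intro i
    by_cases h2 : ∃ p ∈ R, p.1 = i
    · obtain ⟨p, hp, rfl⟩ := h2
      exact ⟨p.2, fun q hq hqp => (h q hq p hp).1 hqp⟩
    · exact ⟨i, fun p hp hpi => absurd ⟨p, hp, hpi⟩ h2⟩
  choose f hf using h1
  have hf' : ∀ p ∈ R, f p.1 = p.2 := fun p hp => (hf p.1 p hp rfl).symm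
  obtain ⟨g, hg⟩ := Finset.exists_equiv_extend_of_card_eq (α := Fin 4) (β := Fin 4)
    (t := Finset.univ) (by simp) (s := R.image Prod.fst) (f := f) (Finset.subset_univ _) (by
      intro i hi j hj hij
      obtain ⟨p, hp, rfl⟩ := Finset.mem_image.1 hi
      obtain ⟨q, hq, rfl⟩ := Finset.mem_image.1 hj
      rw [hf' p hp, hf' q hq] at hij
      exact (h p hp q hq).2 hij)
  refine ⟨g.trans (Equiv.subtypeUnivEquiv fun _ => Finset.mem_univ _), fun p hp => ?_⟩
  rw [← hf' p hp, ← hg p.1 (Finset.mem_image_of_mem _ hp)]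
  rfl

theorem IsProper.comp_perm {G : SimpleGraph V} {c : V → Fin 4} (hc : IsProper G c)
    (σ : Equiv.Perm (Fin 4)) : IsProper G (fun v => σ (c v)) :=
  fun a b hab h => hc a b hab (σ.injective h)

/-- Two colourings that agree on `K` combine to a colouring, if `K` separates `B` from the rest. -/
theorem IsProper.glue [Fintype V] {G : SimpleGraph V} {K B : Finset V} {c₁ c₂ : V → Fin 4}
    (hB : ∀ p ∈ B, ∀ q, G.Adj p q → q ∈ B ∨ q ∈ K)
    (h₁ : IsProper (restrictTo G Bᶜ) c₁) (h₂ : IsProper (restrictTo G (B ∪ K)) c₂)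
    (hK : ∀ p ∈ K, c₁ p = c₂ p) : IsProper G (fun v => if v ∈ B then c₂ v else c₁ v) := by
  have key : ∀ p q, G.Adj p q → p ∈ B → q ∉ B → c₂ p ≠ c₁ q := by
    intro p q hpq hp hq
    have hqK := (hB p hp q hpq).resolve_left hq
    rw [hK q hqK]
    exact h₂ p q ⟨hpq, Finset.mem_union_left _ hp, Finset.mem_union_right _ hqK⟩
  intro p q hpq
  by_cases hp : p ∈ B <;> by_cases hq : q ∈ B <;> simp only [hp, hq, if_true, if_false]
  · exact h₂ p q ⟨hpq, Finset.mem_union_left _ hp, Finset.mem_union_left _ hq⟩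
  · exact key p q hpq hp hq
  · exact (key q p hpq.symm hq hp).symm
  · exact h₁ p q ⟨hpq, by simpa using hp, by simpa using hq⟩

/-- A clique separating a set `B` not containing `x` and `y`: the colours of a colouring of `B`
and the clique can be permuted to match any colouring of the other side. -/
theorem Unlocked.of_clique_separation [Fintype V] {G : SimpleGraph V} {K B : Finset V} {x y : V}
    (hB : ∀ p ∈ B, ∀ q, G.Adj p q → q ∈ B ∨ q ∈ K) (hKB : Disjoint K B)
    (hK : ∀ p ∈ K, ∀ q ∈ K, p ≠ q → G.Adj p q) (hx : x ∉ B) (hy : y ∉ B)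
    (h₁ : Unlocked (restrictTo G Bᶜ) x y) {c₂ : V → Fin 4}
    (h₂ : IsProper (restrictTo G (B ∪ K)) c₂) : Unlocked G x y := by
  obtain ⟨c₁, hc₁, hxy, k, hk, hl⟩ := h₁
  have hKB' : ∀ p ∈ K, p ∉ B := fun p hp hpB => Finset.disjoint_left.1 hKB hp hpB
  have hinj₁ : ∀ p ∈ K, ∀ q ∈ K, c₁ p = c₁ q → p = q := by
    intro p hp q hq h
    by_contra hne
    exact hc₁ p q ⟨hK p hp q hq hne, by simpa using hKB' p hp, by simpa using hKB' q hq⟩ h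
  have hinj₂ : ∀ p ∈ K, ∀ q ∈ K, c₂ p = c₂ q → p = q := by
    intro p hp q hq h
    by_contra hne
    exact h₂ p q ⟨hK p hp q hq hne, Finset.mem_union_right _ hp, Finset.mem_union_right _ hq⟩ h
  obtain ⟨σ, hσ⟩ := exists_perm_of_pairs (K.image fun p => (c₂ p, c₁ p)) (by
    simp only [Finset.mem_image]
    rintro _ ⟨p, hp, rfl⟩ _ ⟨q, hq, rfl⟩
    refine ⟨fun h => ?_, fun h => ?_⟩
    · simp only at h
      rw [hinj₂ p hp q hq h]
    · simp only at h
      rw [hinj₁ p hp q hq h])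
  have hσ' : ∀ p ∈ K, c₁ p = σ (c₂ p) := fun p hp => (hσ _ (Finset.mem_image_of_mem _ hp)).symm
  have hglue := IsProper.glue hB hc₁ (h₂.comp_perm σ) hσ'
  refine ⟨_, hglue, by simpa [hx, hy] using hxy, k, by simpa [hx] using hk, ?_⟩
  simp only [if_neg hx]
  intro hl'
  refine hl ?_
  -- the chain through `B` is retracted to a vertex of the clique
  obtain ⟨t, ht⟩ : ∃ t, ∀ q ∈ K, (c₁ q = c₁ x ∨ c₁ q = k) →
      t ∈ K ∧ (c₁ t = c₁ x ∨ c₁ t = k) := by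
    by_cases h : ∃ q ∈ K, c₁ q = c₁ x ∨ c₁ q = k
    · obtain ⟨t, ht⟩ := h
      exact ⟨t, fun _ _ _ => ht⟩
    · exact ⟨x, fun q hq hqc => absurd ⟨q, hq, hqc⟩ h⟩
  have key : ∀ p q, G.Adj p q → p ∈ B → q ∉ B → (c₁ q = c₁ x ∨ c₁ q = k) →
      t = q ∨ (restrictTo G Bᶜ).Adj t q ∧ (c₁ t = c₁ x ∨ c₁ t = k) := by
    intro p q hpq hp hq hqc
    have hqK := (hB p hp q hpq).resolve_left hq
    obtain ⟨htK, htc⟩ := ht q hqK hqc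
    by_cases h : t = q
    · exact Or.inl h
    · exact Or.inr ⟨⟨hK t htK q hqK h, by simpa using hKB' t htK, by simpa using hq⟩, htc⟩
  have := Linked.map (G' := restrictTo G Bᶜ) (c' := c₁) (j' := c₁ x) (k' := k)
    (fun p => if p ∈ B then t else p) ?_ hl'
  · simpa [hx, hy] using this
  · intro p q hpq hpc hqc
    by_cases hp : p ∈ B <;> by_cases hq : q ∈ B <;>
      simp only [hp, hq, if_true, if_false] at hpc hqc ⊢
    · exact Or.inl trivial
    · rcases key p q hpq hp hq hqc with h | h
      · exact Or.inl h
      · exact Or.inr ⟨h.1, h.2, hqc⟩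
    · rcases key q p hpq.symm hq hp hpc with h | h
      · exact Or.inl h.symm
      · exact Or.inr ⟨h.1.symm, hpc, h.2⟩
    · exact Or.inr ⟨⟨hpq, by simpa using hp, by simpa using hq⟩, hpc, hqc⟩

/-- Separation by a set that contains `x` and `y` and is a clique but for this pair: an exchange
separating `x` from `y` on both sides of it is one on the whole graph. -/
theorem Unlocked.of_pair_separation [Fintype V] {G : SimpleGraph V} {K B : Finset V} {x y : V}
    (hB : ∀ p ∈ B, ∀ q, G.Adj p q → q ∈ B ∨ q ∈ K) (hKB : Disjoint K B)
    (hK : ∀ p ∈ K, ∀ q ∈ K, p ≠ q → s(p, q) ≠ s(x, y) → G.Adj p q) (hx : x ∈ K) (hy : y ∈ K)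
    (h₁ : Unlocked (restrictTo G Bᶜ) x y) (h₂ : Unlocked (restrictTo G (B ∪ K)) x y) :
    Unlocked G x y := by
  obtain ⟨c₁, hc₁, hxy₁, k₁, hk₁, hl₁⟩ := h₁
  obtain ⟨c₂, hc₂, hxy₂, k₂, hk₂, hl₂⟩ := h₂
  have hKB' : ∀ p ∈ K, p ∉ B := fun p hp hpB => Finset.disjoint_left.1 hKB hp hpB
  have hadj₁ : ∀ p ∈ K, ∀ q ∈ K, p ≠ q → s(p, q) ≠ s(x, y) → (restrictTo G Bᶜ).Adj p q :=
    fun p hp q hq h h' => ⟨hK p hp q hq h h', by simpa using hKB' p hp, by simpa using hKB' q hq⟩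
  have hadj₂ : ∀ p ∈ K, ∀ q ∈ K, p ≠ q → s(p, q) ≠ s(x, y) → (restrictTo G (B ∪ K)).Adj p q :=
    fun p hp q hq h h' => ⟨hK p hp q hq h h', Finset.mem_union_right _ hp,
      Finset.mem_union_right _ hq⟩
  -- the other vertices of `K` have neither of the two colours of the exchange
  have aux : ∀ (H : SimpleGraph V) (c : V → Fin 4) (k : Fin 4),
      (∀ p ∈ K, ∀ q ∈ K, p ≠ q → s(p, q) ≠ s(x, y) → H.Adj p q) → IsProper H c → c x = c y →
      ¬ Linked H c (c x) k x y → ∀ z ∈ K, z ≠ x → z ≠ y → c z ≠ c x ∧ c z ≠ k := by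
    intro H c k hH hc hxy hl z hz hzx hzy
    have h1 : H.Adj x z := hH x hx z hz hzx.symm (by simp [hzx, hzy])
    have h2 : H.Adj z y := hH z hz y hy hzy (by simp [hzx, hzy])
    refine ⟨(hc x z h1).symm, fun h => hl ?_⟩
    exact (Relation.ReflTransGen.single ⟨h1, Or.inl rfl, Or.inr h⟩).tail
      ⟨h2, Or.inr h, Or.inl hxy.symm⟩
  have aux₁ := aux _ c₁ k₁ hadj₁ hc₁ hxy₁ hl₁
  have aux₂ := aux _ c₂ k₂ hadj₂ hc₂ hxy₂ hl₂
  have hinj : ∀ (H : SimpleGraph V) (c : V → Fin 4),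
      (∀ p ∈ K, ∀ q ∈ K, p ≠ q → s(p, q) ≠ s(x, y) → H.Adj p q) → IsProper H c →
      ∀ p ∈ K, ∀ q ∈ K, p ≠ x → p ≠ y → c p = c q → p = q := by
    intro H c hH hc p hp q hq hpx hpy h
    by_contra hne
    exact hc p q (hH p hp q hq hne (by simp [hpx, hpy])) h
  obtain ⟨σ, hσ⟩ := exists_perm_of_pairs (insert (c₂ x, c₁ x) (insert (k₂, k₁)
      ((K.filter fun z => z ≠ x ∧ z ≠ y).image fun p => (c₂ p, c₁ p)))) (by
    have e1 : ∀ z ∈ K, z ≠ x → z ≠ y → (c₂ x = c₂ z ↔ c₁ x = c₁ z) := fun z hz hzx hzy =>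
      iff_of_false (aux₂ z hz hzx hzy).1.symm (aux₁ z hz hzx hzy).1.symm
    have e2 : ∀ z ∈ K, z ≠ x → z ≠ y → (k₂ = c₂ z ↔ k₁ = c₁ z) := fun z hz hzx hzy =>
      iff_of_false (aux₂ z hz hzx hzy).2.symm (aux₁ z hz hzx hzy).2.symm
    have e3 : c₂ x = k₂ ↔ c₁ x = k₁ := iff_of_false hk₂.symm hk₁.symm
    simp only [Finset.mem_insert, Finset.mem_image, Finset.mem_filter]
    rintro _ (rfl | rfl | ⟨p, ⟨hp, hpx, hpy⟩, rfl⟩) _ (rfl | rfl | ⟨q, ⟨hq, hqx, hqy⟩, rfl⟩)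
    · simp
    · exact e3
    · exact e1 q hq hqx hqy
    · exact (eq_comm.trans e3).trans eq_comm
    · simp
    · exact e2 q hq hqx hqy
    · exact (eq_comm.trans (e1 p hp hpx hpy)).trans eq_comm
    · exact (eq_comm.trans (e2 p hp hpx hpy)).trans eq_comm
    · refine ⟨fun h => ?_, fun h => ?_⟩
      · simp only at h
        rw [hinj _ c₂ hadj₂ hc₂ p hp q hq hpx hpy h]
      · simp only at h
        rw [hinj _ c₁ hadj₁ hc₁ p hp q hq hpx hpy h])
  have hσx : σ (c₂ x) = c₁ x := hσ (c₂ x, c₁ x) (by simp)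
  have hσk : σ k₂ = k₁ := hσ (k₂, k₁) (by simp)
  have hσK : ∀ p ∈ K, c₁ p = σ (c₂ p) := by
    intro p hp
    by_cases hpx : p = x
    · rw [hpx, hσx]
    · by_cases hpy : p = y
      · rw [hpy, ← hxy₁, ← hxy₂, hσx]
      · exact (hσ (c₂ p, c₁ p) (by
          simp only [Finset.mem_insert, Finset.mem_image, Finset.mem_filter]
          exact Or.inr (Or.inr ⟨p, ⟨hp, hpx, hpy⟩, rfl⟩))).symm
  have hglue := IsProper.glue hB hc₁ (hc₂.comp_perm σ) hσK
  have hxB := hKB' x hx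
  have hyB := hKB' y hy
  refine ⟨_, hglue, by simpa [hxB, hyB] using hxy₁, k₁, by simpa [hxB] using hk₁, ?_⟩
  simp only [if_neg hxB]
  intro hl
  have hcol : ∀ p, (σ (c₂ p) = c₁ x ∨ σ (c₂ p) = k₁) ↔ (c₂ p = c₂ x ∨ c₂ p = k₂) := by
    intro p
    rw [← hσx, ← hσk, σ.injective.eq_iff, σ.injective.eq_iff]
  have hkey : ∀ z, z ∈ K → (c₁ z = c₁ x ∨ c₁ z = k₁) → z = x ∨ z = y := by
    intro z hz hzc
    by_contra! h
    have := aux₁ z hz h.1 h.2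
    tauto
  -- a chain from `x` can change sides only at `x`, as it would have to reach `y` on one side first
  have hinv : ∀ z, Relation.ReflTransGen (fun p q => G.Adj p q ∧
      ((if p ∈ B then σ (c₂ p) else c₁ p) = c₁ x ∨ (if p ∈ B then σ (c₂ p) else c₁ p) = k₁) ∧
      ((if q ∈ B then σ (c₂ q) else c₁ q) = c₁ x ∨ (if q ∈ B then σ (c₂ q) else c₁ q) = k₁)) x z →
      (z ∉ B → Linked (restrictTo G Bᶜ) c₁ (c₁ x) k₁ x z) ∧
      (z ∈ B → Linked (restrictTo G (B ∪ K)) c₂ (c₂ x) k₂ x z) := by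
    intro z hz
    induction hz with
    | refl => exact ⟨fun _ => Relation.ReflTransGen.refl, fun h => absurd h hxB⟩
    | @tail p q _ hs ih =>
      obtain ⟨hpq, hpc, hqc⟩ := hs
      by_cases hp : p ∈ B <;> by_cases hq : q ∈ B <;>
        simp only [hp, hq, if_true, if_false] at hpc hqc
      · refine ⟨fun h => absurd hq h, fun _ => (ih.2 hp).tail ⟨⟨hpq, Finset.mem_union_left _ hp,
          Finset.mem_union_left _ hq⟩, (hcol p).1 hpc, (hcol q).1 hqc⟩⟩
      · refine ⟨fun _ => ?_, fun h => absurd h hq⟩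
        have hqK := (hB p hp q hpq).resolve_left hq
        rcases hkey q hqK hqc with rfl | rfl
        · exact Relation.ReflTransGen.refl
        · refine absurd ((ih.2 hp).tail ⟨⟨hpq, Finset.mem_union_left _ hp,
            Finset.mem_union_right _ hqK⟩, (hcol p).1 hpc, Or.inl hxy₂.symm⟩) hl₂
      · refine ⟨fun h => absurd hq h, fun _ => ?_⟩
        have hpK := (hB q hq p hpq.symm).resolve_left hp
        rcases hkey p hpK hpc with rfl | rfl
        · exact Relation.ReflTransGen.single ⟨⟨hpq, Finset.mem_union_right _ hpK,
            Finset.mem_union_left _ hq⟩, Or.inl rfl, (hcol q).1 hqc⟩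
        · exact absurd (ih.1 hp) hl₁
      · exact ⟨fun _ => (ih.1 hp).tail ⟨⟨hpq, by simpa using hp, by simpa using hq⟩, hpc, hqc⟩,
          fun h => absurd h hq⟩
  exact hl₁ ((hinv y hl).1 hyB)

end Colorings

end AGraph
namespace AGraph

/-! ### Reductions and critical graphs -/

section Reductions

open scoped Classical

variable {V : Type*}

/-- The map identifying `w` and `c` with `a`. -/
noncomputable def merge (a w c : V) (z : V) : V := if z = w ∨ z = c then a else z

theorem merge_of_ne {a w c z : V} (hw : z ≠ w) (hc : z ≠ c) : merge a w c z = z := by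
  simp [merge, hw, hc]

theorem reflTransGen_merge {G : SimpleGraph V} {a w c : V} (haw : G.Adj a w) (hwc : G.Adj w c)
    (z : V) : Relation.ReflTransGen (fun p q => G.Adj p q ∧ merge a w c p = merge a w c q)
      (merge a w c z) z := by
  by_cases hzw : z = w
  · subst hzw
    by_cases hac : a = c
    · subst hac
      simp only [merge, true_or, if_true]
      exact Relation.ReflTransGen.single ⟨haw, by simp⟩
    · have h1 : merge a z c z = a := by simp [merge]
      rw [h1]
      refine Relation.ReflTransGen.single ⟨haw, ?_⟩
      rw [h1, merge_of_ne haw.ne hac]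
  · by_cases hzc : z = c
    · subst hzc
      have h1 : merge a w z z = a := by simp [merge]
      have h2 : merge a w z w = a := by simp [merge]
      have h3 : merge a w z a = a := by unfold merge; split_ifs <;> rfl
      rw [h1]
      exact (Relation.ReflTransGen.single ⟨haw, by rw [h2, h3]⟩).tail ⟨hwc, by rw [h1, h2]⟩
    · rw [merge_of_ne hzw hzc]

/-- Among four neighbours of a vertex in a flat graph two are not adjacent. -/
theorem IsFlat.exists_not_adj [Fintype V] {G : SimpleGraph V} (hG : IsFlat G) {w : V}
    (hw : (nbhd G w).card = 4) : ∃ a c, G.Adj w a ∧ G.Adj w c ∧ a ≠ c ∧ ¬ G.Adj a c := by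
  by_contra! h
  obtain ⟨p, t', hp, ht, ht3⟩ := Finset.card_eq_succ.1 hw
  obtain ⟨q, r, u, hqr, hqu, hru, rfl⟩ := Finset.card_eq_three.1 ht3
  have hm : ∀ z ∈ insert p ({q, r, u} : Finset V), G.Adj w z := fun z hz => by
    rw [ht] at hz
    exact mem_nbhd.1 hz
  simp only [Finset.mem_insert, Finset.mem_singleton, not_or] at hp
  have hp' := hm p (by simp)
  have hq' := hm q (by simp)
  have hr' := hm r (by simp)
  have hu' := hm u (by simp)
  exact hG.no_K5 hp' hq' hr' hu' (h _ _ hp' hq' hp.1) (h _ _ hp' hr' hp.2.1) (h _ _ hp' hu' hp.2.2)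
    (h _ _ hq' hr' hqr) (h _ _ hq' hu' hqu) (h _ _ hr' hu' hru)

theorem card_image_merge_le {S : Finset V} {a w c : V} (hS : S.card = 4) (ha : a ∈ S) (hc : c ∈ S)
    (hac : a ≠ c) : (S.image (merge a w c)).card ≤ 3 := by
  have h1 : S.image (merge a w c) ⊆ (S.erase c).image (merge a w c) := by
    intro z hz
    obtain ⟨p, hp, rfl⟩ := Finset.mem_image.1 hz
    by_cases hpc : p = c
    · subst hpc
      refine Finset.mem_image.2 ⟨a, Finset.mem_erase.2 ⟨hac, ha⟩, ?_⟩
      simp [merge]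
    · exact Finset.mem_image_of_mem _ (Finset.mem_erase.2 ⟨hpc, hp⟩)
  refine (Finset.card_le_card h1).trans (Finset.card_image_le.trans ?_)
  rw [Finset.card_erase_of_mem hc, hS]

/-- The edges of `G` lie inside `T`; the number of vertices of `T` plays the part of the order. -/
def SupportedOn (G : SimpleGraph V) (T : Finset V) : Prop := ∀ a b, G.Adj a b → a ∈ T

theorem SupportedOn.restrictTo (G : SimpleGraph V) (S : Finset V) :
    SupportedOn (restrictTo G S) S := fun _ _ h => h.2.1

theorem SupportedOn.filter_adj [Fintype V] {G : SimpleGraph V} {T : Finset V} (h : SupportedOn G T) (a : V) :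
    T.filter (G.Adj a) = nbhd G a := by
  ext b
  rw [Finset.mem_filter, mem_nbhd]
  exact ⟨fun hb => hb.2, fun hb => ⟨h b a hb.symm, hb⟩⟩

theorem SupportedOn.quot_merge {G : SimpleGraph V} {T : Finset V} (h : SupportedOn G T) {a w c : V}
    (ha : a ∈ T) (haw : a ≠ w) (hac : a ≠ c) :
    SupportedOn (quot (merge a w c) G) ((T.erase w).erase c) := by
  rintro _ _ ⟨-, p, q, hpq, rfl, rfl⟩
  have hp := h p q hpq
  unfold merge
  split_ifs with h1
  · exact Finset.mem_erase.2 ⟨hac, Finset.mem_erase.2 ⟨haw, ha⟩⟩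
  · push Not at h1
    exact Finset.mem_erase.2 ⟨h1.2, Finset.mem_erase.2 ⟨h1.1, hp⟩⟩

theorem IsFlat.sum_card_nbhd_le [Fintype V] {G : SimpleGraph V} (hG : IsFlat G) {T : Finset V}
    (hT : SupportedOn G T) (h3 : 3 ≤ T.card) : ∑ a ∈ T, (nbhd G a).card + 12 ≤ 6 * T.card := by
  have := hG.sum_card_filter_le h3
  rwa [Finset.sum_congr rfl fun a _ => by rw [hT.filter_adj a]] at this

/-- A flat graph of order at most 11 has a 4-colouring, as it has a vertex of degree at most 4. -/
theorem IsFlat.exists_isProper [Fintype V] {G : SimpleGraph V} (hG : IsFlat G) {T : Finset V}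
    (hT : SupportedOn G T) (h11 : T.card ≤ 11) : ∃ c, IsProper G c := by
  induction hn : T.card using Nat.strong_induction_on generalizing G T with
  | _ n ih =>
  subst hn
  by_cases h0 : T = ∅
  · subst h0
    exact ⟨fun _ => 0, fun a b hab => absurd (hT a b hab) (by simp)⟩
  obtain ⟨w, hw, hdeg⟩ : ∃ w ∈ T, (nbhd G w).card ≤ 4 := by
    by_contra! h
    by_cases h3 : 3 ≤ T.card
    · have h1 := hG.sum_card_nbhd_le hT h3
      have h2 := Finset.card_nsmul_le_sum T (fun a => (nbhd G a).card) 5 (fun a ha => h a ha)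
      rw [smul_eq_mul] at h2
      omega
    · obtain ⟨w, hw⟩ := Finset.nonempty_iff_ne_empty.2 h0
      have h1 := h w hw
      have h2 := Finset.card_le_card (Finset.filter_subset (G.Adj w) T)
      rw [hT.filter_adj w] at h2
      omega
  have hcw := Finset.card_erase_of_mem hw
  have hpos : 0 < T.card := Finset.card_pos.2 ⟨w, hw⟩
  -- with degree 4, two non-adjacent neighbours of `w` are identified with `w` first
  by_cases h3 : (nbhd G w).card ≤ 3
  · obtain ⟨c', hc'⟩ := ih (T.erase w).card (by omega) (hG.mono (restrictTo_le G (T.erase w)))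
      (SupportedOn.restrictTo G _) (by omega) rfl
    obtain ⟨c, hc, -⟩ := hc'.exists_lift (G := G) id w (fun p q hpq hp hq => ⟨hpq,
      Finset.mem_erase.2 ⟨hp, hT p q hpq⟩, Finset.mem_erase.2 ⟨hq, hT q p hpq.symm⟩⟩) (by simpa)
    exact ⟨c, hc⟩
  · obtain ⟨a, c, hwa, hwc, hac, hnac⟩ := hG.exists_not_adj (w := w) (by omega)
    have hcard : ((T.erase w).erase c).card < T.card :=
      lt_of_le_of_lt (Finset.card_le_card (Finset.erase_subset _ _)) (by omega)
    obtain ⟨c', hc'⟩ := ih _ hcard (hG.quot _ (reflTransGen_merge hwa.symm hwc))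
      (hT.quot_merge (hT a w hwa.symm) hwa.ne' hac) (by omega) rfl
    obtain ⟨c, hc, -⟩ := hc'.exists_lift (G := G) (merge a w c) w (fun p q hpq hp hq => by
      refine ⟨?_, p, q, hpq, rfl, rfl⟩
      by_cases hpc : p = c
      · have hqc : q ≠ c := fun h => hpq.ne (hpc.trans h.symm)
        rw [merge_of_ne hq hqc, hpc]
        simp only [merge, or_true, if_true]
        rintro rfl
        rw [hpc] at hpq
        exact hnac hpq.symm
      · by_cases hqc : q = c
        · rw [merge_of_ne hp hpc, hqc]
          simp only [merge, or_true, if_true]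
          rintro rfl
          rw [hqc] at hpq
          exact hnac hpq
        · rw [merge_of_ne hp hpc, merge_of_ne hq hqc]
          exact hpq.ne)
      (card_image_merge_le (by omega) (mem_nbhd.2 hwa) (mem_nbhd.2 hwc) hac)
    exact ⟨c, hc⟩

/-- `P` without the edge `x y`. -/
def del (P : SimpleGraph V) (x y : V) : SimpleGraph V := P.deleteEdges {s(x, y)}

@[simp] theorem del_adj {P : SimpleGraph V} {x y a b : V} :
    (del P x y).Adj a b ↔ P.Adj a b ∧ s(a, b) ≠ s(x, y) := by
  simp [del]

/-- The edge `x y` of the flat graph `P` on the vertex set `T` is locked, `T` has at most 12 vertices,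
no flat graph on fewer vertices has a locked edge, and no chord can be added to `P` at a corner of a
face. -/
structure Critical [Fintype V] (P : SimpleGraph V) (T : Finset V) (x y : V) : Prop where
  flat : IsFlat P
  supp : SupportedOn P T
  maximal : IsCornerClosed P
  adj : P.Adj x y
  locked : ¬ Unlocked (del P x y) x y
  unlocked : ∀ (P' : SimpleGraph V) (T' : Finset V) (x' y' : V), IsFlat P' → SupportedOn P' T' →
    T'.card < T.card → P'.Adj x' y' → Unlocked (del P' x' y') x' y'
  card_le : T.card ≤ 12

namespace Critical

variable [Fintype V] {P : SimpleGraph V} {T : Finset V} {x y : V}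

theorem symm (h : Critical P T x y) : Critical P T y x where
  flat := h.flat
  supp := h.supp
  maximal := h.maximal
  adj := h.adj.symm
  locked := by
    have h1 : del P y x = del P x y := by
      rw [del, del, Sym2.eq_swap]
    rw [h1]
    rintro ⟨c, hc, hxy, k, hk, hl⟩
    exact h.locked ⟨c, hc, hxy.symm, k, by rwa [← hxy], fun hl' => hl (by
      rw [hxy]
      exact hl'.symm)⟩
  unlocked := h.unlocked
  card_le := h.card_le

theorem exists_isProper (h : Critical P T x y) {G : SimpleGraph V} {T' : Finset V} (hG : IsFlat G)
    (hT : SupportedOn G T') (hlt : T'.card < T.card) : ∃ c, IsProper G c :=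
  hG.exists_isProper hT (by have := h.card_le; omega)

/-- No clique separates a critical graph. -/
theorem reachOff (h : Critical P T x y) {K : Finset V} (hK : ∀ p ∈ K, ∀ q ∈ K, p ≠ q → P.Adj p q)
    {a b : V} (ha : a ∈ T) (hb : b ∈ T) (haK : a ∉ K) (hbK : b ∉ K) : ReachOff P K a b := by
  by_contra hcon
  -- it suffices to rule out a part `B` without `x` and `y`
  have key : ∀ (B : Finset V), Disjoint K B → (∀ p ∈ B, ∀ q, P.Adj p q → q ∈ B ∨ q ∈ K) →
      (x ∉ B) → (y ∉ B) → (∃ p ∈ T, p ∈ B) → (∃ q ∈ T, q ∉ B ∧ q ∉ K) → False := by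
    rintro B hKB hB hx hy ⟨p, hpT, hpB⟩ ⟨q, hqT, hqB, hqK⟩
    have hKB' : ∀ p ∈ K, p ∉ B := fun p hp hpB => Finset.disjoint_left.1 hKB hp hpB
    have hd1 : restrictTo (del P x y) Bᶜ = del (restrictTo P Bᶜ) x y := by
      ext u v
      simp only [restrictTo_adj, del_adj]
      tauto
    have hd2 : restrictTo (del P x y) (B ∪ K) = del (restrictTo P (B ∪ K)) x y := by
      ext u v
      simp only [restrictTo_adj, del_adj]
      tauto
    have hB' : ∀ p ∈ B, ∀ q, (del P x y).Adj p q → q ∈ B ∨ q ∈ K :=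
      fun p hp q hpq => hB p hp q (del_adj.1 hpq).1
    have hu1 : Unlocked (restrictTo (del P x y) Bᶜ) x y := by
      rw [hd1]
      refine h.unlocked _ (T \ B) x y (h.flat.mono (restrictTo_le _ _)) ?_ ?_ ?_
      · rintro u v ⟨h1, h2, -⟩
        exact Finset.mem_sdiff.2 ⟨h.supp u v h1, by simpa using h2⟩
      · refine Finset.card_lt_card ⟨Finset.sdiff_subset, fun h1 => ?_⟩
        exact (Finset.mem_sdiff.1 (h1 hpT)).2 hpB
      · exact ⟨h.adj, by simpa using hx, by simpa using hy⟩
    have hflat2 : IsFlat (restrictTo P (B ∪ K)) := h.flat.mono (restrictTo_le _ _)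
    have hsupp2 : SupportedOn (restrictTo P (B ∪ K)) (T ∩ (B ∪ K)) := by
      rintro u v ⟨h1, h2, -⟩
      exact Finset.mem_inter.2 ⟨h.supp u v h1, h2⟩
    have hcard2 : (T ∩ (B ∪ K)).card < T.card := by
      refine Finset.card_lt_card ⟨Finset.inter_subset_left, fun h1 => ?_⟩
      have := (Finset.mem_inter.1 (h1 hqT)).2
      simp [hqB, hqK] at this
    by_cases hxy : x ∈ K ∧ y ∈ K
    · refine h.locked (Unlocked.of_pair_separation hB' hKB ?_ hxy.1 hxy.2 hu1 ?_)
      · intro u hu v hv huv hne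
        exact del_adj.2 ⟨hK u hu v hv huv, hne⟩
      · rw [hd2]
        exact h.unlocked _ _ x y hflat2 hsupp2 hcard2 ⟨h.adj, Finset.mem_union_right _ hxy.1,
          Finset.mem_union_right _ hxy.2⟩
    · obtain ⟨c₂, hc₂⟩ := h.exists_isProper hflat2 hsupp2 hcard2
      refine h.locked (Unlocked.of_clique_separation hB' hKB ?_ hx hy hu1 (c₂ := c₂) ?_)
      · intro u hu v hv huv
        refine del_adj.2 ⟨hK u hu v hv huv, fun he => hxy ?_⟩
        rcases Sym2.eq_iff.1 he with ⟨rfl, rfl⟩ | ⟨rfl, rfl⟩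
        exacts [⟨hu, hv⟩, ⟨hv, hu⟩]
      · rw [hd2]
        exact hc₂.mono fun u v huv => (del_adj.1 huv).1
  -- `x` and `y` are adjacent, so the part of `a` or the rest contains neither of them
  set A : Finset V := Finset.univ.filter (ReachOff P K a) with hA
  have haA : a ∈ A := by
    simp only [hA, Finset.mem_filter, Finset.mem_univ, true_and]
    exact Relation.ReflTransGen.refl
  have hbA : b ∉ A := by simpa [hA] using hcon
  have hAK : ∀ p ∈ A, p ∉ K := by
    intro p hp
    have : ReachOff P K a p := by simpa [hA] using hp
    cases this with
    | refl => exact haK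
    | tail _ h => exact h.2
  have hAcl : ∀ p ∈ A, ∀ q, P.Adj p q → q ∈ A ∨ q ∈ K := by
    intro p hp q hpq
    by_cases hq : q ∈ K
    · exact Or.inr hq
    · refine Or.inl ?_
      simp only [hA, Finset.mem_filter, Finset.mem_univ, true_and] at hp ⊢
      exact hp.tail ⟨hpq, hq⟩
  by_cases hxA : x ∈ A ∨ y ∈ A
  · -- `x` and `y` are not in the complementary part
    set B : Finset V := (A ∪ K)ᶜ with hB
    have hBcl : ∀ p ∈ B, ∀ q, P.Adj p q → q ∈ B ∨ q ∈ K := by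
      intro p hp q hpq
      simp only [hB, Finset.mem_compl, Finset.mem_union, not_or] at hp ⊢
      by_cases hqK : q ∈ K
      · exact Or.inr hqK
      · refine Or.inl ⟨fun hqA => ?_, hqK⟩
        rcases hAcl q hqA p hpq.symm with h1 | h1
        exacts [hp.1 h1, hp.2 h1]
    have hxyAK : (x ∈ A ∨ x ∈ K) ∧ (y ∈ A ∨ y ∈ K) := by
      rcases hxA with h1 | h1
      · exact ⟨Or.inl h1, hAcl x h1 y h.adj⟩
      · exact ⟨hAcl y h1 x h.adj.symm, Or.inl h1⟩
    refine key B ?_ hBcl ?_ ?_ ⟨b, hb, ?_⟩ ⟨a, ha, ?_, haK⟩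
    · rw [Finset.disjoint_left]
      intro p hp
      simp [hB, hp]
    · simpa [hB, or_iff_not_imp_left] using hxyAK.1
    · simpa [hB, or_iff_not_imp_left] using hxyAK.2
    · simp [hB, hbA, hbK]
    · simp [hB, haA]
  · push Not at hxA
    refine key A ?_ hAcl hxA.1 hxA.2 ⟨a, ha, haA⟩ ⟨b, hb, hbA, hbK⟩
    rw [Finset.disjoint_left]
    intro p hp hpA
    exact hAK p hpA hp

end Critical

end Reductions

end AGraph
namespace AGraph

/-! ### Vertices of degree 4 in a critical graph -/

section CriticalStructure

open scoped Classical

variable {V : Type*}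

theorem quot_adj_of_adj {P : SimpleGraph V} {f : V → V} {a b : V} (h : P.Adj a b) (ha : f a = a)
    (hb : f b = b) : (quot f P).Adj a b := ⟨h.ne, a, b, h, ha, hb⟩

/-- The map contracting everything reachable from `a` along `r₁` to `a`, and everything reachable
from `b` along `r₂` to `b`. -/
noncomputable def collapse (r₁ r₂ : V → V → Prop) (a b z : V) : V :=
  if Relation.ReflTransGen r₁ a z then a else if Relation.ReflTransGen r₂ b z then b else z

theorem collapse_left {r₁ r₂ : V → V → Prop} {a b z : V} (h : Relation.ReflTransGen r₁ a z) :
    collapse r₁ r₂ a b z = a := by simp [collapse, h]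

theorem collapse_right {r₁ r₂ : V → V → Prop} {a b z : V} (h₁ : ¬ Relation.ReflTransGen r₁ a z)
    (h : Relation.ReflTransGen r₂ b z) : collapse r₁ r₂ a b z = b := by simp [collapse, h, h₁]

theorem collapse_of_not {r₁ r₂ : V → V → Prop} {a b z : V} (h₁ : ¬ Relation.ReflTransGen r₁ a z)
    (h : ¬ Relation.ReflTransGen r₂ b z) : collapse r₁ r₂ a b z = z := by simp [collapse, h, h₁]

theorem IsFlat.quot_collapse [Fintype V] {P : SimpleGraph V} (hP : IsFlat P) {r₁ r₂ : V → V → Prop} {a b : V}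
    (h₁ : ∀ p q, r₁ p q → P.Adj p q) (h₂ : ∀ p q, r₂ p q → P.Adj p q)
    (hdisj : ∀ z, Relation.ReflTransGen r₁ a z → ¬ Relation.ReflTransGen r₂ b z) :
    IsFlat (AGraph.quot (collapse r₁ r₂ a b) P) := by
  refine hP.quot _ fun z => ?_
  by_cases hz₁ : Relation.ReflTransGen r₁ a z
  · rw [collapse_left hz₁]
    induction hz₁ with
    | refl => exact Relation.ReflTransGen.refl
    | tail h h' ih => exact ih.tail ⟨h₁ _ _ h', by rw [collapse_left h, collapse_left (h.tail h')]⟩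
  · by_cases hz₂ : Relation.ReflTransGen r₂ b z
    · rw [collapse_right hz₁ hz₂]
      clear hz₁
      induction hz₂ with
      | refl => exact Relation.ReflTransGen.refl
      | tail h h' ih =>
        exact ih.tail ⟨h₂ _ _ h', by
          rw [collapse_right (fun h1 => hdisj _ h1 h) h,
            collapse_right (fun h1 => hdisj _ h1 (h.tail h')) (h.tail h')]⟩
    · rw [collapse_of_not hz₁ hz₂]

/-- A path ending in `b` has a last edge into `b`. -/
theorem exists_last_step {r : V → V → Prop} {a b : V} (h : Relation.ReflTransGen r a b)
    (hab : a ≠ b) : ∃ t, Relation.ReflTransGen (fun p q => r p q ∧ q ≠ b) a t ∧ r t b := by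
  have key : ∀ z, Relation.ReflTransGen r a z →
      Relation.ReflTransGen (fun p q => r p q ∧ q ≠ b) a z ∨
        ∃ t, Relation.ReflTransGen (fun p q => r p q ∧ q ≠ b) a t ∧ r t b := by
    intro z hz
    induction hz with
    | refl => exact Or.inl Relation.ReflTransGen.refl
    | @tail p q _ hs ih =>
      rcases ih with h1 | h1
      · by_cases hq : q = b
        · exact Or.inr ⟨p, h1, hq ▸ hs⟩
        · exact Or.inl (h1.tail ⟨hs, hq⟩)
      · exact Or.inr h1
  rcases key b h with h1 | h1
  · cases h1 with
    | refl => exact absurd rfl hab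
    | tail _ hs => exact absurd rfl hs.2
  · exact h1

theorem ReachOff.exists_last {P : SimpleGraph V} {K : Finset V} {a b : V} (h : ReachOff P K a b)
    (hab : a ≠ b) : ∃ t, ReachOff P (insert b K) a t ∧ P.Adj t b := by
  obtain ⟨t, ht, htb⟩ := exists_last_step h hab
  exact ⟨t, reflTransGen_mono (fun p q hs => ⟨hs.1.1, by simp [hs.1.2, hs.2]⟩) ht, htb.1⟩

theorem ReachOff.notMem {P : SimpleGraph V} {K : Finset V} {a b : V} (h : ReachOff P K a b)
    (ha : a ∉ K) : b ∉ K := by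
  cases h with
  | refl => exact ha
  | tail _ hs => exact hs.2

/-- `K₅` with one edge replaced by a path is not contained in a flat graph. -/
theorem IsFlat.no_K5_path [Fintype V] {P : SimpleGraph V} (hP : IsFlat P) {k l m a b : V}
    (hkl : P.Adj k l) (hkm : P.Adj k m) (hlm : P.Adj l m)
    (hka : P.Adj k a) (hla : P.Adj l a) (hma : P.Adj m a)
    (hkb : P.Adj k b) (hlb : P.Adj l b) (hmb : P.Adj m b) (hab : a ≠ b)
    (h : ReachOff P {k, l, m} a b) : False := by
  obtain ⟨t, ht, htb⟩ := h.exists_last hab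
  have ha : a ∉ insert b ({k, l, m} : Finset V) := by
    simp [hab, hka.ne', hla.ne', hma.ne']
  set r : V → V → Prop := fun p q => P.Adj p q ∧ q ∉ insert b ({k, l, m} : Finset V) with hr
  have hnot : ∀ z ∈ insert b ({k, l, m} : Finset V), ¬ Relation.ReflTransGen r a z :=
    fun z hz h1 => ReachOff.notMem h1 ha hz
  have hb : ∀ z, Relation.ReflTransGen (fun _ _ : V => False) b z → z = b := by
    intro z hz
    cases hz with
    | refl => rfl
    | tail _ h => exact h.elim
  have hQ := hP.quot_collapse (r₁ := r) (r₂ := fun _ _ => False) (a := a) (b := b)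
    (fun p q h => h.1) (fun p q h => h.elim) (fun z h1 h2 => by
      rw [hb z h2] at h1
      exact hnot b (by simp) h1)
  have hfix : ∀ z ∈ insert b ({k, l, m} : Finset V), collapse r (fun _ _ => False) a b z = z := by
    intro z hz
    by_cases h1 : z = b
    · rw [h1, collapse_right (hnot b (by simp)) Relation.ReflTransGen.refl]
    · exact collapse_of_not (hnot z hz) fun h2 => h1 (hb z h2)
  have hk := hfix k (by simp)
  have hl := hfix l (by simp)
  have hm := hfix m (by simp)
  have hb' := hfix b (by simp)
  have ha' : collapse r (fun _ _ => False) a b a = a := collapse_left Relation.ReflTransGen.refl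
  exact hQ.no_K5 (quot_adj_of_adj hkl hk hl) (quot_adj_of_adj hkm hk hm)
    (quot_adj_of_adj hka hk ha') (quot_adj_of_adj hkb hk hb') (quot_adj_of_adj hlm hl hm)
    (quot_adj_of_adj hla hl ha') (quot_adj_of_adj hlb hl hb') (quot_adj_of_adj hma hm ha')
    (quot_adj_of_adj hmb hm hb') ⟨hab, t, b, htb, collapse_left ht, hb'⟩

theorem merge_eq_iff {a w c p q : V} (hp : p ≠ w) (hq : q ≠ w) :
    merge a w c p = merge a w c q ↔ p = q ∨ (p = a ∧ q = c) ∨ (p = c ∧ q = a) := by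
  unfold merge
  by_cases h1 : p = c <;> by_cases h2 : q = c <;> (simp [hp, hq, h1, h2]; try grind)

variable [Fintype V]

/-- The neighbours of a vertex `w` of degree 4 that cannot be removed: they form a path
`x`, `p`, `s`, `y`. -/
def IsBad (P : SimpleGraph V) (x y w : V) : Prop :=
  ∃ p s, nbhd P w = {x, p, s, y} ∧ [x, p, s, y].Nodup ∧ P.Adj x p ∧ P.Adj p s ∧ P.Adj s y

theorem IsBad.symm {P : SimpleGraph V} {x y w : V} (h : IsBad P x y w) : IsBad P y x w := by
  obtain ⟨p, s, h1, h2, h3, h4, h5⟩ := h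
  refine ⟨s, p, ?_, ?_, h5.symm, h4.symm, h3.symm⟩
  · rw [h1]
    ext z
    simp only [Finset.mem_insert, Finset.mem_singleton]
    tauto
  · have := List.nodup_reverse.2 h2
    simpa using this

theorem IsBad.adj {P : SimpleGraph V} {x y w : V} (h : IsBad P x y w) :
    P.Adj w x ∧ P.Adj w y := by
  obtain ⟨p, s, h1, -⟩ := h
  rw [← mem_nbhd, ← mem_nbhd, h1]
  simp

theorem IsBad.card {P : SimpleGraph V} {x y w : V} (h : IsBad P x y w) : (nbhd P w).card = 4 := by
  obtain ⟨p, s, h1, h2, -⟩ := h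
  have : ({x, p, s, y} : Finset V) = [x, p, s, y].toFinset := by simp
  rw [h1, this, List.toFinset_card_of_nodup h2]
  rfl

namespace Critical

variable {P : SimpleGraph V} {T : Finset V} {x y : V}

theorem mem_left (h : Critical P T x y) : x ∈ T := h.supp x y h.adj

theorem reachOff_singleton (h : Critical P T x y) (w a b : V) (ha : P.Adj w a) (hb : P.Adj w b) :
    ReachOff P {w} a b :=
  h.reachOff (by
    intro p hp q hq hpq
    rw [Finset.mem_singleton] at hp hq
    exact absurd (hp.trans hq.symm) hpq) (h.supp a w ha.symm) (h.supp b w hb.symm)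
    (by simpa using ha.ne') (by simpa using hb.ne')

theorem nbhd_del {w : V} (hx : w ≠ x) (hy : w ≠ y) : nbhd (del P x y) w = nbhd P w := by
  ext z
  simp only [mem_nbhd, del_adj, and_iff_left_iff_imp]
  intro _ he
  rcases Sym2.eq_iff.1 he with ⟨h1, -⟩ | ⟨h1, -⟩
  exacts [hx h1, hy h1]

/-- Vertices of degree at most 3 are reducible. -/
theorem four_le_card_nbhd (h : Critical P T x y) {w : V} (hw : w ∈ T) (hx : w ≠ x) (hy : w ≠ y) :
    4 ≤ (nbhd P w).card := by
  by_contra! hlt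
  have hu := h.unlocked (restrictTo P (T.erase w)) (T.erase w) x y
    (h.flat.mono (restrictTo_le _ _)) (SupportedOn.restrictTo _ _) (Finset.card_erase_lt_of_mem hw)
    ⟨h.adj, Finset.mem_erase.2 ⟨hx.symm, h.mem_left⟩, Finset.mem_erase.2 ⟨hy.symm, h.symm.mem_left⟩⟩
  refine h.locked (Unlocked.lift id w hx.symm hy.symm hu (fun p q hpq hp hq => ?_) ?_)
  · have hpq' := del_adj.1 hpq
    exact del_adj.2 ⟨⟨hpq'.1, Finset.mem_erase.2 ⟨hp, h.supp p q hpq'.1⟩,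
      Finset.mem_erase.2 ⟨hq, h.supp q p hpq'.1.symm⟩⟩, hpq'.2⟩
  · rw [nbhd_del hx hy, Finset.image_id]
    omega

/-- Two non-adjacent neighbours of a vertex of degree 4 can be identified, unless this makes `x`
and `y` adjacent. -/
theorem adj_of_card_nbhd_eq_four (h : Critical P T x y) {w a c : V} (hx : w ≠ x)
    (hy : w ≠ y) (hdeg : (nbhd P w).card = 4) (ha : P.Adj w a) (hc : P.Adj w c) (hac : a ≠ c)
    (hnac : ¬ P.Adj a c) : (a = x ∧ P.Adj c y) ∨ (a = y ∧ P.Adj c x) ∨ (c = x ∧ P.Adj a y) ∨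
      (c = y ∧ P.Adj a x) := by
  by_contra hcon
  set f := merge a w c with hf
  have hw : w ∈ T := h.supp w a ha
  have hne : ∀ p q, P.Adj p q → p ≠ w → q ≠ w → f p ≠ f q := by
    intro p q hpq hp hq he
    rcases (merge_eq_iff hp hq).1 he with rfl | ⟨rfl, rfl⟩ | ⟨rfl, rfl⟩
    exacts [hpq.ne rfl, hnac hpq, hnac hpq.symm]
  have hadj : ∀ p q, P.Adj p q → p ≠ w → q ≠ w → (quot f P).Adj (f p) (f q) :=
    fun p q hpq hp hq => ⟨hne p q hpq hp hq, p, q, hpq, rfl, rfl⟩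
  have hu := h.unlocked (quot f P) ((T.erase w).erase c) (f x) (f y)
    (h.flat.quot _ (reflTransGen_merge ha.symm hc)) (h.supp.quot_merge (h.supp a w ha.symm) ha.ne' hac)
    (lt_of_le_of_lt (Finset.card_le_card (Finset.erase_subset _ _)) (Finset.card_erase_lt_of_mem hw))
    (hadj x y h.adj hx.symm hy.symm)
  refine h.locked (Unlocked.lift f w hx.symm hy.symm hu (fun p q hpq hp hq => ?_) ?_)
  · have hpq' := del_adj.1 hpq
    refine del_adj.2 ⟨hadj p q hpq'.1 hp hq, fun he => ?_⟩
    have key : ∀ p q, P.Adj p q → p ≠ w → q ≠ w → s(p, q) ≠ s(x, y) → f p = f x → f q = f y →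
        False := by
      intro p q hpq hp hq hne' h1 h2
      have h3 := hpq.ne
      have h4 := h.adj.ne
      have h5 : ¬ (p = x ∧ q = y) := fun h => hne' (by rw [h.1, h.2])
      have h6 : ¬ (p = y ∧ q = x) := fun h => hne' (by rw [h.1, h.2, Sym2.eq_swap])
      rcases (merge_eq_iff hp hx.symm).1 h1 with rfl | ⟨rfl, rfl⟩ | ⟨rfl, rfl⟩ <;>
        rcases (merge_eq_iff hq hy.symm).1 h2 with rfl | ⟨rfl, rfl⟩ | ⟨rfl, rfl⟩ <;>
        simp_all [SimpleGraph.adj_comm]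
    rcases Sym2.eq_iff.1 he with ⟨h1, h2⟩ | ⟨h1, h2⟩
    · exact key p q hpq'.1 hp hq hpq'.2 h1 h2
    · exact key q p hpq'.1.symm hq hp (by rw [Sym2.eq_swap]; exact hpq'.2) h2 h1
  · rw [nbhd_del hx hy]
    exact card_image_merge_le hdeg (mem_nbhd.2 ha) (mem_nbhd.2 hc) hac

/-- Otherwise `w`, `x`, `s` are three common neighbours of `p` and `y`, which are connected off them,
and this is a `K₅` with one edge replaced by a path. -/
theorem IsBad.not_adj (h : Critical P T x y) {w p s : V} (hN : nbhd P w = {x, p, s, y})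
    (hnd : [x, p, s, y].Nodup) (hxp : P.Adj x p) (hps : P.Adj p s) (hsy : P.Adj s y) :
    ¬ P.Adj x s := by
  intro hxs
  have hw : ∀ z ∈ ({x, p, s, y} : Finset V), P.Adj w z := fun z hz => mem_nbhd.1 (hN ▸ hz)
  have hwx := hw x (by simp)
  have hwp := hw p (by simp)
  have hws := hw s (by simp)
  have hwy := hw y (by simp)
  have hpy : p ≠ y := by
    rintro rfl
    simp at hnd
  refine h.flat.no_K5_path hwx.symm hxs hws hxp hwp hps.symm h.adj hwy hsy hpy ?_
  refine h.reachOff ?_ (h.supp p x hxp.symm) h.symm.mem_left ?_ ?_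
  · intro u hu v hv huv
    simp only [Finset.mem_insert, Finset.mem_singleton] at hu hv
    rcases hu with rfl | rfl | rfl <;> rcases hv with rfl | rfl | rfl <;>
      first | exact absurd rfl huv | assumption | (apply SimpleGraph.Adj.symm; assumption)
  · simp [hxp.ne', hwp.ne', hps.ne]
  · simp [h.adj.ne', hwy.ne', hsy.ne']

/-- A vertex `w` whose neighbours form a cycle `x b c d` is bad if identifying `x` and `c` is not
allowed because `c` is adjacent to `y`. Here `y` is `b` or `d`, since otherwise either `b` and `d` can
be identified, or they are adjacent and contracting `x y` yields a `K₅`. -/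
theorem isBad_of_adj (h : Critical P T x y) {w b c d : V} (hy : w ≠ y)
    (hN : nbhd P w = {x, b, c, d}) (hnd : [x, b, c, d].Nodup) (hxb : P.Adj x b) (hbc : P.Adj b c)
    (hcd : P.Adj c d) (hdx : P.Adj d x) (hxc : ¬ P.Adj x c) (hcy : P.Adj c y) : IsBad P x y w := by
  have hw : ∀ z ∈ ({x, b, c, d} : Finset V), P.Adj w z := fun z hz => mem_nbhd.1 (hN ▸ hz)
  have hwx := hw x (by simp)
  have hwb := hw b (by simp)
  have hwc := hw c (by simp)
  have hwd := hw d (by simp)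
  have hbd : b ≠ d := by
    rintro rfl
    simp at hnd
  have hcard : (nbhd P w).card = 4 := by
    have : ({x, b, c, d} : Finset V) = [x, b, c, d].toFinset := by simp
    rw [hN, this, List.toFinset_card_of_nodup hnd]
    rfl
  by_cases hyb : y = b
  · subst hyb
    refine ⟨d, c, ?_, ?_, hdx.symm, hcd.symm, hbc.symm⟩
    · rw [hN]
      ext z
      simp only [Finset.mem_insert, Finset.mem_singleton]
      tauto
    · simp only [List.nodup_cons, List.mem_cons, List.not_mem_nil, or_false, not_or] at hnd ⊢
      grind
  · by_cases hyd : y = d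
    · subst hyd
      exact ⟨b, c, hN, hnd, hxb, hbc, hcd⟩
    · exfalso
      by_cases hadj : P.Adj b d
      · have hyx := h.adj.ne'
        have hQ := h.flat.quot (merge x y x) (reflTransGen_merge h.adj h.adj.symm)
        have hfix : ∀ z, z ≠ y → merge x y x z = z := by
          intro z hz
          by_cases hzx : z = x
          · simp [merge, hzx]
          · exact merge_of_ne hz hzx
        have hx' := hfix x hyx.symm
        have hb' := hfix b (Ne.symm hyb)
        have hc' := hfix c hcy.ne
        have hd' := hfix d (Ne.symm hyd)
        have hw' := hfix w hy
        exact hQ.no_K5 (quot_adj_of_adj hwx hw' hx') (quot_adj_of_adj hwb hw' hb')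
          (quot_adj_of_adj hwc hw' hc') (quot_adj_of_adj hwd hw' hd') (quot_adj_of_adj hxb hx' hb')
          ⟨by rintro rfl; simp at hnd, y, c, hcy.symm, by simp [merge], hc'⟩
          (quot_adj_of_adj hdx.symm hx' hd') (quot_adj_of_adj hbc hb' hc')
          (quot_adj_of_adj hadj hb' hd') (quot_adj_of_adj hcd hc' hd')
      · rcases h.adj_of_card_nbhd_eq_four hwx.ne hy hcard hwb hwd hbd hadj with
          h1 | h1 | h1 | h1
        · exact hxb.ne' h1.1
        · exact hyb h1.1.symm
        · exact hdx.ne h1.1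
        · exact hyd h1.1.symm

/-- Vertices of degree 4 are reducible unless they are bad. -/
theorem isBad (h : Critical P T x y) {w : V} (hx : w ≠ x) (hy : w ≠ y)
    (hdeg : (nbhd P w).card = 4) : IsBad P x y w := by
  obtain ⟨a, ha⟩ := Finset.card_pos.1 (by omega : 0 < (nbhd P w).card)
  obtain ⟨b, c, d, hN, hab, hac, had, hbc, hbd, hcd, h1, h2, h3, h4⟩ :=
    h.flat.exists_link_four h.maximal hdeg (mem_nbhd.1 ha) (h.reachOff_singleton w)
  -- the statement for a non-adjacent opposite pair
  have key : ∀ a b c d, nbhd P w = {a, b, c, d} → [a, b, c, d].Nodup → P.Adj a b → P.Adj b c →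
      P.Adj c d → P.Adj d a → ¬ P.Adj a c → IsBad P x y w := by
    intro a b c d hN hnd h1 h2 h3 h4 hnac
    have hw : ∀ z ∈ ({a, b, c, d} : Finset V), P.Adj w z := fun z hz => mem_nbhd.1 (hN ▸ hz)
    have hac : a ≠ c := by
      rintro rfl
      simp at hnd
    have hN' : nbhd P w = {c, b, a, d} := by
      rw [hN]
      ext z
      simp only [Finset.mem_insert, Finset.mem_singleton]
      tauto
    have hnd' : [c, b, a, d].Nodup := by
      simp only [List.nodup_cons, List.mem_cons, List.not_mem_nil, or_false, not_or] at hnd ⊢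
      grind
    rcases h.adj_of_card_nbhd_eq_four hx hy hdeg (hw a (by simp)) (hw c (by simp)) hac hnac with
      ⟨rfl, h5⟩ | ⟨rfl, h5⟩ | ⟨rfl, h5⟩ | ⟨rfl, h5⟩
    · exact h.isBad_of_adj hy hN hnd h1 h2 h3 h4 hnac h5
    · exact (h.symm.isBad_of_adj hx hN hnd h1 h2 h3 h4 hnac h5).symm
    · exact h.isBad_of_adj hy hN' hnd' h2.symm h1.symm h4.symm h3.symm
        (fun h => hnac h.symm) h5
    · exact (h.symm.isBad_of_adj hx hN' hnd' h2.symm h1.symm h4.symm h3.symm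
        (fun h => hnac h.symm) h5).symm
  have hw : ∀ z ∈ ({a, b, c, d} : Finset V), P.Adj w z := fun z hz => mem_nbhd.1 (hN ▸ hz)
  by_cases hadj : P.Adj a c
  · by_cases hadj' : P.Adj b d
    · exact (h.flat.no_K5 (hw a (by simp)) (hw b (by simp)) (hw c (by simp)) (hw d (by simp))
        h1 hadj h4.symm h2 hadj' h3).elim
    · refine key b c d a ?_ ?_ h2 h3 h4 h1 hadj'
      · rw [hN]
        ext z
        simp only [Finset.mem_insert, Finset.mem_singleton]
        tauto
      · simp [hab.symm, hac.symm, had.symm, hbc, hbd, hcd]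
  · exact key a b c d hN (by simp [hab, hac, had, hbc, hbd, hcd]) h1 h2 h3 h4 hadj

end Critical

end CriticalStructure

end AGraph
namespace AGraph

/-! ### Degrees of the ends of a locked edge -/

section EndDegrees

open scoped Classical

variable {V : Type*}

theorem ReflTransGen.of_forall_target {r : V → V → Prop} {p : V → Prop} {a b : V}
    (h : Relation.ReflTransGen r a b) (ha : p a) (hr : ∀ u v, r u v → p v) : p b := by
  cases h with
  | refl => exact ha
  | tail _ hs => exact hr _ _ hs

/-- Exchanging two colours on a union of Kempe chains preserves properness. -/
theorem IsProper.swapOn {G : SimpleGraph V} {c : V → Fin 4} (hc : IsProper G c) {j k : Fin 4}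
    {S : V → Prop} (hS : ∀ a b, G.Adj a b → (c a = j ∨ c a = k) → (c b = j ∨ c b = k) → S a → S b) :
    IsProper G fun z => if S z then Equiv.swap j k (c z) else c z := by
  have key : ∀ a b, G.Adj a b → S a → ¬ S b → Equiv.swap j k (c a) ≠ c b := by
    intro a b hab ha hb h
    by_cases h1 : c a = j ∨ c a = k
    · refine hb (hS a b hab h1 ?_ ha)
      rcases h1 with h1 | h1 <;> rw [h1] at h <;> simp at h <;> simp [h]
    · push Not at h1
      rw [Equiv.swap_apply_of_ne_of_ne h1.1 h1.2] at h
      exact hc a b hab h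
  intro a b hab
  by_cases ha : S a <;> by_cases hb : S b <;> simp only [ha, hb, if_true, if_false]
  · exact fun h => hc a b hab ((Equiv.swap j k).injective h)
  · exact key a b hab ha hb
  · exact (key b a hab.symm hb ha).symm
  · exact hc a b hab

/-- If `x` and `y` are locked, then all other colours occur at `x`. -/
theorem exists_adj_of_not_unlocked {G : SimpleGraph V} {x y : V} (hl : ¬ Unlocked G x y)
    (hne : x ≠ y) {c : V → Fin 4} (hc : IsProper G c) (hxy : c x = c y) {k : Fin 4}
    (hk : k ≠ c x) : ∃ a, G.Adj x a ∧ c a = k := by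
  have h : Linked G c (c x) k x y := by
    by_contra h
    exact hl ⟨c, hc, hxy, k, hk, h⟩
  rcases Relation.ReflTransGen.cases_head h with h1 | ⟨a, h1, -⟩
  · exact absurd h1 hne
  · refine ⟨a, h1.1, h1.2.2.resolve_left fun h2 => hc x a h1.1 h2.symm⟩

namespace Critical

variable [Fintype V] {P : SimpleGraph V} {T : Finset V} {x y : V}

/-- Contracting the edge `x y` shows that `P - x y` has a colouring in which `x` and `y` have the
same colour. -/
theorem exists_isProper_del (h : Critical P T x y) :
    ∃ c, IsProper (del P x y) c ∧ c x = c y := by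
  have hxy := h.adj.ne
  have hQ := h.flat.quot (merge x y x) (reflTransGen_merge h.adj h.adj.symm)
  have hsupp : SupportedOn (AGraph.quot (merge x y x) P) (T.erase y) := by
    rintro _ _ ⟨-, a, b, hab, rfl, rfl⟩
    unfold merge
    split_ifs with h1
    · exact Finset.mem_erase.2 ⟨hxy, h.mem_left⟩
    · push Not at h1
      exact Finset.mem_erase.2 ⟨h1.1, h.supp a b hab⟩
  obtain ⟨c, hc⟩ := h.exists_isProper hQ hsupp (Finset.card_erase_lt_of_mem h.symm.mem_left)
  refine ⟨fun z => c (merge x y x z), fun a b hab => ?_, by simp [merge]⟩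
  obtain ⟨hab, hne⟩ := del_adj.1 hab
  refine hc _ _ ⟨fun he => ?_, a, b, hab, rfl, rfl⟩
  have hab' := hab.ne
  unfold merge at he
  split_ifs at he with h1 h2 h2
  · rcases h1 with rfl | rfl <;> rcases h2 with rfl | rfl <;> simp_all
  · exact h2 (Or.inr he.symm)
  · exact h1 (Or.inr he)
  · exact hab' he

/-- The end `x` of a locked edge has degree at least 5: with degree 4, two disjoint Kempe chains
would complete the wheel around `x` to a `K₅`. -/
theorem five_le_card_nbhd_left (h : Critical P T x y) : 5 ≤ (nbhd P x).card := by
  obtain ⟨c, hc, hxy⟩ := h.exists_isProper_del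
  set G := del P x y with hG
  have hGP : ∀ a b, G.Adj a b → P.Adj a b := fun a b hab => (del_adj.1 hab).1
  have hex : ∀ c, IsProper G c → c x = c y → ∀ k, k ≠ c x → ∃ a, (P.Adj x a ∧ a ≠ y) ∧ c a = k := by
    intro c hc hxy k hk
    obtain ⟨a, ha, hak⟩ := exists_adj_of_not_unlocked h.locked h.adj.ne hc hxy hk
    refine ⟨a, ⟨hGP _ _ ha, ?_⟩, hak⟩
    rintro rfl
    exact (del_adj.1 ha).2 rfl
  obtain ⟨k₁, hk₁⟩ : ∃ k₁, k₁ ≠ c x := exists_ne _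
  obtain ⟨k₂, k₃, h23, h2x, h21, h3x, h31, hall⟩ := exists_other_colors (c x) k₁ hk₁
  obtain ⟨u, ⟨hxu, huy⟩, hcu⟩ := hex c hc hxy k₁ hk₁
  obtain ⟨r, ⟨hxr, hry⟩, hcr⟩ := hex c hc hxy k₂ h2x
  obtain ⟨v, ⟨hxv, hvy⟩, hcv⟩ := hex c hc hxy k₃ h3x
  have hur : u ≠ r := by rintro rfl; exact h21 (hcr.symm.trans hcu)
  have huv : u ≠ v := by rintro rfl; exact h31 (hcv.symm.trans hcu)
  have hrv : r ≠ v := by rintro rfl; exact h23 (hcr.symm.trans hcv)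
  by_contra! hlt
  have hsub : [y, u, r, v].toFinset ⊆ nbhd P x := by
    intro z hz
    simp only [List.toFinset_cons, List.toFinset_nil, insert_empty_eq, Finset.mem_insert,
      Finset.mem_singleton] at hz
    rw [mem_nbhd]
    rcases hz with rfl | rfl | rfl | rfl
    exacts [h.adj, hxu, hxr, hxv]
  have hcard4 : [y, u, r, v].toFinset.card = 4 := by
    rw [List.toFinset_card_of_nodup (by simp [huy.symm, hry.symm, hvy.symm, hur, huv, hrv])]
    rfl
  have hN := Finset.eq_of_subset_of_card_le hsub (by omega)
  have hdeg : (nbhd P x).card = 4 := hN ▸ hcard4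
  obtain ⟨u', r', v', hN', hyu, hyr, hyv, hur', huv', hrv', a1, a2, a3, a4⟩ :=
    h.flat.exists_link_four h.maximal hdeg h.adj (h.reachOff_singleton x)
  clear hcard4 hsub hlt
  -- the three neighbours of `x` other than `y` have the three other colours
  have hmem : ∀ z, z ≠ y → P.Adj x z → z = u' ∨ z = r' ∨ z = v' := by
    intro z hz hxz
    have := mem_nbhd.2 hxz
    rw [hN'] at this
    simpa [hz] using this
  have hxN : ∀ z ∈ ({y, u', r', v'} : Finset V), P.Adj x z := fun z hz => mem_nbhd.1 (hN' ▸ hz)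
  have hxu' := hxN u' (by simp)
  have hxr' := hxN r' (by simp)
  have hxv' := hxN v' (by simp)
  have hcol : c u' ≠ c x ∧ c r' ≠ c x ∧ c v' ≠ c x ∧ c u' ≠ c r' ∧ c u' ≠ c v' ∧ c r' ≠ c v' := by
    have e1 := hmem u huy hxu
    have e2 := hmem r hry hxr
    have e3 := hmem v hvy hxv
    clear hN hN'
    rcases e1 with rfl | rfl | rfl <;> rcases e2 with rfl | rfl | rfl <;>
      rcases e3 with rfl | rfl | rfl <;> simp_all [eq_comm]
  obtain ⟨c1, c2, c3, c4, c5, c6⟩ := hcol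
  clear hN hcu hcr hcv hur huv hrv huy hry hvy hxu hxr hxv hall h31 h3x h21 h2x h23 hk₁
  -- a chain from `y` to `r'`
  have hyr1 : ∃ t, Relation.ReflTransGen (fun p q => ((G.Adj p q ∧ (c p = c x ∨ c p = c r') ∧
      (c q = c x ∨ c q = c r')) ∧ q ≠ x) ∧ q ≠ r') y t ∧ P.Adj t r' := by
    have h1 : Linked G c (c x) (c r') y x := by
      by_contra h1
      exact h.locked ⟨c, hc, hxy, c r', c2, fun h2 => h1 h2.symm⟩
    obtain ⟨t, ht, htx⟩ := exists_last_step h1 h.adj.ne'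
    have htr : t = r' := by
      have ht1 := hmem t (by rintro rfl; exact (del_adj.1 htx.1).2 Sym2.eq_swap)
        (hGP _ _ htx.1.symm)
      have ht2 : c t = c r' := htx.2.1.resolve_left fun h3 => hc _ _ htx.1 h3
      rcases ht1 with rfl | rfl | rfl
      exacts [absurd ht2 c4, rfl, absurd ht2.symm c6]
    subst htr
    obtain ⟨t', ht', hs⟩ := exists_last_step ht hyr
    exact ⟨t', ht', hGP _ _ hs.1.1⟩
  -- a chain from `u'` to `v'`: otherwise an exchange on the chain of `u'` would remove its colour from
  -- the neighbours of `x`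
  have huv1 : ∃ t, Relation.ReflTransGen (fun p q => (G.Adj p q ∧ (c p = c u' ∨ c p = c v') ∧
      (c q = c u' ∨ c q = c v')) ∧ q ≠ v') u' t ∧ P.Adj t v' := by
    have h1 : Linked G c (c u') (c v') u' v' := by
      by_contra h1
      have hpr := hc.swapOn (j := c u') (k := c v') (S := Linked G c (c u') (c v') u')
        fun a b hab ha hb hl => hl.tail ⟨hab, ha, hb⟩
      have hfix : ∀ z, c z ≠ c u' → c z ≠ c v' → (if Linked G c (c u') (c v') u' z then
          Equiv.swap (c u') (c v') (c z) else c z) = c z := by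
        intro z hz1 hz2
        rw [Equiv.swap_apply_of_ne_of_ne hz1 hz2, ite_self]
      have hx1 := hfix x c1.symm c3.symm
      have hy1 := hfix y (hxy ▸ c1.symm) (hxy ▸ c3.symm)
      obtain ⟨a, ⟨hxa, hay⟩, hca⟩ := hex _ hpr (hx1.trans (hxy.trans hy1.symm)) (c u')
        (by simp only [hx1]; exact c1)
      rcases hmem a hay hxa with rfl | rfl | rfl
      · have : Linked G c (c a) (c v') a a := Relation.ReflTransGen.refl
        simp only [this, if_true, Equiv.swap_apply_left] at hca
        exact c5 hca.symm
      · simp only [hfix _ c4.symm c6] at hca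
        exact c4 hca.symm
      · simp only [h1, if_false] at hca
        exact c5 hca.symm
    obtain ⟨t, ht, htv⟩ := exists_last_step h1 huv'
    exact ⟨t, ht, hGP _ _ htv.1⟩
  obtain ⟨t, ht, htr⟩ := hyr1
  obtain ⟨t', ht', htv⟩ := huv1
  set r₁ : V → V → Prop := fun p q => ((G.Adj p q ∧ (c p = c x ∨ c p = c r') ∧
      (c q = c x ∨ c q = c r')) ∧ q ≠ x) ∧ q ≠ r' with hr₁
  set r₂ : V → V → Prop := fun p q => (G.Adj p q ∧ (c p = c u' ∨ c p = c v') ∧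
      (c q = c u' ∨ c q = c v')) ∧ q ≠ v' with hr₂
  have hp1 : ∀ z, Relation.ReflTransGen r₁ y z → (c z = c x ∨ c z = c r') ∧ z ≠ x ∧ z ≠ r' :=
    fun z hz => ReflTransGen.of_forall_target
      (p := fun z => (c z = c x ∨ c z = c r') ∧ z ≠ x ∧ z ≠ r') hz
      ⟨Or.inl hxy.symm, h.adj.ne', hyr⟩ fun _ _ h => ⟨h.1.1.2.2, h.1.2, h.2⟩
  have hp2 : ∀ z, Relation.ReflTransGen r₂ u' z → (c z = c u' ∨ c z = c v') ∧ z ≠ v' :=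
    fun z hz => ReflTransGen.of_forall_target
      (p := fun z => (c z = c u' ∨ c z = c v') ∧ z ≠ v') hz
      ⟨Or.inl rfl, huv'⟩ fun _ _ h => ⟨h.1.2.2, h.2⟩
  have hdisj : ∀ z, Relation.ReflTransGen r₁ y z → ¬ Relation.ReflTransGen r₂ u' z := by
    intro z hz1 hz2
    rcases (hp1 z hz1).1 with h1 | h1 <;> rcases (hp2 z hz2).1 with h2 | h2
    exacts [c1 (h2.symm.trans h1), c3 (h2.symm.trans h1), c4 (h2.symm.trans h1),
      c6 (h1.symm.trans h2)]
  have hQ := h.flat.quot_collapse (r₁ := r₁) (r₂ := r₂) (fun p q h => hGP _ _ h.1.1.1)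
    (fun p q h => hGP _ _ h.1.1) hdisj
  have fy : collapse r₁ r₂ y u' y = y := collapse_left Relation.ReflTransGen.refl
  have ft : collapse r₁ r₂ y u' t = y := collapse_left ht
  have fu : collapse r₁ r₂ y u' u' = u' :=
    collapse_right (fun h1 => hdisj _ h1 Relation.ReflTransGen.refl) Relation.ReflTransGen.refl
  have ft' : collapse r₁ r₂ y u' t' = u' := collapse_right (fun h1 => hdisj _ h1 ht') ht'
  have fx : collapse r₁ r₂ y u' x = x := collapse_of_not (fun h1 => (hp1 _ h1).2.1 rfl)
    fun h1 => (hp2 _ h1).1.elim c1.symm c3.symm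
  have fr : collapse r₁ r₂ y u' r' = r' := collapse_of_not (fun h1 => (hp1 _ h1).2.2 rfl)
    fun h1 => (hp2 _ h1).1.elim c4.symm c6
  have fv : collapse r₁ r₂ y u' v' = v' := collapse_of_not
    (fun h1 => (hp1 _ h1).1.elim c3 c6.symm) fun h1 => (hp2 _ h1).2 rfl
  exact hQ.no_K5 (quot_adj_of_adj h.adj fx fy) (quot_adj_of_adj hxu' fx fu)
    (quot_adj_of_adj hxr' fx fr) (quot_adj_of_adj hxv' fx fv) (quot_adj_of_adj a1 fy fu)
    ⟨hyr, t, r', htr, ft, fr⟩ (quot_adj_of_adj a4.symm fy fv) (quot_adj_of_adj a2 fu fr)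
    ⟨huv', t', v', htv, ft', fv⟩ (quot_adj_of_adj a3 fr fv)

end Critical

end EndDegrees

end AGraph
namespace AGraph

/-! ### The degrees in a critical graph -/

section CriticalCount

open scoped Classical

variable {V : Type*}

/-- Removing a vertex whose neighbours are pairwise adjacent does not disconnect anything. -/
theorem ReachOff.insert_of_clique {P : SimpleGraph V} {K : Finset V} {w a b : V}
    (h : ReachOff P K a b) (ha : a ∉ K) (haw : a ≠ w) (hbw : b ≠ w)
    (hw : ∀ p q, P.Adj w p → P.Adj w q → p ∉ K → q ∉ K → p ≠ q → P.Adj p q) :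
    ReachOff P (insert w K) a b := by
  have key : ∀ z, ReachOff P K a z → (z ≠ w ∧ ReachOff P (insert w K) a z) ∨
      (z = w ∧ ∃ t, ReachOff P (insert w K) a t ∧ P.Adj w t) := by
    intro z hz
    induction hz with
    | refl => exact Or.inl ⟨haw, Relation.ReflTransGen.refl⟩
    | @tail p q _ hs ih =>
      by_cases hq : q = w
      · rcases ih with ⟨_, h1⟩ | ⟨rfl, -⟩
        · exact Or.inr ⟨hq, p, h1, hq ▸ hs.1.symm⟩
        · exact absurd hs.1 (hq ▸ P.loopless.irrefl _)
      · refine Or.inl ⟨hq, ?_⟩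
        have hqK : q ∉ insert w K := by simp [hq, hs.2]
        rcases ih with ⟨_, h1⟩ | ⟨rfl, t, h1, h2⟩
        · exact h1.tail ⟨hs.1, hqK⟩
        · by_cases htq : t = q
          · exact htq ▸ h1
          · have htK : t ∉ K := fun htK =>
              h1.notMem (by simp [haw, ha]) (Finset.mem_insert_of_mem htK)
            exact h1.tail ⟨hw t q h2 hs.1 htK hs.2 htq, hqK⟩
  exact (key b h).elim (fun h1 => h1.2) fun h1 => absurd h1.1 hbw

variable [Fintype V]

/-- A connected set `C` of seven vertices that spans at least 13 edges leaves no room for vertices of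
degree 5 outside: each of these at most five vertices has a neighbour in `C`, so after contracting
`C` the edge bound limits the number of edges among them, while their degrees and the edge bound for
the whole graph require more. -/
theorem IsFlat.false_of_core {P : SimpleGraph V} {T C : Finset V} {x : V} (hP : IsFlat P)
    (hT : SupportedOn P T) (hCT : C ⊆ T) (hx : x ∈ C)
    (hconn : ∀ z ∈ C, Relation.ReflTransGen (fun p q => P.Adj p q ∧ p ∈ C ∧ q ∈ C) x z)
    (hC : C.card = 7) (hT12 : T.card ≤ 12) (hT9 : 9 ≤ T.card)
    (hsum : 26 ≤ ∑ a ∈ C, (C.filter (P.Adj a)).card)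
    (hdeg : ∀ w ∈ T \ C, 5 ≤ (nbhd P w).card) : False := by
  set I := T \ C with hI
  have hIcard : I.card + 7 = T.card := by
    rw [hI, Finset.card_sdiff_of_subset hCT, hC]
    omega
  have hTCI : T = C ∪ I := by rw [hI, Finset.union_sdiff_of_subset hCT]
  have hdisj : Disjoint C I := Finset.disjoint_sdiff
  have hsplit : ∀ a, (nbhd P a).card = (C.filter (P.Adj a)).card + (I.filter (P.Adj a)).card := by
    intro a
    rw [← hT.filter_adj a]
    nth_rw 1 [hTCI]
    rw [Finset.filter_union, Finset.card_union_of_disjoint (Finset.disjoint_filter_filter hdisj)]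
  have hswap : ∑ a ∈ C, (I.filter (P.Adj a)).card = ∑ a ∈ I, (C.filter (P.Adj a)).card := by
    simp only [Finset.card_filter]
    rw [Finset.sum_comm]
    simp only [P.adj_comm]
  have htot := hP.sum_card_nbhd_le hT (by omega)
  rw [Finset.sum_congr rfl fun a _ => hsplit a] at htot
  nth_rw 1 [hTCI] at htot
  rw [Finset.sum_union hdisj, Finset.sum_add_distrib, Finset.sum_add_distrib, hswap] at htot
  have hlow : 5 * I.card ≤ ∑ a ∈ I, ((C.filter (P.Adj a)).card + (I.filter (P.Adj a)).card) := by
    have := Finset.card_nsmul_le_sum I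
      (fun a => (C.filter (P.Adj a)).card + (I.filter (P.Adj a)).card) 5
      (fun a ha => by rw [← hsplit]; exact hdeg a ha)
    rw [smul_eq_mul] at this
    omega
  rw [Finset.sum_add_distrib] at hlow
  -- contract `C` to `x`
  set f : V → V := fun z => if z ∈ C then x else z with hf
  have hfC : ∀ z ∈ C, f z = x := fun z hz => by simp [hf, hz]
  have hfI : ∀ z ∈ I, f z = z := fun z hz => by simp [hf, (Finset.mem_sdiff.1 hz).2]
  have hQ : IsFlat (AGraph.quot f P) := by
    refine hP.quot f fun z => ?_
    by_cases hz : z ∈ C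
    · rw [hfC z hz]
      exact reflTransGen_mono (fun p q h => ⟨h.1, by rw [hfC p h.2.1, hfC q h.2.2]⟩) (hconn z hz)
    · simp only [hf, hz, if_false]
      exact Relation.ReflTransGen.refl
  have hxI : x ∉ I := fun h => (Finset.mem_sdiff.1 h).2 hx
  have hadj : ∀ a ∈ I, (AGraph.quot f P).Adj a x := by
    intro a ha
    have h1 : (I.filter (P.Adj a)).card ≤ (I.erase a).card := by
      refine Finset.card_le_card fun z hz => ?_
      rw [Finset.mem_filter] at hz
      exact Finset.mem_erase.2 ⟨hz.2.ne', hz.1⟩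
    rw [Finset.card_erase_of_mem ha] at h1
    have h2 := hdeg a ha
    rw [hsplit a] at h2
    obtain ⟨z, hz⟩ := Finset.card_pos.1 (by omega : 0 < (C.filter (P.Adj a)).card)
    rw [Finset.mem_filter] at hz
    exact ⟨by rintro rfl; exact hxI ha, a, z, hz.2, hfI a ha, hfC z hz.1⟩
  have hq := hQ.sum_card_filter_le (S := insert x I) (by rw [Finset.card_insert_of_notMem hxI]; omega)
  rw [Finset.sum_insert hxI, Finset.card_insert_of_notMem hxI] at hq
  have h1 : I.card ≤ ((insert x I).filter ((AGraph.quot f P).Adj x)).card :=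
    Finset.card_le_card fun a ha =>
      Finset.mem_filter.2 ⟨Finset.mem_insert_of_mem ha, (hadj a ha).symm⟩
  have h2 : ∑ a ∈ I, ((I.filter (P.Adj a)).card + 1) ≤
      ∑ a ∈ I, ((insert x I).filter ((AGraph.quot f P).Adj a)).card := by
    refine Finset.sum_le_sum fun a ha => ?_
    have hx' : x ∉ I.filter (P.Adj a) := fun h => hxI (Finset.mem_filter.1 h).1
    rw [← Finset.card_insert_of_notMem hx']
    refine Finset.card_le_card fun z hz => ?_
    rcases Finset.mem_insert.1 hz with rfl | hz
    · exact Finset.mem_filter.2 ⟨Finset.mem_insert_self _ _, hadj a ha⟩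
    · rw [Finset.mem_filter] at hz
      exact Finset.mem_filter.2 ⟨Finset.mem_insert_of_mem hz.1,
        quot_adj_of_adj hz.2 (hfI a ha) (hfI z hz.1)⟩
  rw [Finset.sum_add_distrib, Finset.sum_const, smul_eq_mul] at h2
  omega

namespace Critical

variable {P : SimpleGraph V} {T : Finset V} {x y : V}

theorem five_le_card_nbhd_right (h : Critical P T x y) : 5 ≤ (nbhd P y).card :=
  h.symm.five_le_card_nbhd_left

theorem five_le_of_not_isBad (h : Critical P T x y) {w : V} (hw : w ∈ T) (hb : ¬ IsBad P x y w) :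
    5 ≤ (nbhd P w).card := by
  by_cases hx : w = x
  · exact hx ▸ h.five_le_card_nbhd_left
  by_cases hy : w = y
  · exact hy ▸ h.five_le_card_nbhd_right
  have h4 := h.four_le_card_nbhd hw hx hy
  by_contra! hlt
  exact hb (h.isBad hx hy (by omega))

/-- There are at most two bad vertices: three of them would give a `K₃₃` with `x`, `y` and the rest
of the graph on the other side. -/
theorem false_of_three_isBad (h : Critical P T x y) {w₁ w₂ w₃ : V} (h₁ : IsBad P x y w₁)
    (h₂ : IsBad P x y w₂) (h₃ : IsBad P x y w₃) (h12 : w₁ ≠ w₂) (h13 : w₁ ≠ w₃) (h23 : w₂ ≠ w₃) :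
    False := by
  set W : Finset V := {w₁, w₂, w₃} with hW
  have hWb : ∀ w ∈ W, IsBad P x y w := by
    intro w hw
    simp only [hW, Finset.mem_insert, Finset.mem_singleton] at hw
    rcases hw with rfl | rfl | rfl <;> assumption
  have hWc : W.card = 3 := by simp [hW, h12, h13, h23]
  have hWx : ∀ w ∈ W, w ≠ x := fun w hw => (hWb w hw).adj.1.ne
  have hWy : ∀ w ∈ W, w ≠ y := fun w hw => (hWb w hw).adj.2.ne
  -- every bad vertex has a neighbour besides `x`, `y` and the bad vertices
  have hq : ∀ w ∈ W, ∃ q, P.Adj w q ∧ q ≠ x ∧ q ≠ y ∧ q ∉ W := by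
    intro w hw
    obtain ⟨p, s, hN, hnd, hxp, hps, hsy⟩ := hWb w hw
    have hw' : ∀ z ∈ ({x, p, s, y} : Finset V), P.Adj w z := fun z hz => mem_nbhd.1 (hN ▸ hz)
    have hpw := hw' p (by simp)
    have hsw := hw' s (by simp)
    have hpy : p ≠ y := by rintro rfl; simp at hnd
    have hxs : s ≠ x := by rintro rfl; simp at hnd
    by_contra! hcon
    have hpW := hcon p hpw hxp.ne' hpy
    have hsW := hcon s hsw hxs hsy.ne
    exact h.flat.no_K5 h.adj (hWb w hw).adj.1.symm hxp (hWb s hsW).adj.1.symm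
      (hWb w hw).adj.2.symm (hWb p hpW).adj.2.symm hsy.symm hpw hsw hps
  -- the neighbours of a bad vertex besides `x` and `y` form a clique
  have hcl : ∀ w ∈ W, ∀ p q, P.Adj w p → P.Adj w q → p ∉ ({x, y} : Finset V) →
      q ∉ ({x, y} : Finset V) → p ≠ q → P.Adj p q := by
    intro w hw p q hp hq hpK hqK hpq
    obtain ⟨p', s', hN, -, -, hps, -⟩ := hWb w hw
    rw [← mem_nbhd, hN] at hp hq
    simp only [Finset.mem_insert, Finset.mem_singleton, not_or] at hp hq hpK hqK
    have hp' : p = p' ∨ p = s' := by tauto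
    have hq' : q = p' ∨ q = s' := by tauto
    rcases hp' with rfl | rfl <;> rcases hq' with rfl | rfl
    exacts [absurd rfl hpq, hps, hps.symm, absurd rfl hpq]
  set K : Finset V := {w₁, w₂, w₃, x, y} with hK
  have hreach : ∀ a b, a ∈ T → b ∈ T → a ∉ K → b ∉ K → ReachOff P K a b := by
    intro a b ha hb haK hbK
    simp only [hK, Finset.mem_insert, Finset.mem_singleton, not_or] at haK hbK
    have h0 : ReachOff P {x, y} a b := h.reachOff (by
      intro p hp q hq hpq
      simp only [Finset.mem_insert, Finset.mem_singleton] at hp hq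
      rcases hp with rfl | rfl <;> rcases hq with rfl | rfl
      exacts [absurd rfl hpq, h.adj, h.adj.symm, absurd rfl hpq]) ha hb
      (by simp [haK]) (by simp [hbK])
    have h1 := h0.insert_of_clique (w := w₃) (by simp [haK]) haK.2.2.1 hbK.2.2.1
      fun p q hp hq hpK hqK => hcl w₃ (by simp [hW]) p q hp hq hpK hqK
    have h2 := h1.insert_of_clique (w := w₂) (by simp [haK]) haK.2.1 hbK.2.1
      fun p q hp hq hpK hqK => hcl w₂ (by simp [hW]) p q hp hq
        (fun h => hpK (Finset.mem_insert_of_mem h)) (fun h => hqK (Finset.mem_insert_of_mem h))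
    exact h2.insert_of_clique (w := w₁) (by simp [haK]) haK.1 hbK.1
      fun p q hp hq hpK hqK => hcl w₁ (by simp [hW]) p q hp hq
        (fun h => hpK (Finset.mem_insert_of_mem (Finset.mem_insert_of_mem h)))
        (fun h => hqK (Finset.mem_insert_of_mem (Finset.mem_insert_of_mem h)))
  have hKW : ∀ z, z ∉ K ↔ z ≠ x ∧ z ≠ y ∧ z ∉ W := by
    intro z
    simp only [hK, hW, Finset.mem_insert, Finset.mem_singleton]
    tauto
  obtain ⟨q₁, hq₁⟩ := hq w₁ (by simp [hW])
  have hq₁K := (hKW q₁).2 hq₁.2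
  set r : V → V → Prop := fun p q => P.Adj p q ∧ q ∉ K with hr
  have hnot : ∀ z ∈ K, ¬ Relation.ReflTransGen r q₁ z := fun z hz h1 => ReachOff.notMem h1 hq₁K hz
  have hxx : ∀ z, Relation.ReflTransGen (fun _ _ : V => False) x z → z = x := by
    intro z hz
    cases hz with
    | refl => rfl
    | tail _ h => exact h.elim
  have hQ := h.flat.quot_collapse (r₁ := r) (r₂ := fun _ _ => False) (a := q₁) (b := x)
    (fun p q h => h.1) (fun p q h => h.elim) (fun z h1 h2 => by
      rw [hxx z h2] at h1
      exact hnot x (by simp [hK]) h1)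
  have hfix : ∀ z ∈ K, collapse r (fun _ _ => False) q₁ x z = z := by
    intro z hz
    by_cases h1 : z = x
    · rw [h1, collapse_right (hnot x (by simp [hK])) Relation.ReflTransGen.refl]
    · exact collapse_of_not (hnot z hz) fun h2 => h1 (hxx z h2)
  have hWK : ∀ w ∈ W, w ∈ K := by
    intro w hw
    by_contra hcon
    exact ((hKW w).1 hcon).2.2 hw
  refine hQ.no_K33 (A := {x, y, q₁}) (B := W) ?_ hWc ?_
  · rw [Finset.card_eq_three]
    exact ⟨x, y, q₁, h.adj.ne, hq₁.2.1.symm, hq₁.2.2.1.symm, rfl⟩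
  · intro a ha w hw
    simp only [Finset.mem_insert, Finset.mem_singleton] at ha
    rcases ha with rfl | rfl | rfl
    · exact quot_adj_of_adj (hWb w hw).adj.1.symm (hfix _ (by simp [hK])) (hfix w (hWK w hw))
    · exact quot_adj_of_adj (hWb w hw).adj.2.symm (hfix _ (by simp [hK])) (hfix w (hWK w hw))
    · obtain ⟨q, hq⟩ := hq w hw
      refine ⟨by rintro rfl; exact hq₁.2.2.2 hw, q, w, hq.1.symm, ?_, hfix w (hWK w hw)⟩
      exact collapse_left (hreach _ _ (h.supp _ _ hq₁.1.symm) (h.supp _ _ hq.1.symm) hq₁K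
        ((hKW q).2 hq.2))

theorem card_filter_isBad_le (h : Critical P T x y) : (T.filter (IsBad P x y)).card ≤ 2 := by
  by_contra! hlt
  obtain ⟨w₁, h1, w₂, h2, w₃, h3, h12, h13, h23⟩ := Finset.two_lt_card.1 hlt
  exact h.false_of_three_isBad (Finset.mem_filter.1 h1).2 (Finset.mem_filter.1 h2).2
    (Finset.mem_filter.1 h3).2 h12 h13 h23

theorem five_le_card (h : Critical P T x y) : 5 ≤ T.card := by
  have h1 := h.five_le_card_nbhd_left
  have h2 : nbhd P x ⊆ T := fun z hz => h.supp z x (mem_nbhd.1 hz).symm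
  exact h1.trans (Finset.card_le_card h2)

/-- The degree sum is at least `5 n - 2` and at most `6 n - 12`. -/
theorem ten_le_card (h : Critical P T x y) : 10 ≤ T.card := by
  have h0 := h.five_le_card
  have h1 := h.flat.sum_card_nbhd_le h.supp (by omega)
  have h2 : ∑ w ∈ T, 5 ≤ ∑ w ∈ T, ((nbhd P w).card + if IsBad P x y w then 1 else 0) := by
    refine Finset.sum_le_sum fun w hw => ?_
    split_ifs with hb
    · rw [hb.card]
    · exact h.five_le_of_not_isBad hw hb
  have h4 : ∑ w ∈ T, ((nbhd P w).card + if IsBad P x y w then 1 else 0) =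
      ∑ w ∈ T, (nbhd P w).card + (T.filter (IsBad P x y)).card := by
    rw [Finset.sum_add_distrib, ← Finset.card_filter]
  rw [h4, Finset.sum_const, smul_eq_mul] at h2
  have h3 := h.card_filter_isBad_le
  omega

/-- If `x` has degree 5 and a bad neighbour `u`, then `x`, its neighbours and `s` are a dense set as
in `IsFlat.false_of_core`. -/
theorem false_of_core (h : Critical P T x y) {u p q v s : V} (hN : nbhd P u = {x, p, s, y})
    (hnd : [x, p, s, y].Nodup) (hps : P.Adj p s) (hsy : P.Adj s y)
    (hxs : ¬ P.Adj x s) (hNx : nbhd P x = {u, p, q, v, y}) (hnd' : [u, p, q, v, y].Nodup)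
    (hpq : P.Adj p q) (hqv : P.Adj q v) (hvy : P.Adj v y) : False := by
  have hu : ∀ z ∈ ({x, p, s, y} : Finset V), P.Adj u z := fun z hz => mem_nbhd.1 (hN ▸ hz)
  have hx : ∀ z ∈ ({u, p, q, v, y} : Finset V), P.Adj x z := fun z hz => mem_nbhd.1 (hNx ▸ hz)
  have hux := hu x (by simp)
  have hup := hu p (by simp)
  have hus := hu s (by simp)
  have huy := hu y (by simp)
  have hxp := hx p (by simp)
  have hxq := hx q (by simp)
  have hxv := hx v (by simp)
  have hxy := h.adj
  have hsne : ∀ z, P.Adj x z → s ≠ z := by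
    rintro z hz rfl
    exact hxs hz
  have hL : [x, u, y, s, p, q, v].Nodup := by
    simp only [List.nodup_cons, List.mem_cons, List.not_mem_nil, or_false, not_or] at hnd hnd' ⊢
    have := hsne q hxq
    have := hsne v hxv
    have := hux.ne
    have := hxq.ne
    have := hxv.ne
    have := hus.ne
    grind
  set C : Finset V := [x, u, y, s, p, q, v].toFinset with hC
  have hmem : ∀ z, z ∈ C ↔ z = x ∨ z = u ∨ z = y ∨ z = s ∨ z = p ∨ z = q ∨ z = v := by
    intro z
    simp [hC]
  have hcard : ∀ (L : List V) (a : V), L.Nodup → (∀ z ∈ L, P.Adj a z ∧ z ∈ C) →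
      L.length ≤ (C.filter (P.Adj a)).card := by
    intro L a hL hz
    rw [← List.toFinset_card_of_nodup hL]
    refine Finset.card_le_card fun z hz' => ?_
    rw [Finset.mem_filter]
    exact (hz z (List.mem_toFinset.1 hz')).symm
  refine h.flat.false_of_core h.supp (C := C) (x := x) ?_ ((hmem x).2 (by simp)) ?_
    (List.toFinset_card_of_nodup hL) h.card_le (by have := h.ten_le_card; omega) ?_ ?_
  · intro z hz
    rcases (hmem z).1 hz with rfl | rfl | rfl | rfl | rfl | rfl | rfl
    exacts [h.mem_left, h.supp _ _ hux, h.symm.mem_left, h.supp _ _ hsy, h.supp _ _ hps,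
      h.supp _ _ hqv, h.supp _ _ hvy]
  · have hxC : x ∈ C := (hmem x).2 (by simp)
    have huC : u ∈ C := (hmem u).2 (by simp)
    have hone : ∀ z ∈ C, P.Adj x z →
        Relation.ReflTransGen (fun p q => P.Adj p q ∧ p ∈ C ∧ q ∈ C) x z :=
      fun z hz hxz => Relation.ReflTransGen.single ⟨hxz, hxC, hz⟩
    intro z hz
    rcases (hmem z).1 hz with rfl | rfl | rfl | rfl | rfl | rfl | rfl
    exacts [Relation.ReflTransGen.refl, hone _ hz hux.symm, hone _ hz hxy,
      (hone _ huC hux.symm).tail ⟨hus, huC, hz⟩, hone _ hz hxp, hone _ hz hxq, hone _ hz hxv]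
  · rw [hC, List.sum_toFinset _ hL, ← hC]
    have e1 := hcard [u, p, q, v, y] x hnd' (by simp [hmem, hux.symm, hxp, hxq, hxv, hxy])
    have e2 := hcard [x, p, s, y] u hnd (by simp [hmem, hux, hup, hus, huy])
    have hL' := hL
    simp only [List.nodup_cons, List.mem_cons, List.not_mem_nil, or_false, not_or] at hL'
    have e3 := hcard [x, u, s, v] y (by simp; grind)
      (by simp [hmem, hxy.symm, huy.symm, hsy.symm, hvy.symm])
    have e4 := hcard [u, p, y] s (by simp; grind) (by simp [hmem, hus.symm, hps.symm, hsy])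
    have e5 := hcard [x, u, s, q] p (by simp; grind) (by simp [hmem, hxp.symm, hup.symm, hps, hpq])
    have e6 := hcard [x, p, v] q (by simp; grind) (by simp [hmem, hxq.symm, hpq.symm, hqv])
    have e7 := hcard [x, q, y] v (by simp; grind) (by simp [hmem, hxv.symm, hqv.symm, hvy])
    simp only [List.length_cons, List.length_nil, List.map_cons, List.map_nil, List.sum_cons,
      List.sum_nil] at *
    omega
  · intro w hw
    rw [Finset.mem_sdiff] at hw
    refine h.five_le_of_not_isBad hw.1 fun hb => hw.2 ((hmem w).2 ?_)
    have := mem_nbhd.2 hb.adj.1.symm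
    rw [hNx] at this
    simp only [Finset.mem_insert, Finset.mem_singleton] at this
    tauto

/-- If there is a bad vertex, then the ends of the locked edge have degree at least 6. -/
theorem six_le_card_nbhd_left (h : Critical P T x y) {u : V} (hu : IsBad P x y u) :
    6 ≤ (nbhd P x).card := by
  have h5 := h.five_le_card_nbhd_left
  by_contra! hlt
  obtain ⟨b, c, d, e, hNx, hnd', h1, h2, h3, h4, h6⟩ :=
    h.flat.exists_link_five h.maximal (by omega) hu.adj.1.symm (h.reachOff_singleton x)
  obtain ⟨p, s, hN, hnd, hxp, hps, hsy⟩ := hu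
  have hxs := IsBad.not_adj h hN hnd hxp hps hsy
  have hx : ∀ z ∈ ({u, b, c, d, e} : Finset V), P.Adj x z := fun z hz => mem_nbhd.1 (hNx ▸ hz)
  have hsel : ∀ z, P.Adj u z → P.Adj x z → z = p ∨ z = y := by
    intro z huz hxz
    rw [← mem_nbhd, hN] at huz
    simp only [Finset.mem_insert, Finset.mem_singleton] at huz
    rcases huz with rfl | rfl | rfl | rfl
    exacts [absurd hxz (P.loopless.irrefl _), Or.inl rfl, absurd hxz hxs, Or.inr rfl]
  have hb := hsel b h1 (hx b (by simp))
  have he := hsel e h6.symm (hx e (by simp))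
  have hbe : b ≠ e := by
    rintro rfl
    simp at hnd'
  rcases hb with rfl | rfl <;> rcases he with rfl | rfl
  · exact hbe rfl
  · exact h.false_of_core hN hnd hps hsy hxs hNx hnd' h2 h3 h4
  · refine h.false_of_core hN hnd hps hsy hxs (q := d) (v := c) ?_ ?_ h4.symm h3.symm h2.symm
    · rw [hNx]
      ext z
      simp only [Finset.mem_insert, Finset.mem_singleton]
      tauto
    · simp only [List.nodup_cons, List.mem_cons, List.not_mem_nil, or_false, not_or] at hnd' ⊢
      grind
  · exact hbe rfl

/-- A critical graph has order 12, and its degrees are known. -/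
theorem card_and_degrees (h : Critical P T x y) : T.card = 12 ∧
    ((∀ w ∈ T, (nbhd P w).card = 5) ∨ ∃ w₁ w₂, w₁ ≠ w₂ ∧ IsBad P x y w₁ ∧ IsBad P x y w₂ ∧
      (nbhd P x).card = 6 ∧ (nbhd P y).card = 6 ∧
      ∀ w ∈ T, w ≠ x → w ≠ y → w ≠ w₁ → w ≠ w₂ → (nbhd P w).card = 5) := by
  have h12 := h.card_le
  have h10 := h.ten_le_card
  have htot := h.flat.sum_card_nbhd_le h.supp (by omega)
  by_cases hB : ∃ w, IsBad P x y w
  · obtain ⟨w₀, hw₀⟩ := hB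
    have hbx : ¬ IsBad P x y x := fun h1 => h1.adj.1.ne rfl
    have hby : ¬ IsBad P x y y := fun h1 => h1.adj.2.ne rfl
    have hB2 := h.card_filter_isBad_le
    have hle : ∀ w ∈ T, (5 + (if w = x then 1 else 0) + (if w = y then 1 else 0)) ≤
        (nbhd P w).card + if IsBad P x y w then 1 else 0 := by
      intro w hw
      by_cases hx : w = x
      · subst hx
        have := h.six_le_card_nbhd_left hw₀
        simp [h.adj.ne, this, hbx]
      · by_cases hy : w = y
        · subst hy
          have := h.symm.six_le_card_nbhd_left hw₀.symm
          simp [hx, this, hby]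
        · simp only [hx, hy, if_false, add_zero]
          split_ifs with hb
          · rw [hb.card]
          · exact h.five_le_of_not_isBad hw hb
    have hsum1 : ∑ w ∈ T, (5 + (if w = x then 1 else 0) + (if w = y then 1 else 0)) =
        5 * T.card + 2 := by
      simp only [Finset.sum_add_distrib, Finset.sum_ite_eq', h.mem_left, h.symm.mem_left, if_true,
        Finset.sum_const, smul_eq_mul]
      ring
    have hsum2 : ∑ w ∈ T, ((nbhd P w).card + if IsBad P x y w then 1 else 0) =
        ∑ w ∈ T, (nbhd P w).card + (T.filter (IsBad P x y)).card := by
      rw [Finset.sum_add_distrib, ← Finset.card_filter]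
    have hlow := Finset.sum_le_sum hle
    rw [hsum1, hsum2] at hlow
    refine ⟨by omega, Or.inr ?_⟩
    have hBc : (T.filter (IsBad P x y)).card = 2 := by omega
    obtain ⟨w₁, w₂, hne, hBe⟩ := Finset.card_eq_two.1 hBc
    have hbad : ∀ w ∈ T, IsBad P x y w ↔ w = w₁ ∨ w = w₂ := by
      intro w hw
      have : w ∈ T.filter (IsBad P x y) ↔ w ∈ ({w₁, w₂} : Finset V) := by rw [hBe]
      simpa [hw] using this
    have hw₁ : IsBad P x y w₁ := (Finset.mem_filter.1 (hBe ▸ Finset.mem_insert_self w₁ {w₂} :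
      w₁ ∈ T.filter (IsBad P x y))).2
    have hw₂ : IsBad P x y w₂ := (Finset.mem_filter.1 (hBe ▸ (by simp) :
      w₂ ∈ T.filter (IsBad P x y))).2
    have heq := (Finset.sum_eq_sum_iff_of_le hle).1 (by rw [hsum1, hsum2]; omega)
    refine ⟨w₁, w₂, hne, hw₁, hw₂, ?_, ?_, ?_⟩
    · have := heq x h.mem_left
      simpa [h.adj.ne, hbx, eq_comm] using this
    · have := heq y h.symm.mem_left
      simpa [h.adj.ne', hby, eq_comm] using this
    · intro w hw hx hy h1 h2
      have := heq w hw
      have hb : ¬ IsBad P x y w := by rw [hbad w hw]; tauto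
      simpa [hx, hy, hb, eq_comm] using this
  · push Not at hB
    have hle : ∀ w ∈ T, 5 ≤ (nbhd P w).card := fun w hw => h.five_le_of_not_isBad hw (hB w)
    have hlow := Finset.sum_le_sum hle
    rw [Finset.sum_const, smul_eq_mul] at hlow
    refine ⟨by omega, Or.inl fun w hw => ?_⟩
    have heq := (Finset.sum_eq_sum_iff_of_le hle).1 (by
      rw [Finset.sum_const, smul_eq_mul]; omega)
    exact (heq w hw).symm

end Critical

/-- A flat graph on `T` is contained in a maximal one. -/
theorem IsFlat.exists_isCornerClosed {P : SimpleGraph V} (hP : IsFlat P) {T : Finset V}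
    (hT : SupportedOn P T) : ∃ P', P ≤ P' ∧ IsFlat P' ∧ SupportedOn P' T ∧ IsCornerClosed P' := by
  have hfin : {P' : SimpleGraph V | IsFlat P' ∧ SupportedOn P' T}.Finite := Set.toFinite _
  obtain ⟨P', hle, hmax⟩ := hfin.exists_le_maximal (a := P) ⟨hP, hT⟩
  refine ⟨P', hle, hmax.prop.1, hmax.prop.2, fun w a b ha hb hab hnab hflat => hnab ?_⟩
  have h1 : P' ⊔ SimpleGraph.edge a b ≤ P' := hmax.le_of_ge ⟨hflat, fun p q hpq => by
    rcases hpq with h1 | h1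
    · exact hmax.prop.2 p q h1
    · rw [SimpleGraph.edge_adj] at h1
      rcases h1.1 with ⟨rfl, -⟩ | ⟨rfl, -⟩
      exacts [hmax.prop.2 _ _ ha.symm, hmax.prop.2 _ _ hb.symm]⟩ le_sup_left
  exact h1 (Or.inr ((SimpleGraph.edge_adj _ _ _ _).2 ⟨Or.inl ⟨rfl, rfl⟩, hab⟩))

/-- Flat graphs of order at most 11 have no locked edges. -/
theorem IsFlat.unlocked {P : SimpleGraph V} (hP : IsFlat P) {T : Finset V} (hT : SupportedOn P T)
    (h11 : T.card ≤ 11) {x y : V} (hxy : P.Adj x y) : Unlocked (del P x y) x y := by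
  induction hn : T.card using Nat.strong_induction_on generalizing P T x y with
  | _ n ih =>
  subst hn
  by_contra hlock
  obtain ⟨P', hle, hflat, hsupp, hmax⟩ := hP.exists_isCornerClosed hT
  have hc : Critical P' T x y := {
    flat := hflat
    supp := hsupp
    maximal := hmax
    adj := hle hxy
    locked := fun h => hlock (h.mono fun a b hab =>
      del_adj.2 ⟨hle (del_adj.1 hab).1, (del_adj.1 hab).2⟩)
    unlocked := fun P'' T'' x' y' h1 h2 h3 h4 => ih _ h3 h1 h2 (by omega) h4 rfl
    card_le := by omega }
  have := hc.card_and_degrees.1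
  omega

end CriticalCount

end AGraph
namespace AGraph

/-! ### Planar rotation systems are flat -/

section Rotation

open scoped Classical

variable {V : Type*}

theorem exists_pow_lt_of_sameCycle {α : Type*} {f : Equiv.Perm α} {a b : α} {m : ℕ} (hm : 0 < m)
    (h : (f ^ m) a = a) (hab : f.SameCycle a b) : ∃ i < m, (f ^ i) a = b := by
  obtain ⟨i, rfl⟩ := hab
  have hm' : (0 : ℤ) < m := by exact_mod_cast hm
  have hr0 := Int.emod_nonneg i hm'.ne'
  have hr1 := Int.emod_lt_of_pos i hm'
  refine ⟨(i % m).toNat, by omega, ?_⟩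
  have h1 : ∀ q : ℤ, ((f ^ m) ^ q) a = a := fun q => Function.IsFixedPt.perm_zpow h q
  have h2 : f ^ i = f ^ (i % m) * (f ^ m) ^ (i / m) := by
    rw [← zpow_natCast f m, ← zpow_mul, ← zpow_add, Int.emod_add_mul_ediv]
  rw [h2, Equiv.Perm.mul_apply, h1, ← zpow_natCast f, Int.toNat_of_nonneg hr0]

/-- A sum over the neighbours of a vertex as a sum over darts. -/
theorem sum_adj_eq_sum_dart [Fintype V] {G : SimpleGraph V} {M : Type*} [AddCommMonoid M] (a : V)
    (f : V → V → M) : ∑ b, (if G.Adj a b then f a b else 0) =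
      ∑ d : G.Dart, if d.fst = a then f d.fst d.snd else 0 := by
  rw [← Finset.sum_filter, ← Finset.sum_filter]
  refine Finset.sum_bij' (fun b hb => (⟨(a, b), (Finset.mem_filter.1 hb).2⟩ : G.Dart))
    (fun d _ => d.snd) ?_ ?_ ?_ ?_ ?_
  · intro b hb
    simp
  · intro d hd
    obtain rfl := (Finset.mem_filter.1 hd).2
    simp [d.adj]
  · intro b hb
    rfl
  · intro d hd
    obtain rfl := (Finset.mem_filter.1 hd).2
    rfl
  · intro b hb
    rfl

namespace RotationSystem

variable {G : SimpleGraph V} (R : RotationSystem G)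

theorem face_fst (d : G.Dart) : (R.face d).fst = d.snd := R.next_fst d.symm

theorem face_symm (d : G.Dart) : R.face d.symm = R.next d := by
  change R.next d.symm.symm = R.next d
  rw [SimpleGraph.Dart.symm_symm]

/-- The face of a dart. -/
def faceOf (d : G.Dart) : Quotient (Equiv.Perm.SameCycle.setoid R.face) := Quotient.mk _ d

theorem faceOf_eq {d e : G.Dart} : R.faceOf d = R.faceOf e ↔ R.face.SameCycle d e := Quotient.eq

theorem faceOf_face (d : G.Dart) : R.faceOf (R.face d) = R.faceOf d :=
  R.faceOf_eq.2 (Equiv.Perm.sameCycle_apply_left.2 (Equiv.Perm.SameCycle.refl _ _))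

theorem faceOf_symm (d : G.Dart) : R.faceOf d.symm = R.faceOf (R.next d) := by
  rw [← R.face_symm, faceOf_face]

/-- The face of the dart `a → b`; the value is `none` if there is no such dart. -/
noncomputable def side (a b : V) : Option (Quotient (Equiv.Perm.SameCycle.setoid R.face)) :=
  if h : G.Adj a b then some (R.faceOf ⟨(a, b), h⟩) else none

theorem side_dart (d : G.Dart) : R.side d.fst d.snd = some (R.faceOf d) := by
  simp only [side, d.adj, dif_pos]

theorem side_dart' (d : G.Dart) : R.side d.snd d.fst = some (R.faceOf d.symm) := R.side_dart d.symm

/-- A function on faces that agrees on the two sides of each edge is constant. -/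
theorem eq_of_faceOf_symm {R : RotationSystem G} (hG : G.Connected) {K : Type*}
    (h : Quotient (Equiv.Perm.SameCycle.setoid R.face) → K)
    (hh : ∀ d, h (R.faceOf d) = h (R.faceOf d.symm)) (d e : G.Dart) :
    h (R.faceOf d) = h (R.faceOf e) := by
  have hnext : ∀ d, h (R.faceOf (R.next d)) = h (R.faceOf d) := by
    intro d
    rw [hh d, R.faceOf_symm]
  have hvert : ∀ d e : G.Dart, d.fst = e.fst → h (R.faceOf d) = h (R.faceOf e) := by
    intro d e hde
    obtain ⟨i, rfl⟩ := R.cyclic d e hde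
    have hcl : ∀ i : ℤ, h (R.faceOf ((R.next ^ i) d)) = h (R.faceOf d) := by
      intro i
      induction i using Int.induction_on with
      | zero => rfl
      | succ i ih => rw [← ih, add_comm, zpow_one_add, Equiv.Perm.mul_apply, hnext]
      | pred i ih =>
        rw [← ih, ← hnext, ← Equiv.Perm.mul_apply, ← zpow_one_add]
        congr 4
        ring
    exact (hcl i).symm
  have hwalk : ∀ a b : V, G.Reachable a b → ∀ d e : G.Dart, d.fst = a → e.fst = b →
      h (R.faceOf d) = h (R.faceOf e) := by
    rintro a b ⟨p⟩
    induction p with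
    | nil => exact fun d e hd he => hvert d e (hd.trans he.symm)
    | cons hab p ih =>
      intro d e hd he
      rw [hvert d ⟨(_, _), hab⟩ hd, hh]
      exact ih _ e rfl he
  exact hwalk _ _ (hG.preconnected d.fst e.fst) d e rfl rfl

end RotationSystem

variable [Fintype V] {G : SimpleGraph V} {R : RotationSystem G}

/-- The incidence matrix of faces and edges over the field of two elements. -/
noncomputable def faceMatrix (R : RotationSystem G) :
    Matrix (Quotient (Equiv.Perm.SameCycle.setoid R.face)) G.edgeSet (ZMod 2) :=
  fun f e => ∑ d : G.Dart, if R.faceOf d = f ∧ d.edge = e then 1 else 0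

theorem faceMatrix_mulVec (R : RotationSystem G) (g : G.edgeSet → ZMod 2)
    (f : Quotient (Equiv.Perm.SameCycle.setoid R.face)) :
    (faceMatrix R).mulVec g f =
      ∑ d : G.Dart, if R.faceOf d = f then g ⟨d.edge, d.edge_mem⟩ else 0 := by
  simp only [Matrix.mulVec, dotProduct, faceMatrix, Finset.sum_mul]
  rw [Finset.sum_comm]
  refine Finset.sum_congr rfl fun d _ => ?_
  rw [Finset.sum_eq_single (⟨d.edge, d.edge_mem⟩ : G.edgeSet)]
  · by_cases h : R.faceOf d = f <;> simp [h]
  · intro e _ he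
    have : d.edge ≠ e := fun h => he (Subtype.ext h.symm)
    simp [this]
  · simp

theorem faceMatrix_transpose_mulVec (R : RotationSystem G)
    (h : Quotient (Equiv.Perm.SameCycle.setoid R.face) → ZMod 2) (d : G.Dart) :
    (faceMatrix R).transpose.mulVec h ⟨d.edge, d.edge_mem⟩ =
      h (R.faceOf d) + h (R.faceOf d.symm) := by
  simp only [Matrix.mulVec, dotProduct, faceMatrix, Matrix.transpose_apply, Finset.sum_mul]
  rw [Finset.sum_comm]
  have h1 : ∀ e : G.Dart, ∑ f, (if R.faceOf e = f ∧ e.edge = d.edge then (1 : ZMod 2) else 0) * h f =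
      if e = d ∨ e = d.symm then h (R.faceOf e) else 0 := by
    intro e
    rw [Finset.sum_eq_single (R.faceOf e)]
    · by_cases hed : e = d ∨ e = d.symm
      · simp [hed, SimpleGraph.dart_edge_eq_iff]
      · simp [hed, SimpleGraph.dart_edge_eq_iff]
    · intro f _ hf
      simp [Ne.symm hf]
    · simp
  rw [Finset.sum_congr rfl fun e _ => h1 e, ← Finset.sum_filter]
  have h2 : (Finset.univ.filter fun e : G.Dart => e = d ∨ e = d.symm) = {d, d.symm} := by
    ext e
    simp
  rw [h2, Finset.sum_pair d.symm_ne.symm]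

/-- The coboundary map from vertex labellings to edge labellings. -/
noncomputable def coboundary (G : SimpleGraph V) : (V → ZMod 2) →ₗ[ZMod 2] (G.edgeSet → ZMod 2) where
  toFun φ e := Sym2.lift ⟨fun a b => φ a + φ b, fun a b => add_comm _ _⟩ e.1
  map_add' φ ψ := by
    ext ⟨e, he⟩
    induction e with
    | _ a b =>
      simp only [Sym2.lift_mk, Pi.add_apply]
      ring
  map_smul' k φ := by
    ext ⟨e, he⟩
    induction e with
    | _ a b =>
      simp only [Sym2.lift_mk, Pi.smul_apply, smul_eq_mul, RingHom.id_apply]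
      ring

theorem eq_of_add_eq_zero_zmod_two {a b : ZMod 2} (h : a + b = 0) : a = b := by
  revert a b
  decide

theorem finrank_le_one_of_const {ι : Type*} [Finite ι] (W : Submodule (ZMod 2) (ι → ZMod 2))
    (h : ∀ w ∈ W, ∀ i j, w i = w j) : Module.finrank (ZMod 2) W ≤ 1 := by
  have hle : W ≤ Submodule.span (ZMod 2) {fun _ => (1 : ZMod 2)} := by
    intro w hw
    rw [Submodule.mem_span_singleton]
    by_cases hι : Nonempty ι
    · obtain ⟨i⟩ := hι
      exact ⟨w i, funext fun j => by simp [h w hw i j]⟩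
    · exact ⟨0, funext fun j => (hι ⟨j⟩).elim⟩
  refine (Submodule.finrank_mono hle).trans ?_
  exact (finrank_span_le_card _).trans (by simp)

/-- The Euler relation makes the cycle space of the dual as large as possible. -/
theorem RotationSystem.IsPlanar.ker_le (hR : R.IsPlanar) :
    LinearMap.ker (faceMatrix R).mulVecLin ≤ LinearMap.range (coboundary G) := by
  obtain ⟨hconn, heuler⟩ := hR
  have hle : LinearMap.range (coboundary G) ≤ LinearMap.ker (faceMatrix R).mulVecLin := by
    rintro _ ⟨φ, rfl⟩
    rw [LinearMap.mem_ker, Matrix.mulVecLin_apply]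
    funext f
    rw [faceMatrix_mulVec, Pi.zero_apply]
    have h1 : ∀ d : G.Dart, (if R.faceOf d = f then coboundary G φ ⟨d.edge, d.edge_mem⟩ else 0) =
        (if R.faceOf d = f then φ d.fst else 0) +
          (if R.faceOf (R.face d) = f then φ (R.face d).fst else 0) := by
      intro d
      rw [R.faceOf_face, R.face_fst, ← ite_add_zero]
      rfl
    rw [Finset.sum_congr rfl fun d _ => h1 d, Finset.sum_add_distrib,
      Equiv.sum_comp R.face (fun d => if R.faceOf d = f then φ d.fst else 0)]
    exact zmod_two_add_self _
  -- The matrix has rank at least `|F| - 1`, as functions on faces in the kernel of its transpose are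
  -- constant. So its kernel has dimension at most `|E| - |F| + 1 = |V| - 1`, which is at most the
  -- rank of the coboundary map, as potentials with zero coboundary are constant.
  refine (Submodule.eq_of_le_of_finrank_le hle ?_).ge
  have h1 := LinearMap.finrank_range_add_finrank_ker (coboundary G)
  have h2 := LinearMap.finrank_range_add_finrank_ker (faceMatrix R).mulVecLin
  have h3 := LinearMap.finrank_range_add_finrank_ker (faceMatrix R).transpose.mulVecLin
  have h4 : Module.finrank (ZMod 2) (LinearMap.range (faceMatrix R).transpose.mulVecLin) =
      Module.finrank (ZMod 2) (LinearMap.range (faceMatrix R).mulVecLin) :=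
    Matrix.rank_transpose (faceMatrix R)
  have h5 : Module.finrank (ZMod 2) (LinearMap.ker (coboundary G)) ≤ 1 := by
    refine finrank_le_one_of_const _ fun φ hφ a b => ?_
    obtain ⟨p⟩ := hconn.preconnected a b
    induction p with
    | nil => rfl
    | @cons a b c hab p ih =>
      rw [← ih]
      have := congrFun (LinearMap.mem_ker.1 hφ) ⟨s(a, b), hab⟩
      exact eq_of_add_eq_zero_zmod_two this
  have h6 : Module.finrank (ZMod 2) (LinearMap.ker (faceMatrix R).transpose.mulVecLin) ≤ 1 := by
    refine finrank_le_one_of_const _ fun h hh f f' => ?_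
    induction f using Quotient.inductionOn
    induction f' using Quotient.inductionOn
    refine RotationSystem.eq_of_faceOf_symm hconn h (fun d => ?_) _ _
    have := congrFun (LinearMap.mem_ker.1 hh) ⟨d.edge, d.edge_mem⟩
    rw [Matrix.mulVecLin_apply, faceMatrix_transpose_mulVec] at this
    exact eq_of_add_eq_zero_zmod_two this
  rw [Module.finrank_fintype_fun_eq_card] at h1 h2 h3
  rw [RotationSystem.numFaces, Nat.card_eq_fintype_card, Nat.card_eq_fintype_card,
    Nat.card_eq_fintype_card] at heuler
  omega

/-- The faces of a planar rotation system form a face system. -/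
theorem RotationSystem.IsPlanar.isFaceSystem (hR : R.IsPlanar) : IsFaceSystem G R.side where
  closed h a := by
    have h1 : ∀ b, (if G.Adj a b then h (R.side a b) + h (R.side b a) else 0) =
        (if G.Adj a b then (fun a b => h (R.side a b)) a b else 0) +
          (if G.Adj a b then (fun a b => h (R.side b a)) a b else 0) := fun b => ite_add_zero
    rw [Finset.sum_congr rfl fun b _ => h1 b, Finset.sum_add_distrib,
      sum_adj_eq_sum_dart a fun a b => h (R.side a b),
      sum_adj_eq_sum_dart a fun a b => h (R.side b a)]
    have h2 : ∀ d : G.Dart, (if d.fst = a then h (R.side d.snd d.fst) else 0) =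
        if (R.next d).fst = a then h (R.side (R.next d).fst (R.next d).snd) else 0 := by
      intro d
      rw [R.side_dart', R.side_dart, R.faceOf_symm, R.next_fst]
    simp only [h2]
    rw [Equiv.sum_comp R.next (fun d => if d.fst = a then h (R.side d.fst d.snd) else 0)]
    exact zmod_two_add_self _
  exact g hg := by
    have hmem : (fun e : G.edgeSet => g e) ∈ LinearMap.ker (faceMatrix R).mulVecLin := by
      rw [LinearMap.mem_ker, Matrix.mulVecLin_apply]
      funext f
      have h1 := hg fun f' => if f' = some f then 1 else 0
      rw [Finset.sum_congr rfl fun a _ => sum_adj_eq_sum_dart a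
        fun a b => g s(a, b) * if R.side a b = some f then 1 else 0, Finset.sum_comm] at h1
      rw [faceMatrix_mulVec, Pi.zero_apply]
      refine (Finset.sum_congr rfl fun d _ => ?_).trans h1
      rw [Finset.sum_ite_eq, if_pos (Finset.mem_univ _), R.side_dart]
      by_cases h : R.faceOf d = f
      · simp only [h, if_true, mul_one]
        rfl
      · simp [h]
    obtain ⟨φ, hφ⟩ := hR.ker_le hmem
    exact ⟨φ, fun a b hab => (congrFun hφ ⟨s(a, b), hab⟩).symm⟩

end Rotation

end AGraph
namespace AGraph

/-! ### Triangulations and near-triangulations -/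

section NearTriangulation

open scoped Classical

variable {V : Type*} {G : SimpleGraph V}

theorem RotationSystem.adj_of_face (R : RotationSystem G) {e : G.Dart}
    (he : R.face (R.face (R.face e)) = e) : G.Adj e.fst (R.face e).snd := by
  have h1 := (R.face (R.face e)).adj
  have h2 := R.face_fst (R.face (R.face e))
  rw [he] at h2
  rw [← h2, R.face_fst] at h1
  exact h1.symm

/-- The successor of a dart at its initial vertex completes a triangle, if the face between the two
darts is a triangle. -/
theorem RotationSystem.adj_next (R : RotationSystem G) {d : G.Dart}
    (he : R.face (R.face (R.face d.symm)) = d.symm) : G.Adj d.snd (R.next d).snd := by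
  have := R.adj_of_face he
  rwa [R.face_symm] at this

theorem IsAGraph.adj {u x v y : V} (h : IsAGraph G u x v y) : G.Adj u x ∧ G.Adj x v ∧ G.Adj v y ∧ G.Adj y u := by
  obtain ⟨-, -, R, -, d, h1, h2, h3, h4, -⟩ := h
  refine ⟨?_, ?_, ?_, ?_⟩
  · simpa [h1] using d.adj
  · simpa [h2] using (R.face d).adj
  · simpa [h3] using (R.face (R.face d)).adj
  · simpa [h4] using (R.face (R.face (R.face d))).adj

variable [Fintype V]

theorem sum_card_nbhd_eq (G : SimpleGraph V) : ∑ a, (nbhd G a).card = 2 * Nat.card G.edgeSet := by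
  rw [Nat.card_eq_fintype_card, ← SimpleGraph.edgeFinset_card, ← G.sum_degrees_eq_twice_card_edges]
  refine Finset.sum_congr rfl fun a _ => ?_
  rw [← SimpleGraph.card_neighborFinset_eq_degree]
  congr 1
  ext b
  simp

theorem card_nbhd_sup_edge {a b : V} (hab : a ≠ b) (hnab : ¬ G.Adj a b) (w : V) :
    (nbhd (G ⊔ SimpleGraph.edge a b) w).card =
      (nbhd G w).card + (if w = a then 1 else 0) + (if w = b then 1 else 0) := by
  by_cases ha : w = a
  · subst ha
    have : nbhd (G ⊔ SimpleGraph.edge w b) w = insert b (nbhd G w) := by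
      ext z
      simp only [mem_nbhd, SimpleGraph.sup_adj, SimpleGraph.edge_adj, Finset.mem_insert]
      grind
    rw [this, Finset.card_insert_of_notMem (by simpa using hnab)]
    simp [hab]
  · by_cases hb : w = b
    · subst hb
      have : nbhd (G ⊔ SimpleGraph.edge a w) w = insert a (nbhd G w) := by
        ext z
        simp only [mem_nbhd, SimpleGraph.sup_adj, SimpleGraph.edge_adj, Finset.mem_insert]
        grind
      rw [this, Finset.card_insert_of_notMem (by simpa using fun h => hnab h.symm)]
      simp [ha]
    · have : nbhd (G ⊔ SimpleGraph.edge a b) w = nbhd G w := by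
        ext z
        simp only [mem_nbhd, SimpleGraph.sup_adj, SimpleGraph.edge_adj]
        grind
      simp [this, ha, hb]

theorem sum_card_nbhd_sup_edge {a b : V} (hab : a ≠ b) (hnab : ¬ G.Adj a b) :
    ∑ w, (nbhd (G ⊔ SimpleGraph.edge a b) w).card = ∑ w, (nbhd G w).card + 2 := by
  simp only [card_nbhd_sup_edge hab hnab, Finset.sum_add_distrib, Finset.sum_ite_eq',
    Finset.mem_univ, if_true]

theorem SupportedOn.univ (G : SimpleGraph V) : SupportedOn G Finset.univ :=
  fun _ _ _ => Finset.mem_univ _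

/-- A flat graph with `3 n - 6` edges is edge-maximal. -/
theorem isCornerClosed_of_card (h3 : 3 ≤ Fintype.card V)
    (h : 6 * Fintype.card V ≤ ∑ a, (nbhd G a).card + 12) : IsCornerClosed G := by
  intro w a b _ _ hab hnab hflat
  have h1 := hflat.sum_card_nbhd_le (SupportedOn.univ _) h3
  rw [sum_card_nbhd_sup_edge hab hnab, Finset.card_univ] at h1
  omega

namespace IsAGraph

variable {u x v y : V}

theorem isFlat_sup_edge_left (h : IsAGraph G u x v y) (hxy : ¬ G.Adj x y) :
    IsFlat (G ⊔ SimpleGraph.edge x y) := by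
  have hadj := h.adj
  obtain ⟨-, hne, R, hR, d, h1, h2, h3, h4, -⟩ := h
  have e2 := R.side_dart (R.face d)
  have e3 := R.side_dart (R.face (R.face d))
  rw [R.faceOf_face] at e2
  rw [R.faceOf_face, R.faceOf_face] at e3
  rw [h2] at e2
  rw [h3] at e3
  exact hR.isFaceSystem.isFlat_sup_edge hadj.2.1.symm hadj.2.2.1 hne hxy (Or.inr e2) (Or.inl e3)

theorem isFlat_sup_edge_right (h : IsAGraph G u x v y) (huv : ¬ G.Adj u v) :
    IsFlat (G ⊔ SimpleGraph.edge u v) := by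
  have hadj := h.adj
  obtain ⟨hne, -, R, hR, d, h1, h2, h3, h4, -⟩ := h
  have e1 := R.side_dart d
  have e2 := R.side_dart (R.face d)
  rw [R.faceOf_face] at e2
  rw [h1] at e1
  rw [h2] at e2
  exact hR.isFaceSystem.isFlat_sup_edge hadj.1.symm hadj.2.1 hne huv (Or.inr e1) (Or.inl e2)

/-- A near-triangulation with one face of size 4 has at least `3 n - 7` edges. -/
theorem le_sum_card_nbhd (h : IsAGraph G u x v y) :
    6 * Fintype.card V ≤ ∑ a, (nbhd G a).card + 14 := by
  obtain ⟨-, -, R, hR, d, -, -, -, -, h5, h6⟩ := h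
  have hcard : ∀ f, (Finset.univ.filter fun e => R.faceOf e = f).card ≤
      3 + if f = R.faceOf d then 1 else 0 := by
    intro f
    induction f using Quotient.inductionOn with
    | _ e =>
    have key : ∀ (m : ℕ), 0 < m → (R.face ^ m) e = e →
        (Finset.univ.filter fun e' => R.faceOf e' = R.faceOf e).card ≤ m := by
      intro m hm he
      have : (Finset.univ.filter fun e' => R.faceOf e' = R.faceOf e) ⊆
          (Finset.range m).image fun i => (R.face ^ i) e := by
        intro e' he'
        obtain ⟨i, hi, rfl⟩ := exists_pow_lt_of_sameCycle hm he
          (R.faceOf_eq.1 (Finset.mem_filter.1 he').2.symm)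
        exact Finset.mem_image_of_mem _ (Finset.mem_range.2 hi)
      exact (Finset.card_le_card this).trans (Finset.card_image_le.trans (by simp))
    change (Finset.univ.filter fun e' => R.faceOf e' = R.faceOf e).card ≤
      3 + if R.faceOf e = R.faceOf d then 1 else 0
    split_ifs with hd
    · rw [hd]
      have h7 := key
      obtain ⟨i, rfl⟩ := R.faceOf_eq.1 hd.symm
      have h8 : (R.face ^ 4) ((R.face ^ i) d) = (R.face ^ i) d := by
        rw [← Equiv.Perm.mul_apply, ← zpow_natCast, ← zpow_add, add_comm, zpow_add,
          Equiv.Perm.mul_apply, zpow_natCast]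
        exact congrArg _ h5
      have := h7 4 (by norm_num) h8
      rwa [hd] at this
    · exact key 3 (by norm_num) (h6 e fun h => hd (R.faceOf_eq.2 h.symm))
  have h7 : Fintype.card G.Dart ≤ 3 * R.numFaces + 1 := by
    rw [← Finset.card_univ, Finset.card_eq_sum_card_fiberwise (f := R.faceOf) (t := Finset.univ)
      (fun _ _ => Finset.mem_coe.2 (Finset.mem_univ _))]
    refine (Finset.sum_le_sum fun f _ => hcard f).trans ?_
    rw [Finset.sum_add_distrib, Finset.sum_const, Finset.sum_ite_eq', if_pos (Finset.mem_univ _),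
      RotationSystem.numFaces, Nat.card_eq_fintype_card, Finset.card_univ, smul_eq_mul, mul_comm]
  rw [SimpleGraph.dart_card_eq_twice_card_edges, SimpleGraph.edgeFinset_card,
    ← Nat.card_eq_fintype_card] at h7
  have h8 := hR.2
  rw [sum_card_nbhd_eq]
  rw [Nat.card_eq_fintype_card] at h8
  omega

/-- All faces at a vertex `w` off the boundary are triangles, so the predecessor and the successor of a
neighbour `a` in the rotation at `w` are common neighbours of `a` and `w`. If there is only one common
neighbour, these agree and the rotation is a 2-cycle. -/
theorem card_nbhd_le_two (h : IsAGraph G u x v y) {w a p : V} (hwu : w ≠ u) (hwx : w ≠ x)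
    (hwv : w ≠ v) (hwy : w ≠ y) (ha : G.Adj w a) (hp : ∀ b, G.Adj w b → G.Adj a b → b = p) :
    (nbhd G w).card ≤ 2 := by
  obtain ⟨-, -, R, -, d, h1, h2, h3, h4, h5, h6⟩ := h
  -- the faces at `w` are triangles
  have htri : ∀ e : G.Dart, e.fst = w → R.face (R.face (R.face e.symm)) = e.symm := by
    rintro e rfl
    refine h6 _ fun hs => ?_
    obtain ⟨i, hi, he⟩ := exists_pow_lt_of_sameCycle (m := 4) (by norm_num) h5 hs
    have he' : ((R.face ^ i) d).snd = e.fst := by rw [he]; rfl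
    interval_cases i
    · exact hwx (by rw [← he']; exact (congrArg Prod.snd h1))
    · exact hwv (by rw [← he']; exact (congrArg Prod.snd h2))
    · exact hwy (by rw [← he']; exact (congrArg Prod.snd h3))
    · exact hwu (by rw [← he']; exact (congrArg Prod.snd h4))
  set e : G.Dart := ⟨(w, a), ha⟩ with he
  have hnext : (R.next e).snd = p := hp _ (by
    have := (R.next e).adj
    rwa [R.next_fst] at this) (R.adj_next (htri e rfl))
  set e' : G.Dart := R.next.symm e with he'
  have hen : R.next e' = e := Equiv.apply_symm_apply _ _
  have hfst : e'.fst = w := by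
    have := R.next_fst e'
    rw [hen] at this
    exact this.symm
  have hprev : e'.snd = p := by
    have h7 := R.adj_next (htri e' hfst)
    rw [hen] at h7
    have h8 := e'.adj
    rw [hfst] at h8
    exact hp _ h8 h7.symm
  have hee : R.next e = e' := by
    apply SimpleGraph.Dart.ext
    exact Prod.ext ((R.next_fst e).trans hfst.symm) (hnext.trans hprev.symm)
  have hsub : nbhd G w ⊆ {a, p} := by
    intro b hb
    rw [mem_nbhd] at hb
    obtain ⟨i, hi, hb'⟩ := exists_pow_lt_of_sameCycle (m := 2) (a := e) (by norm_num)
      (show R.next (R.next e) = e by rw [hee, hen]) (R.cyclic e ⟨(w, b), hb⟩ rfl)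
    have hb2 : ((R.next ^ i) e).snd = b := by rw [hb']
    rw [Finset.mem_insert, Finset.mem_singleton]
    interval_cases i
    · exact Or.inl hb2.symm
    · exact Or.inr (hb2.symm.trans hnext)
  exact (Finset.card_le_card hsub).trans Finset.card_le_two

end IsAGraph

end NearTriangulation

end AGraph
namespace AGraph

/-! ### Neighbourhoods in 5-regular flat graphs of order 12 -/

section IcosahedronLinks

open scoped Classical

variable {V : Type*} [Fintype V] {P : SimpleGraph V}

/-- In a 5-regular flat graph let `S` be a set of vertices with all its neighbours in `S ∪ K`, and let
`K` have at least `i / 2` inner edges. The edge bound for `S ∪ K` then bounds the number `k` of edges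
between `S` and `K` by `5 |S| + k + i ≤ 6 (|S| + |K|) - 12`, while `5 |S| ≤ |S| (|S| - 1) + k`. -/
theorem IsFlat.le_card_of_closed (hP : IsFlat P) (h5 : ∀ w, (nbhd P w).card = 5) {S K : Finset V}
    (hS : S.Nonempty) (hKS : Disjoint S K) (hcl : ∀ s ∈ S, ∀ t, P.Adj s t → t ∈ S ∨ t ∈ K)
    {i : ℕ} (hi : i ≤ ∑ a ∈ K, (K.filter (P.Adj a)).card) :
    12 + i + 5 * S.card ≤ 6 * K.card + S.card * S.card := by
  have hnb : ∀ s ∈ S, (S ∪ K).filter (P.Adj s) = nbhd P s := by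
    intro s hs
    ext t
    rw [Finset.mem_filter, mem_nbhd, Finset.mem_union, and_iff_right_iff_imp]
    exact hcl s hs t
  have hcard : (S ∪ K).card = S.card + K.card := Finset.card_union_of_disjoint hKS
  have hsplit : ∀ a, ((S ∪ K).filter (P.Adj a)).card =
      (S.filter (P.Adj a)).card + (K.filter (P.Adj a)).card := by
    intro a
    rw [Finset.filter_union, Finset.card_union_of_disjoint (Finset.disjoint_filter_filter hKS)]
  obtain ⟨s, hs⟩ := hS
  have h3 : 3 ≤ (S ∪ K).card := by
    have h1 := Finset.card_le_card (Finset.filter_subset (P.Adj s) (S ∪ K))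
    rw [hnb s hs, h5] at h1
    omega
  have htot := hP.sum_card_filter_le h3
  rw [hcard, Finset.sum_union hKS, Finset.sum_congr rfl fun s hs => by rw [hnb s hs, h5 s],
    Finset.sum_const, smul_eq_mul, Finset.sum_congr rfl fun a _ => hsplit a,
    Finset.sum_add_distrib] at htot
  have hswap : ∑ a ∈ K, (S.filter (P.Adj a)).card = ∑ a ∈ S, (K.filter (P.Adj a)).card := by
    simp only [Finset.card_filter]
    rw [Finset.sum_comm]
    simp only [P.adj_comm]
  have hlow : ∑ a ∈ S, 5 ≤ ∑ a ∈ S, ((S.card - 1) + (K.filter (P.Adj a)).card) := by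
    refine Finset.sum_le_sum fun a ha => ?_
    rw [← h5 a, ← hnb a ha, hsplit]
    refine Nat.add_le_add_right ?_ _
    rw [← Finset.card_erase_of_mem ha]
    refine Finset.card_le_card fun z hz => ?_
    rw [Finset.mem_filter] at hz
    exact Finset.mem_erase.2 ⟨hz.2.ne', hz.1⟩
  rw [Finset.sum_add_distrib, Finset.sum_const, Finset.sum_const, smul_eq_mul, smul_eq_mul] at hlow
  obtain ⟨m, hm⟩ : ∃ m, S.card = m + 1 := Nat.exists_eq_succ_of_ne_zero (Finset.card_pos.2 ⟨s, hs⟩).ne'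
  rw [hm] at htot hlow ⊢
  rw [Nat.add_sub_cancel] at hlow
  nlinarith

/-- The preceding bound for the part of `P - K` that contains `a`. -/
theorem IsFlat.le_card_reachOff (hP : IsFlat P) (h5 : ∀ w, (nbhd P w).card = 5) {K : Finset V}
    {a : V} (ha : a ∉ K) {i : ℕ} (hi : i ≤ ∑ a ∈ K, (K.filter (P.Adj a)).card) :
    12 + i + 5 * (Finset.univ.filter (ReachOff P K a)).card ≤
      6 * K.card + (Finset.univ.filter (ReachOff P K a)).card * (Finset.univ.filter (ReachOff P K a)).card := by
  refine hP.le_card_of_closed h5 ⟨a, ?_⟩ ?_ ?_ hi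
  · rw [Finset.mem_filter]
    exact ⟨Finset.mem_univ _, Relation.ReflTransGen.refl⟩
  · rw [Finset.disjoint_left]
    intro z hz
    exact ReachOff.notMem (Finset.mem_filter.1 hz).2 ha
  · intro s hs t hst
    by_cases ht : t ∈ K
    · exact Or.inr ht
    · refine Or.inl (Finset.mem_filter.2 ⟨Finset.mem_univ _, ?_⟩)
      exact (Finset.mem_filter.1 hs).2.tail ⟨hst, ht⟩

theorem disjoint_reachOff {K : Finset V} {a b : V} (hb : b ∉ K) (h : ¬ ReachOff P K a b) :
    Disjoint (Finset.univ.filter (ReachOff P K a)) (Finset.univ.filter (ReachOff P K b)) := by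
  rw [Finset.disjoint_left]
  intro z hza hzb
  have h1 : ReachOff P K b z := (Finset.mem_filter.1 hzb).2
  refine h ((Finset.mem_filter.1 hza).2.trans ?_)
  clear hza hzb
  induction h1 with
  | refl => exact Relation.ReflTransGen.refl
  | @tail p q hp hs ih =>
    refine Relation.ReflTransGen.head ⟨hs.1.symm, ?_⟩ ih
    exact ReachOff.notMem hp hb

theorem card_reachOff_add_le {K : Finset V} {a b : V} (ha : a ∉ K) (hb : b ∉ K)
    (h : ¬ ReachOff P K a b) : (Finset.univ.filter (ReachOff P K a)).card +
      (Finset.univ.filter (ReachOff P K b)).card + K.card ≤ Fintype.card V := by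
  rw [← Finset.card_union_of_disjoint (disjoint_reachOff hb h), ← Finset.card_union_of_disjoint]
  · exact Finset.card_le_univ _
  · rw [Finset.disjoint_left]
    intro z hz
    rcases Finset.mem_union.1 hz with hz | hz
    exacts [ReachOff.notMem (Finset.mem_filter.1 hz).2 ha,
      ReachOff.notMem (Finset.mem_filter.1 hz).2 hb]

/-- A 5-regular flat graph of order 12 has no cut vertex. -/
theorem IsFlat.reachOff_singleton (hP : IsFlat P) (h5 : ∀ w, (nbhd P w).card = 5)
    (h12 : Fintype.card V = 12) (w a b : V) (ha : P.Adj w a) (hb : P.Adj w b) :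
    ReachOff P {w} a b := by
  by_contra h
  have ha' : a ∉ ({w} : Finset V) := by simpa using ha.ne'
  have hb' : b ∉ ({w} : Finset V) := by simpa using hb.ne'
  have h1 := hP.le_card_reachOff h5 ha' (Nat.zero_le _)
  have h2 := hP.le_card_reachOff h5 hb' (Nat.zero_le _)
  have h3 := card_reachOff_add_le ha' hb' h
  rw [h12] at h3
  rw [Finset.card_singleton] at h1 h2 h3
  have h4 : ∀ n : ℕ, 12 + 0 + 5 * n ≤ 6 * 1 + n * n → 6 ≤ n := by
    intro n hn
    by_contra! hlt
    interval_cases n <;> omega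
  have h6 := h4 _ h1
  have h7 := h4 _ h2
  omega

/-- In a 5-regular flat graph of order 12, the cycle around a vertex has no chords: a chord would
yield a separating triangle, with too few vertices for its two sides. -/
theorem IsFlat.not_adj_of_link (hP : IsFlat P) (h5 : ∀ w, (nbhd P w).card = 5)
    (h12 : Fintype.card V = 12) {w a b c d e : V} (hN : nbhd P w = {a, b, c, d, e})
    (hnd : [a, b, c, d, e].Nodup) (hab : P.Adj a b) (hbc : P.Adj b c) (hcd : P.Adj c d)
    (hde : P.Adj d e) (hea : P.Adj e a) : ¬ P.Adj a c := by
  intro hac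
  have hw : ∀ z ∈ ({a, b, c, d, e} : Finset V), P.Adj w z := fun z hz => mem_nbhd.1 (hN ▸ hz)
  have hwa := hw a (by simp)
  have hwb := hw b (by simp)
  have hwc := hw c (by simp)
  have hwd := hw d (by simp)
  have hwe := hw e (by simp)
  simp only [List.nodup_cons, List.mem_cons, List.not_mem_nil, or_false, not_or] at hnd
  obtain ⟨⟨-, -, had, -⟩, ⟨-, hbd, hbe⟩, ⟨-, hce⟩, -⟩ := hnd
  have hb' : b ∉ ({w, a, c} : Finset V) := by simp [hwb.ne', hab.ne', hbc.ne]
  have hd' : d ∉ ({w, a, c} : Finset V) := by simp [hwd.ne', Ne.symm had, hcd.ne']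
  have hsep : ¬ ReachOff P {w, a, c} b d := by
    intro hr
    -- contract the edge `d e`
    have hQ := hP.quot (merge d e d) (reflTransGen_merge hde hde.symm)
    have hfix : ∀ z, z ≠ e → merge d e d z = z := by
      intro z hz
      by_cases hzd : z = d
      · simp [merge, hzd]
      · exact merge_of_ne hz hzd
    have hfw := hfix w hwe.ne
    have hfa := hfix a hea.ne'
    have hfb := hfix b hbe
    have hfc := hfix c hce
    have hfd := hfix d hde.ne
    have hfe : merge d e d e = d := by simp [merge]
    refine hQ.no_K5_path (quot_adj_of_adj hwa hfw hfa) (quot_adj_of_adj hwc hfw hfc)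
      (quot_adj_of_adj hac hfa hfc) (quot_adj_of_adj hwb hfw hfb) (quot_adj_of_adj hab hfa hfb)
      (quot_adj_of_adj hbc.symm hfc hfb) (quot_adj_of_adj hwd hfw hfd)
      ⟨had, a, e, hea.symm, hfa, hfe⟩ (quot_adj_of_adj hcd hfc hfd) hbd ?_
    have hmap : ∀ z, ReachOff P {w, a, c} b z →
        ReachOff (AGraph.quot (merge d e d) P) {w, a, c} b (merge d e d z) := by
      intro z hz
      induction hz with
      | refl =>
        rw [hfb]
        exact Relation.ReflTransGen.refl
      | @tail p q _ hs ih =>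
        by_cases heq : merge d e d p = merge d e d q
        · rwa [← heq]
        · refine ih.tail ⟨⟨heq, p, q, hs.1, rfl, rfl⟩, ?_⟩
          by_cases hqe : q = e
          · rw [hqe, hfe]
            exact hd'
          · rw [hfix q hqe]
            exact hs.2
    have := hmap d hr
    rwa [hfd] at this
  have hwac : ({w, a, c} : Finset V) = [w, a, c].toFinset := by simp
  have hwacn : [w, a, c].Nodup := by simp [hwa.ne, hwc.ne, hac.ne]
  have hcard : ({w, a, c} : Finset V).card = 3 := by
    rw [hwac, List.toFinset_card_of_nodup hwacn]
    rfl
  have hi : 6 ≤ ∑ k ∈ ({w, a, c} : Finset V), (({w, a, c} : Finset V).filter (P.Adj k)).card := by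
    have h2 : ∀ k ∈ ({w, a, c} : Finset V), 2 ≤ (({w, a, c} : Finset V).filter (P.Adj k)).card := by
      intro k hk
      have : (({w, a, c} : Finset V).erase k) ⊆ ({w, a, c} : Finset V).filter (P.Adj k) := by
        intro z hz
        rw [Finset.mem_erase] at hz
        refine Finset.mem_filter.2 ⟨hz.2, ?_⟩
        have hzk := hz.1
        have hz2 := hz.2
        simp only [Finset.mem_insert, Finset.mem_singleton] at hk hz2
        rcases hk with rfl | rfl | rfl <;> rcases hz2 with rfl | rfl | rfl <;>
          first | exact absurd rfl hzk | assumption | (apply SimpleGraph.Adj.symm; assumption)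
      have h3 := Finset.card_le_card this
      rw [Finset.card_erase_of_mem hk, hcard] at h3
      exact h3
    have := Finset.card_nsmul_le_sum _ _ 2 h2
    rw [hcard] at this
    exact this
  have h1 := hP.le_card_reachOff h5 hb' hi
  have h2 := hP.le_card_reachOff h5 hd' hi
  have h3 := card_reachOff_add_le hb' hd' hsep
  rw [h12] at h3
  rw [hcard] at h1 h2 h3
  have hpos : ∀ z, 0 < (Finset.univ.filter (ReachOff P {w, a, c} z)).card := fun z =>
    Finset.card_pos.2 ⟨z, Finset.mem_filter.2 ⟨Finset.mem_univ _, Relation.ReflTransGen.refl⟩⟩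
  have h4 : ∀ n : ℕ, 0 < n → 12 + 6 + 5 * n ≤ 6 * 3 + n * n → 5 ≤ n := by
    intro n hn0 hn
    by_contra! hlt
    interval_cases n <;> omega
  have h6 := h4 _ (hpos b) h1
  have h7 := h4 _ (hpos d) h2
  omega

/-- In a 5-regular flat graph of order 12, the neighbours of a vertex span a cycle. -/
theorem IsFlat.exists_induced_link (hP : IsFlat P) (h5 : ∀ w, (nbhd P w).card = 5)
    (h12 : Fintype.card V = 12) {w : V} {a : V} (ha : P.Adj w a) :
    ∃ b c d e, nbhd P w = {a, b, c, d, e} ∧ [a, b, c, d, e].Nodup ∧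
      P.Adj a b ∧ P.Adj b c ∧ P.Adj c d ∧ P.Adj d e ∧ P.Adj e a ∧
      ¬ P.Adj a c ∧ ¬ P.Adj a d ∧ ¬ P.Adj b d ∧ ¬ P.Adj b e ∧ ¬ P.Adj c e := by
  have hmax : IsCornerClosed P := isCornerClosed_of_card (by omega) (by
    rw [Finset.sum_congr rfl fun a _ => h5 a, Finset.sum_const, Finset.card_univ, h12]
    norm_num)
  obtain ⟨b, c, d, e, hN, hnd, h1, h2, h3, h4, h6⟩ :=
    hP.exists_link_five hmax (h5 w) ha (hP.reachOff_singleton h5 h12 w)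
  have hrot : ∀ a b c d e : V, nbhd P w = {a, b, c, d, e} → [a, b, c, d, e].Nodup →
      nbhd P w = {b, c, d, e, a} ∧ [b, c, d, e, a].Nodup := by
    intro a b c d e hN hnd
    refine ⟨?_, ?_⟩
    · rw [hN]
      ext z
      simp only [Finset.mem_insert, Finset.mem_singleton]
      tauto
    · simp only [List.nodup_cons, List.mem_cons, List.not_mem_nil, or_false, not_or] at hnd ⊢
      grind
  obtain ⟨hN1, hnd1⟩ := hrot _ _ _ _ _ hN hnd
  obtain ⟨hN2, hnd2⟩ := hrot _ _ _ _ _ hN1 hnd1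
  obtain ⟨hN3, hnd3⟩ := hrot _ _ _ _ _ hN2 hnd2
  obtain ⟨hN4, hnd4⟩ := hrot _ _ _ _ _ hN3 hnd3
  exact ⟨b, c, d, e, hN, hnd, h1, h2, h3, h4, h6,
    hP.not_adj_of_link h5 h12 hN hnd h1 h2 h3 h4 h6,
    fun h => hP.not_adj_of_link h5 h12 hN3 hnd3 h4 h6 h1 h2 h3 h.symm,
    hP.not_adj_of_link h5 h12 hN1 hnd1 h2 h3 h4 h6 h1,
    fun h => hP.not_adj_of_link h5 h12 hN4 hnd4 h6 h1 h2 h3 h4 h.symm,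
    hP.not_adj_of_link h5 h12 hN2 hnd2 h3 h4 h6 h1 h2⟩

end IcosahedronLinks

end AGraph
namespace AGraph

/-! ### Uniqueness of the icosahedron -/

instance : DecidableRel gStar.Adj :=
  inferInstanceAs (DecidableRel (SimpleGraph.fromRel fun a b : Fin 12 => (a, b) ∈ _).Adj)

/-- Adjacency in the one-edge graph, decided in a way that the kernel can evaluate. -/
instance edgeAdjDecidable {V : Type*} [DecidableEq V] (a b : V) :
    DecidableRel (SimpleGraph.edge a b).Adj :=
  fun p q => decidable_of_iff ((a = p ∧ b = q ∨ a = q ∧ b = p) ∧ p ≠ q) (by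
    rw [SimpleGraph.edge_adj]
    tauto)

/-- The graph `G*` with the edge `u* v*`, an icosahedron. -/
abbrev gStarUV : SimpleGraph (Fin 12) := gStar ⊔ SimpleGraph.edge 10 11

theorem gStarUV_degree : ∀ i : Fin 12, (Finset.univ.filter fun j => gStarUV.Adj i j).card = 5 := by
  decide

theorem gStarUV_adj_iff : ∀ i j : Fin 12, gStarUV.Adj i j ↔
    (gStar.Adj i j ∨ (i = 10 ∧ j = 11) ∨ (i = 11 ∧ j = 10)) := by
  decide

theorem gStarUV_common_neighbor : ∀ i : Fin 12, gStarUV.Adj i 10 → gStarUV.Adj i 11 → i ≠ 0 →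
    i = 3 := by
  decide

section IcosahedronIso

open scoped Classical

variable {V : Type*} [Fintype V] {P : SimpleGraph V}

/-- An injective homomorphism from `G* + u* v*` into a 5-regular graph of the same order is an
isomorphism. -/
theorem exists_iso_gStarUV (h5 : ∀ w, (nbhd P w).card = 5) (h12 : Fintype.card V = 12)
    (f : Fin 12 → V) (hf : Function.Injective f) (hadj : ∀ i j, gStarUV.Adj i j → P.Adj (f i) (f j)) :
    ∃ φ : P ≃g gStarUV, ∀ i, φ (f i) = i := by
  have hbij : Function.Bijective f :=
    (Fintype.bijective_iff_injective_and_card f).2 ⟨hf, by simp [h12]⟩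
  have hiff : ∀ i j, P.Adj (f i) (f j) ↔ gStarUV.Adj i j := by
    intro i j
    refine ⟨fun h => ?_, hadj i j⟩
    have hsub : (Finset.univ.filter fun j => gStarUV.Adj i j).image f ⊆ nbhd P (f i) := by
      intro z hz
      obtain ⟨k, hk, rfl⟩ := Finset.mem_image.1 hz
      exact mem_nbhd.2 (hadj i k (Finset.mem_filter.1 hk).2)
    have hdeg := gStarUV_degree i
    have heq := Finset.eq_of_subset_of_card_le hsub (by
      rw [h5, Finset.card_image_of_injective _ hf]
      exact le_of_eq (by convert hdeg.symm))
    have hmem : f j ∈ nbhd P (f i) := mem_nbhd.2 h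
    rw [← heq] at hmem
    obtain ⟨k, hk, hkj⟩ := Finset.mem_image.1 hmem
    rw [← hf hkj]
    exact (Finset.mem_filter.1 hk).2
  let e := Equiv.ofBijective f hbij
  have hiso : gStarUV ≃g P := ⟨e, fun {i j} => hiff i j⟩
  refine ⟨(⟨e, fun {i j} => hiff i j⟩ : gStarUV ≃g P).symm, fun i => ?_⟩
  exact e.symm_apply_apply i

/-- The icosahedron is the only 5-regular flat graph of order 12, and any two of its edges with a
choice of a triangle at them correspond under an isomorphism. -/
theorem IsFlat.exists_iso_gStarUV (hP : IsFlat P) (h5 : ∀ w, (nbhd P w).card = 5)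
    (h12 : Fintype.card V = 12) {w a₀ a₁ : V} (h0 : P.Adj w a₀) (h1 : P.Adj w a₁)
    (h01 : P.Adj a₀ a₁) : ∃ φ : P ≃g gStarUV, φ w = 10 ∧ φ a₀ = 11 ∧ φ a₁ = 0 := by
  -- the first ring
  obtain ⟨a, hN, hainj, hacyc, hanadj, ha0, ha1⟩ : ∃ a : ZMod 5 → V, (∀ z, P.Adj w z ↔ ∃ i, z = a i) ∧
      Function.Injective a ∧ (∀ i, P.Adj (a i) (a (i + 1))) ∧ (∀ i, ¬ P.Adj (a i) (a (i + 2))) ∧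
      a 0 = a₀ ∧ a 1 = a₁ := by
    have key : ∀ b c d e : V, nbhd P w = {a₀, b, c, d, e} → [a₀, b, c, d, e].Nodup →
        P.Adj a₀ b → P.Adj b c → P.Adj c d → P.Adj d e → P.Adj e a₀ →
        ¬ P.Adj a₀ c → ¬ P.Adj a₀ d → ¬ P.Adj b d → ¬ P.Adj b e → ¬ P.Adj c e → b = a₁ →
        ∃ a : ZMod 5 → V, (∀ z, P.Adj w z ↔ ∃ i, z = a i) ∧
        Function.Injective a ∧ (∀ i, P.Adj (a i) (a (i + 1))) ∧ (∀ i, ¬ P.Adj (a i) (a (i + 2))) ∧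
        a 0 = a₀ ∧ a 1 = a₁ := by
      intro b c d e hN hnd e1 e2 e3 e4 e5 n1 n2 n3 n4 n5 hb
      refine ⟨(![a₀, b, c, d, e] : Fin 5 → V), ?_, ?_, ?_, ?_, rfl, hb⟩
      · intro z
        rw [← mem_nbhd, hN]
        change _ ↔ ∃ i : Fin 5, z = ![a₀, b, c, d, e] i
        simp [Fin.exists_fin_succ]
      · have := List.nodup_iff_injective_get.1 hnd
        have heq : (![a₀, b, c, d, e] : Fin 5 → V) = [a₀, b, c, d, e].get := by
          funext i
          fin_cases i <;> rfl
        rw [heq]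
        exact this
      · intro i
        fin_cases i
        exacts [e1, e2, e3, e4, e5]
      · intro i
        fin_cases i
        exacts [n1, n3, n5, fun h => n2 h.symm, fun h => n4 h.symm]
    obtain ⟨b, c, d, e, hN, hnd, e1, e2, e3, e4, e5, n1, n2, n3, n4, n5⟩ :=
      hP.exists_induced_link h5 h12 h0
    have hmem : a₁ ∈ ({a₀, b, c, d, e} : Finset V) := hN ▸ mem_nbhd.2 h1
    simp only [Finset.mem_insert, Finset.mem_singleton] at hmem
    rcases hmem with rfl | rfl | rfl | rfl | rfl
    · exact absurd h01 (P.loopless.irrefl _)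
    · exact key _ _ _ _ hN hnd e1 e2 e3 e4 e5 n1 n2 n3 n4 n5 rfl
    · exact absurd h01 n1
    · exact absurd h01 n2
    · refine key _ _ _ _ ?_ ?_ e5.symm e4.symm e3.symm e2.symm e1.symm n2 n1 (fun h => n5 h.symm)
        (fun h => n4 h.symm) (fun h => n3 h.symm) rfl
      · rw [hN]
        ext z
        simp only [Finset.mem_insert, Finset.mem_singleton]
        tauto
      · simp only [List.nodup_cons, List.mem_cons, List.not_mem_nil, or_false, not_or] at hnd ⊢
        grind
  have hwa : ∀ i, P.Adj w (a i) := fun i => (hN _).2 ⟨i, rfl⟩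
  have hi1 : ∀ i : ZMod 5, i + 1 ≠ i - 1 := by decide
  have hi0 : ∀ i : ZMod 5, i = i + 1 ∨ i = i - 1 → False := by decide
  -- the second ring, first from one side
  have hring : ∀ i, ∃ p q, nbhd P (a i) = {w, a (i + 1), p, q, a (i - 1)} ∧
      [w, a (i + 1), p, q, a (i - 1)].Nodup ∧ P.Adj (a (i + 1)) p ∧ P.Adj p q ∧
      P.Adj q (a (i - 1)) ∧ ¬ P.Adj w p ∧ ¬ P.Adj w q ∧ ¬ P.Adj (a (i + 1)) q ∧
      ¬ P.Adj p (a (i - 1)) := by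
    intro i
    obtain ⟨b, c, d, e, hN', hnd, e1, e2, e3, e4, e5, n1, n2, n3, n4, n5⟩ :=
      hP.exists_induced_link h5 h12 (hwa i).symm
    -- the neighbours of `w` in the link
    have hsel : ∀ z, P.Adj (a i) z → P.Adj w z → z = a (i + 1) ∨ z = a (i - 1) := by
      intro z hz hwz
      obtain ⟨j, rfl⟩ := (hN z).1 hwz
      have hji : j = i ∨ j = i + 1 ∨ j = i - 1 ∨ j = i + 2 ∨ i = j + 2 := by
        clear * -
        revert i j
        decide
      rcases hji with rfl | rfl | rfl | rfl | rfl
      · exact absurd hz (P.loopless.irrefl _)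
      · exact Or.inl rfl
      · exact Or.inr rfl
      · exact absurd hz (hanadj i)
      · exact absurd hz.symm (hanadj j)
    have hmem : ∀ z ∈ ({w, b, c, d, e} : Finset V), P.Adj (a i) z :=
      fun z hz => mem_nbhd.1 (hN' ▸ hz)
    have hb := hsel b (hmem b (by simp)) e1
    have he := hsel e (hmem e (by simp)) e5.symm
    have hbe : b ≠ e := by
      rintro rfl
      simp at hnd
    rcases hb with rfl | rfl <;> rcases he with rfl | rfl
    · exact absurd rfl hbe
    · exact ⟨c, d, hN', hnd, e2, e3, e4, n1, n2, n3, n5⟩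
    · refine ⟨d, c, ?_, ?_, e4.symm, e3.symm, e2.symm, n2, n1, fun h => n5 h.symm,
        fun h => n3 h.symm⟩
      · rw [hN']
        ext z
        simp only [Finset.mem_insert, Finset.mem_singleton]
        tauto
      · simp only [List.nodup_cons, List.mem_cons, List.not_mem_nil, or_false, not_or] at hnd ⊢
        grind
    · exact absurd rfl hbe
  choose b q hNa hnda hab hbq hqa hwb hwq haq hba using hring
  -- the two descriptions of the second ring agree
  have hbq' : ∀ i, b i = q (i + 1) := by
    intro i
    have h2 := mem_nbhd.2 (hab i)
    have h3 : P.Adj (a i) (b i) := by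
      rw [← mem_nbhd, hNa i]
      simp
    rw [hNa (i + 1)] at h2
    simp only [Finset.mem_insert, Finset.mem_singleton, add_sub_cancel_right] at h2
    rcases h2 with h2 | h2 | h2 | h2 | h2
    · exact absurd (hwa i) (fun _ => (h2 ▸ hnda i).notMem (by simp))
    · exact absurd (h2 ▸ hwa _) (hwb i)
    · have := hba (i + 1)
      rw [add_sub_cancel_right, ← h2] at this
      exact absurd h3.symm this
    · exact h2
    · exact absurd h3 (h2 ▸ P.loopless.irrefl _)
  have hq : ∀ i, q i = b (i - 1) := by
    intro i
    rw [hbq', sub_add_cancel]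
  simp only [hq] at hNa hnda hbq hqa hwq haq
  have hab0 : ∀ i, P.Adj (a i) (b i) := by
    intro i
    rw [← mem_nbhd, hNa i]
    simp
  have hbcyc : ∀ i, P.Adj (b i) (b (i + 1)) := by
    intro i
    have := hbq (i + 1)
    rw [add_sub_cancel_right] at this
    exact this.symm
  have hbw : ∀ i, b i ≠ w := by
    intro i h
    have := hnda i
    rw [h] at this
    simp at this
  have hbnea : ∀ i j, b i ≠ a j := fun i j h => hwb i (h ▸ hwa j)
  have hbinj : Function.Injective b := by
    intro i j hij
    have hji : j = i ∨ j = i + 1 ∨ i = j + 1 ∨ j = i + 2 ∨ i = j + 2 := by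
      clear * -
      revert i j
      decide
    have hn2 : ∀ i, ¬ P.Adj (a (i + 2)) (b i) := by
      intro i h
      have := haq (i + 1)
      rw [add_assoc, add_sub_cancel_right] at this
      exact this h
    rcases hji with h | rfl | rfl | rfl | rfl
    · exact h.symm
    · exact absurd hij (hbcyc i).ne
    · exact absurd hij.symm (hbcyc j).ne
    · exact absurd (hij ▸ hab0 (i + 2)) (hn2 i)
    · exact absurd (hij ▸ hab0 (j + 2)) (hn2 j)
  -- the last vertex
  set S : Finset V := insert w (Finset.univ.image a ∪ Finset.univ.image b) with hS
  have hScard : S.card = 11 := by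
    rw [hS, Finset.card_insert_of_notMem, Finset.card_union_of_disjoint,
      Finset.card_image_of_injective _ hainj, Finset.card_image_of_injective _ hbinj]
    · rfl
    · rw [Finset.disjoint_left]
      intro z hz hz'
      obtain ⟨i, -, rfl⟩ := Finset.mem_image.1 hz
      obtain ⟨j, -, hj⟩ := Finset.mem_image.1 hz'
      exact hbnea j i hj
    · intro h
      rcases Finset.mem_union.1 h with h | h
      · obtain ⟨i, -, hi⟩ := Finset.mem_image.1 h
        exact (hwa i).ne' hi
      · obtain ⟨i, -, hi⟩ := Finset.mem_image.1 h
        exact hbw i hi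
  obtain ⟨z, hz⟩ : ∃ z, Sᶜ = {z} := by
    rw [← Finset.card_eq_one, Finset.card_compl, h12, hScard]
  have hzS : z ∉ S := by
    rw [← Finset.mem_compl, hz]
    exact Finset.mem_singleton_self z
  have hSmem : ∀ t, t ∈ S ↔ t = w ∨ (∃ i, t = a i) ∨ ∃ i, t = b i := by
    intro t
    simp [hS, eq_comm]
  have hall : ∀ t, t ≠ z → t ∈ S := by
    intro t ht
    by_contra hcon
    rw [← Finset.mem_compl, hz, Finset.mem_singleton] at hcon
    exact ht hcon
  have hzb : ∀ i, P.Adj z (b i) := by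
    have hsub : nbhd P z ⊆ Finset.univ.image b := by
      intro t ht
      rw [mem_nbhd] at ht
      rcases (hSmem t).1 (hall t ht.ne') with rfl | ⟨i, rfl⟩ | ⟨i, rfl⟩
      · exact absurd ((hSmem z).2 (Or.inr (Or.inl ((hN z).1 ht.symm)))) hzS
      · have h2 := mem_nbhd.2 ht.symm
        rw [hNa i] at h2
        refine absurd ((hSmem z).2 ?_) hzS
        simp only [Finset.mem_insert, Finset.mem_singleton] at h2
        rcases h2 with h2 | h2 | h2 | h2 | h2
        exacts [Or.inl h2, Or.inr (Or.inl ⟨_, h2⟩), Or.inr (Or.inr ⟨_, h2⟩),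
          Or.inr (Or.inr ⟨_, h2⟩), Or.inr (Or.inl ⟨_, h2⟩)]
      · exact Finset.mem_image_of_mem _ (Finset.mem_univ _)
    have heq := Finset.eq_of_subset_of_card_le hsub (by
      rw [h5]
      exact Finset.card_image_le)
    intro i
    rw [← mem_nbhd, heq]
    exact Finset.mem_image_of_mem _ (Finset.mem_univ _)
  -- `w` goes to `u* = 10`, the first ring to `11, 0, 1, 2, 3`
  set f : Fin 12 → V := ![a 1, a 2, a 3, a 4, b 4, b 0, b 2, z, b 1, b 3, w, a 0] with hf
  have hza : ∀ i, a i ≠ z := fun i h => hzS ((hSmem z).2 (Or.inr (Or.inl ⟨i, h.symm⟩)))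
  have hzb' : ∀ i, b i ≠ z := fun i => (hzb i).ne'
  have hzw : z ≠ w := fun h => hzS ((hSmem z).2 (Or.inl h))
  have hnd : [a 1, a 2, a 3, a 4, b 4, b 0, b 2, z, b 1, b 3, w, a 0].Nodup := by
    simp only [List.nodup_cons, List.mem_cons, List.not_mem_nil, or_false, not_or, hainj.eq_iff,
      hbinj.eq_iff, hza, hzb', hbw, fun i j => (hbnea i j).symm, hbnea, fun i => (hwa i).ne',
      fun i => (hwa i).ne, hzw, fun i => (hzb' i).symm, fun i => (hza i).symm, not_false_eq_true,
      true_and, and_true, List.nodup_nil]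
    decide
  have hfinj : Function.Injective f := by
    have heq : f = [a 1, a 2, a 3, a 4, b 4, b 0, b 2, z, b 1, b 3, w, a 0].get := by
      funext i
      fin_cases i <;> rfl
    rw [heq]
    exact List.nodup_iff_injective_get.1 hnd
  have hadj : ∀ i j, gStarUV.Adj i j → P.Adj (f i) (f j) := by
    have hL : ∀ e ∈ ([(0, 1), (1, 2), (2, 3), (3, 4), (4, 5), (5, 0),
        (6, 7), (6, 8), (6, 9), (7, 8), (7, 9),
        (8, 5), (8, 0), (8, 1), (6, 1), (6, 2),
        (9, 2), (9, 3), (9, 4), (7, 4), (7, 5),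
        (10, 0), (10, 1), (10, 2), (10, 3),
        (11, 3), (11, 4), (11, 5), (11, 0), (10, 11)] : List (Fin 12 × Fin 12)),
        P.Adj (f e.1) (f e.2) := by
      simp only [List.forall_mem_cons]
      exact ⟨hacyc 1, hacyc 2, hacyc 3, hab0 4, hbcyc 4, (hab 0).symm,
        (hzb 2).symm, (hbcyc 1).symm, hbcyc 2, hzb 1, hzb 3,
        (hbcyc 0).symm, (hab0 1).symm, (hab 1).symm, (hab0 2).symm, (hab 2).symm,
        (hab0 3).symm, (hab 3).symm, hbcyc 3, hzb 4, hzb 0,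
        hwa 1, hwa 2, hwa 3, hwa 4,
        (hacyc 4).symm, hab 4, hab0 0, hacyc 0, hwa 0, by simp⟩
    intro i j hij
    rcases (gStarUV_adj_iff i j).1 hij with h | ⟨rfl, rfl⟩ | ⟨rfl, rfl⟩
    · rcases h.2 with h | h
      · exact hL (i, j) (List.mem_append_left [(10, 11)] h)
      · exact (hL (j, i) (List.mem_append_left [(10, 11)] h)).symm
    · exact hwa 0
    · exact (hwa 0).symm
  obtain ⟨φ, hφ⟩ := AGraph.exists_iso_gStarUV h5 h12 f hfinj hadj
  exact ⟨φ, hφ 10, ha0 ▸ hφ 11, ha1 ▸ hφ 0⟩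

end IcosahedronIso

end AGraph
namespace AGraph

/-! ### Kempe classes and the lower bound for `A*` -/

section KempeBridge

open scoped Classical

variable {V : Type*} {G : SimpleGraph V}

theorem coloring_isProper (c : G.Coloring (Fin 4)) : IsProper G c := fun _ _ h => c.valid h

theorem linked_of_reachable {c : G.Coloring (Fin 4)} {j k : Fin 4} {a b : twoColored G c j k}
    (h : (G.induce (twoColored G c j k)).Reachable a b) : Linked G c j k a b := by
  obtain ⟨p⟩ := h
  induction p with
  | nil => exact Relation.ReflTransGen.refl
  | @cons a b d hab p ih => exact Relation.ReflTransGen.head ⟨hab, a.2, b.2⟩ ih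

theorem Linked.closed {c : V → Fin 4} {j k : Fin 4} {A : V → Prop}
    (hA : ∀ a b, G.Adj a b → (c a = j ∨ c a = k) → (c b = j ∨ c b = k) → A a → A b) {a b : V}
    (h : Linked G c j k a b) (ha : A a) : A b := by
  induction h with
  | refl => exact ha
  | tail _ hs ih => exact hA _ _ hs.1 hs.2.1 hs.2.2 ih

/-- Kempe exchanges in terms of a union `A` of Kempe chains. -/
theorem kempeExchange_iff (c c' : G.Coloring (Fin 4)) : KempeExchange G c c' ↔
    ∃ j k : Fin 4, j ≠ k ∧ ∃ A : V → Prop,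
      (∀ a b, G.Adj a b → (c a = j ∨ c a = k) → (c b = j ∨ c b = k) → A a → A b) ∧
      (∃ a, (c a = j ∨ c a = k) ∧ A a) ∧ (∃ b, (c b = j ∨ c b = k) ∧ ¬ A b) ∧
      ∀ w, c' w = if A w then Equiv.swap j k (c w) else c w := by
  constructor
  · rintro ⟨j, k, hjk, S, hS, hSu, h1, h2⟩
    refine ⟨j, k, hjk, fun w => ∃ h : w ∈ twoColored G c j k,
      SimpleGraph.connectedComponentMk _ ⟨w, h⟩ ∈ S, ?_, ?_, ?_, ?_⟩
    · rintro a b hab ha hb ⟨h, hS⟩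
      refine ⟨hb, ?_⟩
      have : (G.induce (twoColored G c j k)).Adj ⟨a, h⟩ ⟨b, hb⟩ := hab
      rwa [← SimpleGraph.ConnectedComponent.sound this.reachable]
    · obtain ⟨K, hK⟩ := hS
      induction K using SimpleGraph.ConnectedComponent.ind with
      | _ a => exact ⟨a, a.2, a.2, hK⟩
    · obtain ⟨K, hK⟩ := (Set.ne_univ_iff_exists_notMem S).1 hSu
      induction K using SimpleGraph.ConnectedComponent.ind with
      | _ a => exact ⟨a, a.2, fun h => hK h.2⟩
    · intro w
      by_cases hw : w ∈ twoColored G c j k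
      · by_cases hwS : SimpleGraph.connectedComponentMk _ (⟨w, hw⟩ : twoColored G c j k) ∈ S
        · rw [if_pos ⟨hw, hwS⟩]
          exact (h1 ⟨w, hw⟩).1 hwS
        · rw [if_neg fun h => hwS h.2]
          exact (h1 ⟨w, hw⟩).2 hwS
      · rw [if_neg fun h => hw h.1]
        exact h2 w hw
  · rintro ⟨j, k, hjk, A, hA, ⟨a, ha, hAa⟩, ⟨b, hb, hAb⟩, hc⟩
    have hmem : ∀ w : twoColored G c j k, SimpleGraph.connectedComponentMk _ w ∈
        {K : KempeChain G c j k | ∃ z, SimpleGraph.connectedComponentMk _ z = K ∧ A z} ↔ A w := by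
      intro w
      refine ⟨?_, fun h => ⟨w, rfl, h⟩⟩
      rintro ⟨z, hz, hAz⟩
      exact (linked_of_reachable (SimpleGraph.ConnectedComponent.exact hz)).closed hA hAz
    refine ⟨j, k, hjk, {K | ∃ z, SimpleGraph.connectedComponentMk _ z = K ∧ A z},
      ⟨_, (hmem ⟨a, ha⟩).2 hAa⟩, fun h => hAb ((hmem ⟨b, hb⟩).1 (h ▸ Set.mem_univ _)),
      fun w => ⟨fun h => ?_, fun h => ?_⟩, fun w hw => ?_⟩
    · rw [hc, if_pos ((hmem w).1 h)]
    · rw [hc, if_neg fun h' => h ((hmem w).2 h')]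
    · have hw' : ¬ (c w = j ∨ c w = k) := hw
      push Not at hw'
      rw [hc, Equiv.swap_apply_of_ne_of_ne hw'.1 hw'.2, ite_self]

theorem swap_eq_or_eq_iff {j k z : Fin 4} :
    (Equiv.swap j k z = j ∨ Equiv.swap j k z = k) ↔ z = j ∨ z = k := by
  rw [Equiv.swap_apply_eq_iff, Equiv.swap_apply_eq_iff, Equiv.swap_apply_left,
    Equiv.swap_apply_right, or_comm]

theorem KempeExchange.symm {c c' : G.Coloring (Fin 4)} (h : KempeExchange G c c') :
    KempeExchange G c' c := by
  obtain ⟨j, k, hjk, A, hA, ⟨a, ha, hAa⟩, ⟨b, hb, hAb⟩, hc⟩ := (kempeExchange_iff c c').1 h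
  have h2 : ∀ w, (c' w = j ∨ c' w = k) ↔ (c w = j ∨ c w = k) := by
    intro w
    rw [hc]
    split_ifs
    exacts [swap_eq_or_eq_iff, Iff.rfl]
  refine (kempeExchange_iff c' c).2 ⟨j, k, hjk, A, fun a b hab ha hb =>
    hA a b hab ((h2 a).1 ha) ((h2 b).1 hb), ⟨a, (h2 a).2 ha, hAa⟩, ⟨b, (h2 b).2 hb, hAb⟩,
    fun w => ?_⟩
  rw [hc]
  split_ifs
  exacts [(Equiv.swap_apply_self j k (c w)).symm, rfl]

/-- The state of a colouring. -/
def stateOf (c : G.Coloring (Fin 4)) : State G := ⟨Setoid.ker c, c, rfl⟩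

theorem stateOf_iff (c : G.Coloring (Fin 4)) (a b : V) : (stateOf c).1 a b ↔ c a = c b := Iff.rfl

theorem exists_stateOf (s : State G) : ∃ c, s = stateOf c := by
  obtain ⟨c, hc⟩ := s.2
  exact ⟨c, Subtype.ext hc⟩

theorem KempeExchange.reachable {c c' : G.Coloring (Fin 4)} (h : KempeExchange G c c') :
    (stateGraph G).Reachable (stateOf c) (stateOf c') := by
  by_cases heq : stateOf c = stateOf c'
  · rw [heq]
  · exact SimpleGraph.Adj.reachable
      ((SimpleGraph.fromRel_adj _ _ _).2 ⟨heq, Or.inl ⟨c, c', rfl, rfl, h⟩⟩)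

/-- If `x` and `y` can be separated by one Kempe exchange, then there is an n-s class. -/
theorem Unlocked.exists_isNSClass {x y : V} (h : Unlocked G x y) :
    ∃ C : KempeClass G, IsNSClass C x y := by
  obtain ⟨c, hc, hxy, k, hk, hl⟩ := h
  have hcl : ∀ a b, G.Adj a b → (c a = c x ∨ c a = k) → (c b = c x ∨ c b = k) →
      Linked G c (c x) k x a → Linked G c (c x) k x b :=
    fun a b hab ha hb hl => hl.tail ⟨hab, ha, hb⟩
  set C : G.Coloring (Fin 4) := SimpleGraph.Coloring.mk c fun {a b} h => hc a b h with hC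
  set C' : G.Coloring (Fin 4) := SimpleGraph.Coloring.mk _ fun {a b} h => hc.swapOn hcl a b h with hC'
  have hex : KempeExchange G C C' := (kempeExchange_iff C C').2 ⟨c x, k, hk.symm,
    Linked G c (c x) k x, hcl, ⟨x, Or.inl rfl, Relation.ReflTransGen.refl⟩,
    ⟨y, Or.inl hxy.symm, hl⟩, fun w => rfl⟩
  refine ⟨(stateGraph G).connectedComponentMk (stateOf C), ⟨stateOf C, rfl, hxy⟩, stateOf C', ?_, ?_⟩
  · rw [SimpleGraph.ConnectedComponent.mem_supp_iff]
    exact SimpleGraph.ConnectedComponent.sound hex.reachable.symm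
  · rw [stateOf_iff]
    change (if Linked G c (c x) k x x then _ else _) ≠ (if Linked G c (c x) k x y then _ else _)
    have hxx : Linked G c (c x) k x x := Relation.ReflTransGen.refl
    rw [if_pos hxx, if_neg hl, Equiv.swap_apply_left, ← hxy]
    exact hk

theorem KempeExchange.eq_of_not_unlocked {x y : V} (hl : ¬ Unlocked G x y)
    {c c' : G.Coloring (Fin 4)} (h : KempeExchange G c c') (hxy : c x = c y) : c' x = c' y := by
  obtain ⟨j, k, hjk, A, hA, -, -, hc⟩ := (kempeExchange_iff c c').1 h
  rw [hc, hc, ← hxy]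
  by_cases hx : c x = j ∨ c x = k
  · have hlink : Linked G c j k x y := by
      by_contra hcon
      refine hl ⟨c, coloring_isProper c, hxy, ?_⟩
      rcases hx with hx | hx
      · exact ⟨k, fun h => hjk (hx.symm.trans h.symm), by rwa [hx]⟩
      · refine ⟨j, fun h => hjk (h.trans hx), fun h => hcon ?_⟩
        rw [hx] at h
        exact h.map id fun p q hpq hp hq => Or.inr ⟨hpq, hp.symm, hq.symm⟩
    have : A x ↔ A y := ⟨hlink.closed hA, hlink.symm.closed hA⟩
    simp only [this]
  · push Not at hx
    rw [Equiv.swap_apply_of_ne_of_ne hx.1 hx.2, ite_self, ite_self]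

/-- If `x` and `y` cannot be separated by one Kempe exchange, then there is no n-s class. -/
theorem not_isNSClass_of_not_unlocked {x y : V} (hl : ¬ Unlocked G x y) (C : KempeClass G) :
    ¬ IsNSClass C x y := by
  rintro ⟨⟨s, hs, hsxy⟩, t, ht, htxy⟩
  have hrel : ∀ s t : State G, (∃ c c' : G.Coloring (Fin 4), s.1 = Setoid.ker c ∧
      t.1 = Setoid.ker c' ∧ KempeExchange G c c') → (s.1 x y ↔ t.1 x y) := by
    rintro s t ⟨c, c', hs, ht, h⟩
    rw [hs, ht]
    exact ⟨h.eq_of_not_unlocked hl, h.symm.eq_of_not_unlocked hl⟩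
  have hst : (stateGraph G).Reachable s t := SimpleGraph.ConnectedComponent.exact
    (((SimpleGraph.ConnectedComponent.mem_supp_iff _ _).1 hs).trans
      ((SimpleGraph.ConnectedComponent.mem_supp_iff _ _).1 ht).symm)
  obtain ⟨p⟩ := hst
  clear hs ht
  induction p with
  | nil => exact htxy hsxy
  | cons hab p ih =>
    refine ih ?_ htxy
    rcases ((SimpleGraph.fromRel_adj _ _ _).1 hab).2 with h | h
    · exact (hrel _ _ h).1 hsxy
    · exact (hrel _ _ h).2 hsxy

theorem Unlocked.of_closed {c : V → Fin 4} {x y : V} (hc : IsProper G c) (hxy : c x = c y)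
    {k : Fin 4} (hk : k ≠ c x) {A : V → Prop}
    (hA : ∀ a b, G.Adj a b → (c a = c x ∨ c a = k) → (c b = c x ∨ c b = k) → A a → A b)
    (hx : A x) (hy : ¬ A y) : Unlocked G x y :=
  ⟨c, hc, hxy, k, hk, fun h => hy (h.closed hA hx)⟩

theorem Unlocked.of_iso {W : Type*} {H : SimpleGraph W} (φ : G ≃g H) {x y : V}
    (h : Unlocked H (φ x) (φ y)) : Unlocked G x y := by
  obtain ⟨c, hc, hxy, k, hk, hl⟩ := h
  refine ⟨fun z => c (φ z), fun a b hab => hc _ _ (φ.map_adj_iff.2 hab), hxy, k, hk, fun h => hl ?_⟩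
  have key : ∀ z, Linked G (fun z => c (φ z)) (c (φ x)) k x z →
      Linked H c (c (φ x)) k (φ x) (φ z) := by
    intro z hz
    induction hz with
    | refl => exact Relation.ReflTransGen.refl
    | tail _ hs ih => exact ih.tail ⟨φ.map_adj_iff.2 hs.1, hs.2⟩
  exact key y h

end KempeBridge

section OrderTwelve

open scoped Classical

variable {V : Type*}

theorem del_sup_edge {G : SimpleGraph V} {x y : V} (hxy : ¬ G.Adj x y) :
    del (G ⊔ SimpleGraph.edge x y) x y = G := by
  ext a b
  rw [del_adj, SimpleGraph.sup_adj, SimpleGraph.edge_adj]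
  constructor
  · rintro ⟨h | ⟨⟨rfl, rfl⟩ | ⟨rfl, rfl⟩, -⟩, h2⟩
    exacts [h, absurd rfl h2, absurd Sym2.eq_swap h2]
  · refine fun h => ⟨Or.inl h, fun he => ?_⟩
    rcases Sym2.eq_iff.1 he with ⟨rfl, rfl⟩ | ⟨rfl, rfl⟩
    exacts [hxy h, hxy h.symm]

theorem sup_edge_adj_self {G : SimpleGraph V} {x y : V} (hne : x ≠ y) :
    (G ⊔ SimpleGraph.edge x y).Adj x y :=
  Or.inr ((SimpleGraph.edge_adj _ _ _ _).2 ⟨Or.inl ⟨rfl, rfl⟩, hne⟩)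

/-- An isomorphism that respects an added edge restricts to the graphs without that edge. -/
theorem exists_iso_of_sup_edge {W : Type*} {G : SimpleGraph V} {H : SimpleGraph W} {a b : V}
    {a' b' : W} (hab : ¬ G.Adj a b) (hab' : ¬ H.Adj a' b')
    (φ : (G ⊔ SimpleGraph.edge a b) ≃g (H ⊔ SimpleGraph.edge a' b')) (ha : φ a = a')
    (hb : φ b = b') : ∃ ψ : G ≃g H, ∀ z, ψ z = φ z := by
  refine ⟨⟨φ.toEquiv, fun {p q} => ?_⟩, fun z => rfl⟩
  have hG : G.Adj p q ↔ (G ⊔ SimpleGraph.edge a b).Adj p q ∧ s(p, q) ≠ s(a, b) := by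
    rw [← del_adj, del_sup_edge hab]
  have hH : H.Adj (φ p) (φ q) ↔ (H ⊔ SimpleGraph.edge a' b').Adj (φ p) (φ q) ∧
      s(φ p, φ q) ≠ s(a', b') := by
    rw [← del_adj, del_sup_edge hab']
  refine hH.trans (Iff.trans ?_ hG.symm)
  refine and_congr φ.map_adj_iff (not_congr ?_)
  have he : s(a', b') = Sym2.map φ s(a, b) := by rw [Sym2.map_mk, ha, hb]
  rw [he, ← Sym2.map_mk]
  exact (Sym2.map.injective φ.injective).eq_iff

theorem gStar_isProper : IsProper gStar ![0, 1, 0, 1, 0, 2, 2, 1, 3, 3, 3, 3] := by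
  unfold IsProper
  decide

theorem gStar_unlocked : Unlocked gStar 10 11 :=
  Unlocked.of_closed gStar_isProper rfl (k := 2) (by decide) (A := fun z => z = 10)
    (by decide) rfl (by decide)

theorem gStar_not_adj : ¬ gStar.Adj 10 11 := by decide

variable [Fintype V]

/-- Bad vertices of the parent lie on the boundary of `G`: off it, the neighbour `x` of a bad vertex `w`
would have two common neighbours with `w` in `G`, but the only one is `p`. -/
theorem IsAGraph.two_isBad_cases {G : SimpleGraph V} {u x v y : V} (hG : IsAGraph G u x v y)
    (hnxy : ¬ G.Adj x y) {T : Finset V} (hc : Critical (G ⊔ SimpleGraph.edge x y) T x y) {w : V}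
    (hw : IsBad (G ⊔ SimpleGraph.edge x y) x y w) : w = u ∨ w = v := by
  by_contra! hcon
  have hwx := hw.adj.1.ne
  have hwy := hw.adj.2.ne
  have hnb : nbhd G w = nbhd (G ⊔ SimpleGraph.edge x y) w := by
    have := Critical.nbhd_del (P := G ⊔ SimpleGraph.edge x y) hwx hwy
    rwa [del_sup_edge hnxy] at this
  have h4 := hw.card
  obtain ⟨p, s, hN, hnd, hxp, hps, hsy⟩ := hw
  have hxs := Critical.IsBad.not_adj hc hN hnd hxp hps hsy
  have h2 := hG.card_nbhd_le_two (a := x) (p := p) hcon.1 hwx hcon.2 hwy (by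
    rw [← mem_nbhd, hnb, hN]
    simp) (by
    intro b hb hxb
    rw [← mem_nbhd, hnb, hN] at hb
    simp only [Finset.mem_insert, Finset.mem_singleton] at hb
    rcases hb with rfl | rfl | rfl | rfl
    exacts [absurd hxb (G.loopless.irrefl _), rfl, absurd (Or.inl hxb) hxs, absurd hxb hnxy])
  rw [hnb] at h2
  omega

/-- The members of `A*` have order at least 12, and `G*` is the only one of order 12. -/
theorem InAStar.twelve_le {G : SimpleGraph V} {u x v y : V} (h : InAStar G u x v y) :
    12 ≤ Fintype.card V ∧ (Fintype.card V = 12 → ∃ φ : G ≃g gStar,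
      φ u = uStar ∧ φ x = xStar ∧ φ v = vStar ∧ φ y = yStar) := by
  obtain ⟨⟨hG, hnxy, -⟩, hNS⟩ := h
  have hlock : ¬ Unlocked G x y := fun h => by
    obtain ⟨C, hC⟩ := h.exists_isNSClass
    exact hNS C hC
  obtain ⟨hux, hxv, hvy, hyu⟩ := hG.adj
  have hxy : x ≠ y := hG.2.1
  have huv : u ≠ v := hG.1
  have hP := hG.isFlat_sup_edge_left hnxy
  set P := G ⊔ SimpleGraph.edge x y with hPdef
  have hPxy : P.Adj x y := sup_edge_adj_self hxy
  have hlock' : ¬ Unlocked (del P x y) x y := by rwa [del_sup_edge hnxy]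
  refine ⟨?_, fun h12 => ?_⟩
  · by_contra! hlt
    exact hlock' (hP.unlocked (SupportedOn.univ P) (by rw [Finset.card_univ]; omega) hPxy)
  · have hsum := hG.le_sum_card_nbhd
    have hc : Critical P Finset.univ x y := {
      flat := hP
      supp := SupportedOn.univ P
      maximal := isCornerClosed_of_card (by omega) (by
        rw [hPdef, sum_card_nbhd_sup_edge hxy hnxy]
        omega)
      adj := hPxy
      locked := hlock'
      unlocked := fun P' T' x' y' h1 h2 h3 h4 => h1.unlocked h2 (by
        rw [Finset.card_univ] at h3
        omega) h4
      card_le := by rw [Finset.card_univ]; omega }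
    rcases hc.card_and_degrees.2 with h5 | ⟨w₁, w₂, hne, hb₁, hb₂, hx6, hy6, h5⟩
    · -- the parent is the icosahedron, where `x` and `y` are not locked
      obtain ⟨φ, hφx, hφy, -⟩ := hP.exists_iso_gStarUV (fun w => h5 w (Finset.mem_univ w)) h12 hPxy
        (a₁ := u) (Or.inl hux.symm) (Or.inl hyu)
      obtain ⟨ψ, hψ⟩ := exists_iso_of_sup_edge hnxy gStar_not_adj φ hφx hφy
      refine absurd (Unlocked.of_iso ψ ?_) hlock
      rw [hψ, hψ, hφx, hφy]
      exact gStar_unlocked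
    · -- the other parent `G + u v` is the icosahedron
      have hbad : IsBad P x y u ∧ IsBad P x y v := by
        rcases hG.two_isBad_cases hnxy hc hb₁ with rfl | rfl <;>
          rcases hG.two_isBad_cases hnxy hc hb₂ with rfl | rfl
        exacts [absurd rfl hne, ⟨hb₁, hb₂⟩, ⟨hb₂, hb₁⟩, absurd rfl hne]
      have huv' : ∀ w, w = u ∨ w = v ↔ w = w₁ ∨ w = w₂ := by
        rcases hG.two_isBad_cases hnxy hc hb₁ with rfl | rfl <;>
          rcases hG.two_isBad_cases hnxy hc hb₂ with rfl | rfl <;> intro w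
        exacts [absurd rfl hne, Iff.rfl, or_comm, absurd rfl hne]
      have hnuv : ¬ G.Adj u v := by
        intro hadj
        obtain ⟨p, s, hN, hnd, hxp, hps, hsy⟩ := hbad.1
        have hv : v ∈ nbhd P u := mem_nbhd.2 (Or.inl hadj)
        rw [hN] at hv
        simp only [Finset.mem_insert, Finset.mem_singleton] at hv
        rcases hv with rfl | rfl | rfl | rfl
        · exact hxv.ne rfl
        · -- the reversed path gives that `p` and `y` are not adjacent
          have hN' : nbhd P u = {y, s, v, x} := by
            rw [hN]
            ext z
            simp only [Finset.mem_insert, Finset.mem_singleton]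
            tauto
          exact Critical.IsBad.not_adj hc.symm hN' (by simpa using List.nodup_reverse.2 hnd)
            hsy.symm hps.symm hxp.symm (Or.inl hvy.symm)
        · exact Critical.IsBad.not_adj hc hN hnd hxp hps hsy (Or.inl hxv)
        · exact hvy.ne rfl
      have hdeg : ∀ w, (nbhd (G ⊔ SimpleGraph.edge u v) w).card = 5 := by
        intro w
        have e1 := card_nbhd_sup_edge huv hnuv w
        have e2 := card_nbhd_sup_edge hxy hnxy w
        rw [← hPdef] at e2
        by_cases hwu : w = u
        · subst hwu
          have := hbad.1.card
          have := hbad.1.adj.1.ne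
          have := hbad.1.adj.2.ne
          simp_all
        · by_cases hwv : w = v
          · subst hwv
            have := hbad.2.card
            have := hbad.2.adj.1.ne
            have := hbad.2.adj.2.ne
            simp_all
          · by_cases hwx : w = x
            · subst hwx
              simp_all
            · by_cases hwy : w = y
              · subst hwy
                simp_all
              · have hw := (huv' w).not.1 (by tauto)
                push Not at hw
                have := h5 w (Finset.mem_univ w) hwx hwy hw.1 hw.2
                simp_all
      obtain ⟨φ, hφu, hφv, hφx⟩ := (hG.isFlat_sup_edge_right hnuv).exists_iso_gStarUV hdeg h12
        (sup_edge_adj_self huv) (a₁ := x) (Or.inl hux) (Or.inl hxv.symm)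
      have hφy : φ y = 3 := by
        have h1 : gStarUV.Adj (φ y) (φ u) := φ.map_adj_iff.2 (Or.inl hyu)
        have h2 : gStarUV.Adj (φ y) (φ v) := φ.map_adj_iff.2 (Or.inl hvy.symm)
        rw [hφu] at h1
        rw [hφv] at h2
        refine gStarUV_common_neighbor _ h1 h2 fun h => hxy ?_
        exact φ.injective (hφx.trans h.symm)
      obtain ⟨ψ, hψ⟩ := exists_iso_of_sup_edge hnuv gStar_not_adj φ hφu hφv
      exact ⟨ψ, by rw [hψ, hφu]; rfl, by rw [hψ, hφx]; rfl, by rw [hψ, hφv]; rfl,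
        by rw [hψ, hφy]; rfl⟩

end OrderTwelve

end AGraph
namespace AGraph

/-! ### Plane drawings of `G*` and of its parents -/

section FaceCount

open scoped Classical

variable {V : Type*} {G : SimpleGraph V}

theorem RotationSystem.face_ne (R : RotationSystem G) (e : G.Dart) : R.face e ≠ e :=
  fun h => e.adj.ne (by rw [← R.face_fst, h])

variable [Fintype V]

namespace RotationSystem

variable (R : RotationSystem G)

theorem card_filter_faceOf {e : G.Dart} {m : ℕ} (hm : 0 < m) (he : (R.face ^ m) e = e)
    (hinj : ∀ i < m, ∀ j < m, (R.face ^ i) e = (R.face ^ j) e → i = j) :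
    (Finset.univ.filter fun e' => R.faceOf e' = R.faceOf e).card = m := by
  have : (Finset.univ.filter fun e' => R.faceOf e' = R.faceOf e) =
      (Finset.range m).image fun i => (R.face ^ i) e := by
    ext e'
    simp only [Finset.mem_filter, Finset.mem_univ, true_and, Finset.mem_image, Finset.mem_range]
    constructor
    · intro h
      obtain ⟨i, hi, h'⟩ := exists_pow_lt_of_sameCycle hm he (R.faceOf_eq.1 h.symm)
      exact ⟨i, hi, h'⟩
    · rintro ⟨i, -, rfl⟩
      exact (R.faceOf_eq.2 ⟨i, by rw [zpow_natCast]⟩).symm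
  rw [this, Finset.card_image_of_injOn, Finset.card_range]
  intro i hi j hj h
  exact hinj i (by simpa using hi) j (by simpa using hj) h

theorem card_filter_faceOf_triangle {e : G.Dart} (he : R.face (R.face (R.face e)) = e) :
    (Finset.univ.filter fun e' => R.faceOf e' = R.faceOf e).card = 3 := by
  have h1 := R.face_ne e
  have h2 := R.face_ne (R.face e)
  have h3 := R.face_ne (R.face (R.face e))
  rw [he] at h3
  refine R.card_filter_faceOf (by norm_num) he fun i hi j hj h => ?_
  interval_cases i <;> interval_cases j
  exacts [rfl, absurd h.symm h1, absurd h h3, absurd h h1, rfl, absurd h.symm h2,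
    absurd h.symm h3, absurd h h2, rfl]

theorem sum_card_filter_faceOf :
    ∑ f, (Finset.univ.filter fun e => R.faceOf e = f).card = 2 * Nat.card G.edgeSet := by
  rw [Nat.card_eq_fintype_card, ← SimpleGraph.edgeFinset_card,
    ← SimpleGraph.dart_card_eq_twice_card_edges, ← Finset.card_univ,
    Finset.card_eq_sum_card_fiberwise (f := R.faceOf) (t := Finset.univ)
      (fun _ _ => Finset.mem_coe.2 (Finset.mem_univ _))]

/-- A rotation system with triangular faces only is planar, if the number of edges is right. -/
theorem isPlanar_of_triangles (hconn : G.Connected) (htri : ∀ d, R.face (R.face (R.face d)) = d)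
    (hE : Nat.card G.edgeSet + 6 = 3 * Nat.card V) : R.IsPlanar := by
  have h1 : ∀ f, (Finset.univ.filter fun e => R.faceOf e = f).card = 3 := by
    intro f
    induction f using Quotient.inductionOn with
    | _ e => exact R.card_filter_faceOf_triangle (htri e)
  have h2 := R.sum_card_filter_faceOf
  rw [Finset.sum_congr rfl fun f _ => h1 f, Finset.sum_const, Finset.card_univ,
    ← Nat.card_eq_fintype_card, smul_eq_mul] at h2
  have h3 : R.numFaces * 3 = 2 * Nat.card G.edgeSet := h2
  exact ⟨hconn, by omega⟩

/-- A rotation system with one face of size 4 and otherwise triangular faces is planar, if the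
number of edges is right. -/
theorem isPlanar_of_quadrangle (hconn : G.Connected) {d : G.Dart} {u x v y : V} (huv : u ≠ v)
    (hxy : x ≠ y) (h1 : d.toProd = (u, x)) (h2 : (R.face d).toProd = (x, v))
    (h3 : (R.face (R.face d)).toProd = (v, y)) (h4 : (R.face (R.face (R.face d))).toProd = (y, u))
    (h5 : R.face (R.face (R.face (R.face d))) = d)
    (htri : ∀ e, ¬ R.face.SameCycle d e → R.face (R.face (R.face e)) = e)
    (hE : Nat.card G.edgeSet + 7 = 3 * Nat.card V) : R.IsPlanar := by
  have hux : u ≠ x := by simpa [h1] using d.adj.ne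
  have hxv : x ≠ v := by simpa [h2] using (R.face d).adj.ne
  have hvy : v ≠ y := by simpa [h3] using (R.face (R.face d)).adj.ne
  have hyu : y ≠ u := by simpa [h4] using (R.face (R.face (R.face d))).adj.ne
  have hfour : (Finset.univ.filter fun e => R.faceOf e = R.faceOf d).card = 4 := by
    have hfst : ∀ i < 4, ((R.face ^ i) d).fst = (![u, x, v, y] : Fin 4 → V) (Fin.ofNat 4 i) := by
      intro i hi
      interval_cases i
      exacts [congrArg Prod.fst h1, congrArg Prod.fst h2, congrArg Prod.fst h3,
        congrArg Prod.fst h4]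
    refine R.card_filter_faceOf (by norm_num) h5 fun i hi j hj h => ?_
    have h6 := hfst i hi
    rw [h, hfst j hj] at h6
    interval_cases i <;> interval_cases j <;>
      first
        | rfl
        | exact (hux h6).elim
        | exact (hux h6.symm).elim
        | exact (huv h6).elim
        | exact (huv h6.symm).elim
        | exact (hyu h6).elim
        | exact (hyu h6.symm).elim
        | exact (hxv h6).elim
        | exact (hxv h6.symm).elim
        | exact (hxy h6).elim
        | exact (hxy h6.symm).elim
        | exact (hvy h6).elim
        | exact (hvy h6.symm).elim
  have hcard : ∀ f, (Finset.univ.filter fun e => R.faceOf e = f).card =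
      3 + if f = R.faceOf d then 1 else 0 := by
    intro f
    split_ifs with hf
    · rw [hf, hfour]
    · induction f using Quotient.inductionOn with
      | _ e => exact R.card_filter_faceOf_triangle (htri e fun h => hf (R.faceOf_eq.2 h.symm))
  have h6 := R.sum_card_filter_faceOf
  rw [Finset.sum_congr rfl fun f _ => hcard f, Finset.sum_add_distrib, Finset.sum_const,
    Finset.sum_ite_eq', if_pos (Finset.mem_univ _), Finset.card_univ, ← Nat.card_eq_fintype_card,
    smul_eq_mul] at h6
  have h7 : R.numFaces * 3 + 1 = 2 * Nat.card G.edgeSet := h6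
  exact ⟨hconn, by omega⟩

end RotationSystem

theorem two_mul_card_edgeSet {G : SimpleGraph (Fin 12)} {inst : DecidableRel G.Adj} {m : ℕ}
    (h : ∑ a, (Finset.univ.filter (G.Adj a)).card = m) : 2 * Nat.card G.edgeSet = m := by
  rw [← sum_card_nbhd_eq, ← h]
  refine Finset.sum_congr rfl fun a _ => congrArg _ ?_
  ext b
  simp

end FaceCount

/-- The entry that follows `w` in the cyclic list `l`. -/
def cyclicSucc (l : List (Fin 12)) (w : Fin 12) : Fin 12 := ((l.rotate 1)[l.idxOf w]?).getD w

/-- The rotation system given by listing the neighbours of each vertex in cyclic order. -/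
def rotationOf (G : SimpleGraph (Fin 12)) (r : Fin 12 → List (Fin 12))
    (h₁ : ∀ v w, G.Adj v w → G.Adj v (cyclicSucc (r v) w) ∧
      cyclicSucc (r v).reverse (cyclicSucc (r v) w) = w)
    (h₂ : ∀ v w, G.Adj v w → G.Adj v (cyclicSucc (r v).reverse w) ∧
      cyclicSucc (r v) (cyclicSucc (r v).reverse w) = w)
    (h₃ : ∀ v w w', G.Adj v w → G.Adj v w' → ∃ i : Fin 6, (cyclicSucc (r v))^[i] w = w') :
    RotationSystem G where
  next :=
    { toFun := fun d => ⟨(d.fst, cyclicSucc (r d.fst) d.snd), (h₁ _ _ d.adj).1⟩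
      invFun := fun d => ⟨(d.fst, cyclicSucc (r d.fst).reverse d.snd), (h₂ _ _ d.adj).1⟩
      left_inv := fun d => SimpleGraph.Dart.ext _ _ (Prod.ext rfl (h₁ _ _ d.adj).2)
      right_inv := fun d => SimpleGraph.Dart.ext _ _ (Prod.ext rfl (h₂ _ _ d.adj).2) }
  next_fst _ := rfl
  cyclic := by
    rintro ⟨⟨v, w⟩, h⟩ ⟨⟨v', w'⟩, h'⟩ rfl
    obtain ⟨i, hi⟩ := h₃ v w w' h h'
    refine ⟨(i : ℕ), ?_⟩
    rw [zpow_natCast, ← Equiv.Perm.iterate_eq_pow]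
    have key : ∀ (n : ℕ) (z : Fin 12) (hz : G.Adj v z), ∃ hz',
        (fun d : G.Dart => (⟨(d.fst, cyclicSucc (r d.fst) d.snd), (h₁ _ _ d.adj).1⟩ : G.Dart))^[n]
          ⟨(v, z), hz⟩ = ⟨(v, (cyclicSucc (r v))^[n] z), hz'⟩ := by
      intro n
      induction n with
      | zero => exact fun z hz => ⟨hz, rfl⟩
      | succ n ih => exact fun z hz => ih _ (h₁ v z hz).1
    obtain ⟨hz', hk⟩ := key i w h
    refine hk.trans (SimpleGraph.Dart.ext _ _ (Prod.ext rfl hi))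

/-- The cyclic order of the neighbours of each vertex in a plane drawing of `G*`. -/
def gStarRot : Fin 12 → List (Fin 12) :=
  ![[10, 11, 5, 8, 1], [10, 0, 8, 6, 2], [10, 1, 6, 9, 3], [10, 2, 9, 4, 11], [11, 3, 9, 7, 5],
    [8, 0, 11, 4, 7], [2, 1, 8, 7, 9], [5, 4, 9, 6, 8], [1, 0, 5, 7, 6], [3, 2, 6, 7, 4],
    [0, 1, 2, 3], [5, 0, 3, 4]]

/-- The drawing of `G* + x* y*` obtained from that of `G*`. -/
def gStarXYRot : Fin 12 → List (Fin 12) :=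
  ![[10, 3, 11, 5, 8, 1], [10, 0, 8, 6, 2], [10, 1, 6, 9, 3], [10, 2, 9, 4, 11, 0],
    [11, 3, 9, 7, 5], [8, 0, 11, 4, 7], [2, 1, 8, 7, 9], [5, 4, 9, 6, 8], [1, 0, 5, 7, 6],
    [3, 2, 6, 7, 4], [0, 1, 2, 3], [5, 0, 3, 4]]

/-- The drawing of `G* + u* v*` obtained from that of `G*`. -/
def gStarUVRot : Fin 12 → List (Fin 12) :=
  ![[10, 11, 5, 8, 1], [10, 0, 8, 6, 2], [10, 1, 6, 9, 3], [10, 2, 9, 4, 11], [11, 3, 9, 7, 5],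
    [8, 0, 11, 4, 7], [2, 1, 8, 7, 9], [5, 4, 9, 6, 8], [1, 0, 5, 7, 6], [3, 2, 6, 7, 4],
    [11, 0, 1, 2, 3], [5, 0, 10, 3, 4]]

theorem gStar_connected : gStar.Connected := by
  have h0 : ∀ a : Fin 12, a ≠ 0 → ∃ b < a, gStar.Adj a b := by decide
  have h1 : ∀ a : Fin 12, gStar.Reachable a 0 := by
    intro a
    induction a using WellFoundedLT.induction with
    | _ a ih =>
      by_cases ha : a = 0
      · rw [ha]
      · obtain ⟨b, hb, hab⟩ := h0 a ha
        exact hab.reachable.trans (ih b hb)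
  exact ⟨fun a b => (h1 a).trans (h1 b).symm⟩

theorem gStar_card_edgeSet : Nat.card gStar.edgeSet = 29 := by
  have := two_mul_card_edgeSet (G := gStar) (inst := inferInstance) (m := 58) (by decide)
  omega

theorem isPlanarTriangulation_of_rot (G : SimpleGraph (Fin 12)) (hG : gStar ≤ G)
    (hE : Nat.card G.edgeSet = 30) (r : Fin 12 → List (Fin 12))
    (h₁ : ∀ v w, G.Adj v w → G.Adj v (cyclicSucc (r v) w) ∧
      cyclicSucc (r v).reverse (cyclicSucc (r v) w) = w)
    (h₂ : ∀ v w, G.Adj v w → G.Adj v (cyclicSucc (r v).reverse w) ∧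
      cyclicSucc (r v) (cyclicSucc (r v).reverse w) = w)
    (h₃ : ∀ v w w', G.Adj v w → G.Adj v w' → ∃ i : Fin 6, (cyclicSucc (r v))^[i] w = w')
    (h₄ : ∀ a b, G.Adj a b → cyclicSucc (r (cyclicSucc (r b) a)) b = a ∧
      cyclicSucc (r a) (cyclicSucc (r b) a) = b) : IsPlanarTriangulation G := by
  have htri : ∀ d, (rotationOf G r h₁ h₂ h₃).face ((rotationOf G r h₁ h₂ h₃).face
      ((rotationOf G r h₁ h₂ h₃).face d)) = d := by
    rintro ⟨⟨a, b⟩, hab⟩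
    obtain ⟨h5, h6⟩ := h₄ a b hab
    refine SimpleGraph.Dart.ext _ _ (Prod.ext h5 ?_)
    change cyclicSucc (r (cyclicSucc (r (cyclicSucc (r b) a)) b)) (cyclicSucc (r b) a) = b
    rw [h5, h6]
  exact ⟨_, RotationSystem.isPlanar_of_triangles _ (gStar_connected.mono hG) htri
    (by rw [hE, Nat.card_eq_fintype_card, Fintype.card_fin]), htri⟩

theorem gStarXY_isPlanarTriangulation : IsPlanarTriangulation (gStar ⊔ SimpleGraph.edge 0 3) := by
  refine isPlanarTriangulation_of_rot _ le_sup_left ?_ gStarXYRot ?_ ?_ ?_ ?_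
  · have := two_mul_card_edgeSet (G := gStar ⊔ SimpleGraph.edge 0 3) (inst := inferInstance)
      (m := 60) (by decide)
    omega
  all_goals decide

theorem gStarUV_isPlanarTriangulation : IsPlanarTriangulation gStarUV := by
  refine isPlanarTriangulation_of_rot _ le_sup_left ?_ gStarUVRot ?_ ?_ ?_ ?_
  · have := two_mul_card_edgeSet (G := gStarUV) (inst := inferInstance) (m := 60) (by decide)
    omega
  all_goals decide

theorem isAGraph_of_rot (r : Fin 12 → List (Fin 12)) (u x v y : Fin 12)
    (h₁ : ∀ v w, gStar.Adj v w → gStar.Adj v (cyclicSucc (r v) w) ∧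
      cyclicSucc (r v).reverse (cyclicSucc (r v) w) = w)
    (h₂ : ∀ v w, gStar.Adj v w → gStar.Adj v (cyclicSucc (r v).reverse w) ∧
      cyclicSucc (r v) (cyclicSucc (r v).reverse w) = w)
    (h₃ : ∀ v w w', gStar.Adj v w → gStar.Adj v w' → ∃ i : Fin 6, (cyclicSucc (r v))^[i] w = w')
    (huv : u ≠ v) (hxy : x ≠ y) (hux : gStar.Adj u x) (h5 : cyclicSucc (r x) u = v)
    (h6 : cyclicSucc (r v) x = y) (h7 : cyclicSucc (r y) v = u) (h8 : cyclicSucc (r u) y = x)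
    (h₄ : ∀ a b, gStar.Adj a b → (a, b) = (u, x) ∨ (a, b) = (x, v) ∨ (a, b) = (v, y) ∨
      (a, b) = (y, u) ∨ (cyclicSucc (r (cyclicSucc (r b) a)) b = a ∧
      cyclicSucc (r a) (cyclicSucc (r b) a) = b)) : IsAGraph gStar u x v y := by
  set R := rotationOf gStar r h₁ h₂ h₃ with hR
  have hface : ∀ d, (R.face d).toProd = (d.snd, cyclicSucc (r d.snd) d.fst) := fun d => rfl
  set d : gStar.Dart := ⟨(u, x), hux⟩ with hd
  have e1 : d.toProd = (u, x) := rfl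
  have e2 : (R.face d).toProd = (x, v) := by rw [hface, ← h5]
  have e3 : (R.face (R.face d)).toProd = (v, y) := by rw [hface, e2, ← h6]
  have e4 : (R.face (R.face (R.face d))).toProd = (y, u) := by rw [hface, e3, ← h7]
  have e5 : R.face (R.face (R.face (R.face d))) = d := by
    refine SimpleGraph.Dart.ext _ _ ?_
    rw [hface, e4]
    exact Prod.ext rfl h8
  have hcyc : ∀ i : ℕ, R.face.SameCycle d ((R.face ^ i) d) := fun i => ⟨i, by rw [zpow_natCast]⟩
  have htri : ∀ e, ¬ R.face.SameCycle d e → R.face (R.face (R.face e)) = e := by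
    rintro ⟨⟨a, b⟩, hab⟩ hne
    have hdart : ∀ i : ℕ, ((R.face ^ i) d).toProd ≠ (a, b) := fun i h =>
      hne (by
        have := SimpleGraph.Dart.ext ((R.face ^ i) d) ⟨(a, b), hab⟩ h
        rw [← this]
        exact hcyc i)
    rcases h₄ a b hab with h | h | h | h | ⟨h9, h10⟩
    · exact absurd h.symm (hdart 0)
    · exact absurd (e2.trans h.symm) (hdart 1)
    · exact absurd (e3.trans h.symm) (hdart 2)
    · exact absurd (e4.trans h.symm) (hdart 3)
    · refine SimpleGraph.Dart.ext _ _ (Prod.ext h9 ?_)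
      change cyclicSucc (r (cyclicSucc (r (cyclicSucc (r b) a)) b)) (cyclicSucc (r b) a) = b
      rw [h9, h10]
  exact ⟨huv, hxy, R, R.isPlanar_of_quadrangle gStar_connected huv hxy e1 e2 e3 e4 e5 htri
    (by rw [gStar_card_edgeSet, Nat.card_eq_fintype_card, Fintype.card_fin]), d, e1, e2, e3, e4, e5,
    htri⟩

theorem gStar_isParentedAGraph_xy : IsParentedAGraph gStar 10 0 11 3 := by
  refine ⟨?_, by decide, gStarXY_isPlanarTriangulation⟩
  refine isAGraph_of_rot gStarRot 10 0 11 3 ?_ ?_ ?_ ?_ ?_ ?_ ?_ ?_ ?_ ?_ ?_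
  all_goals decide

/-- For the other pair the boundary is traversed backwards, so the drawing is reflected. -/
theorem gStar_isParentedAGraph_uv : IsParentedAGraph gStar 0 10 3 11 := by
  refine ⟨?_, by decide, gStarUV_isPlanarTriangulation⟩
  refine isAGraph_of_rot (fun v => (gStarRot v).reverse) 0 10 3 11 ?_ ?_ ?_ ?_ ?_ ?_ ?_ ?_ ?_ ?_ ?_
  all_goals decide

end AGraph
namespace AGraph

/-! ### The states and the Kempe classes of `G*` -/

/-- The colourings of `G*` in which the triangle `6`, `7`, `8` has the colours `0`, `1`, `2`, one
for each state. In the first six `x*` and `y*` have the same colour. -/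
def gStarCol : Fin 18 → Fin 12 → Fin 4 :=
  ![![0, 3, 2, 0, 2, 3, 0, 1, 2, 3, 1, 1],
    ![1, 3, 2, 1, 2, 3, 0, 1, 2, 3, 0, 0],
    ![0, 1, 2, 0, 2, 3, 0, 1, 2, 3, 3, 1],
    ![0, 3, 1, 0, 2, 3, 0, 1, 2, 3, 2, 1],
    ![1, 3, 2, 1, 2, 0, 0, 1, 2, 3, 0, 3],
    ![1, 3, 2, 1, 0, 3, 0, 1, 2, 3, 0, 2],
    ![3, 1, 3, 1, 3, 0, 0, 1, 2, 2, 0, 2],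
    ![3, 1, 3, 1, 3, 0, 0, 1, 2, 2, 2, 2],
    ![3, 1, 3, 0, 3, 0, 0, 1, 2, 2, 2, 2],
    ![0, 1, 3, 1, 0, 3, 0, 1, 2, 2, 2, 2],
    ![3, 1, 3, 0, 3, 0, 0, 1, 2, 2, 2, 1],
    ![1, 3, 1, 0, 3, 0, 0, 1, 2, 2, 2, 2],
    ![0, 3, 1, 3, 0, 3, 0, 1, 2, 2, 2, 2],
    ![0, 1, 2, 1, 0, 3, 0, 1, 2, 3, 3, 2],
    ![1, 3, 1, 3, 0, 3, 0, 1, 2, 2, 2, 2],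
    ![1, 3, 1, 0, 2, 0, 0, 1, 2, 3, 2, 3],
    ![0, 3, 1, 3, 0, 3, 0, 1, 2, 2, 2, 1],
    ![1, 3, 1, 3, 0, 3, 0, 1, 2, 2, 0, 2]]

/-- For each colouring of the list an earlier one, related to it by a Kempe exchange. -/
def gStarParent : Fin 18 → Fin 18 :=
  ![0, 0, 0, 0, 1, 1, 6, 6, 7, 7, 8, 8, 9, 9, 11, 11, 12, 14]

theorem gStarCol_isProper (i : Fin 18) : IsProper gStar (gStarCol i) := by
  have : ∀ i : Fin 18, ∀ a b : Fin 12, gStar.Adj a b → gStarCol i a ≠ gStarCol i b := by decide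
  exact this i

theorem gStarCol_triangle : ∀ i : Fin 18,
    gStarCol i 6 = 0 ∧ gStarCol i 7 = 1 ∧ gStarCol i 8 = 2 := by
  decide

set_option maxRecDepth 100000 in
set_option synthInstance.maxSize 2000 in
set_option synthInstance.maxHeartbeats 400000 in
/-- The vertices are coloured one by one, each avoiding the colours of its earlier neighbours. -/
theorem exists_eq_gStarCol_aux : ∀ c9 : Fin 4, c9 ≠ 0 → c9 ≠ 1 → ∀ c5 : Fin 4, c5 ≠ 1 → c5 ≠ 2 →
    ∀ c0 : Fin 4, c0 ≠ 2 → c0 ≠ c5 → ∀ c1 : Fin 4, c1 ≠ c0 → c1 ≠ 2 → c1 ≠ 0 →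
    ∀ c2 : Fin 4, c2 ≠ c1 → c2 ≠ 0 → c2 ≠ c9 → ∀ c3 : Fin 4, c3 ≠ c2 → c3 ≠ c9 →
    ∀ c4 : Fin 4, c4 ≠ c3 → c4 ≠ c5 → c4 ≠ c9 → c4 ≠ 1 →
    ∀ c10 : Fin 4, c10 ≠ c0 → c10 ≠ c1 → c10 ≠ c2 → c10 ≠ c3 →
    ∀ c11 : Fin 4, c11 ≠ c3 → c11 ≠ c4 → c11 ≠ c5 → c11 ≠ c0 →
    ∃ i, ![c0, c1, c2, c3, c4, c5, 0, 1, 2, c9, c10, c11] = gStarCol i := by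
  decide

theorem exists_eq_gStarCol {c : Fin 12 → Fin 4} (hc : IsProper gStar c) (h6 : c 6 = 0)
    (h7 : c 7 = 1) (h8 : c 8 = 2) : ∃ i, c = gStarCol i := by
  have h : ∀ a b, gStar.Adj a b → c a ≠ c b := hc
  have hc' : c = ![c 0, c 1, c 2, c 3, c 4, c 5, c 6, c 7, c 8, c 9, c 10, c 11] := by
    funext i
    fin_cases i <;> rfl
  rw [h6, h7, h8] at hc'
  obtain ⟨i, hi⟩ := exists_eq_gStarCol_aux
    (c 9) (h6 ▸ h 9 6 (by decide)) (h7 ▸ h 9 7 (by decide))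
    (c 5) (h7 ▸ h 5 7 (by decide)) (h8 ▸ h 5 8 (by decide))
    (c 0) (h8 ▸ h 0 8 (by decide)) (h 0 5 (by decide))
    (c 1) (h 1 0 (by decide)) (h8 ▸ h 1 8 (by decide)) (h6 ▸ h 1 6 (by decide))
    (c 2) (h 2 1 (by decide)) (h6 ▸ h 2 6 (by decide)) (h 2 9 (by decide))
    (c 3) (h 3 2 (by decide)) (h 3 9 (by decide))
    (c 4) (h 4 3 (by decide)) (h 4 5 (by decide)) (h 4 9 (by decide)) (h7 ▸ h 4 7 (by decide))
    (c 10) (h 10 0 (by decide)) (h 10 1 (by decide)) (h 10 2 (by decide)) (h 10 3 (by decide))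
    (c 11) (h 11 3 (by decide)) (h 11 4 (by decide)) (h 11 5 (by decide)) (h 11 0 (by decide))
  exact ⟨i, hc'.trans hi⟩

/-- Up to a permutation of the colours, every colouring of `G*` is in the list. -/
theorem exists_perm_eq_gStarCol {c : Fin 12 → Fin 4} (hc : IsProper gStar c) :
    ∃ (π : Equiv.Perm (Fin 4)) (i : Fin 18), ∀ a, π (c a) = gStarCol i a := by
  have hperm : ∀ a b d : Fin 4, a ≠ b → a ≠ d → b ≠ d →
      ∃ π : Equiv.Perm (Fin 4), π a = 0 ∧ π b = 1 ∧ π d = 2 := by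
    decide
  obtain ⟨π, h6, h7, h8⟩ := hperm _ _ _ (hc 6 7 (by decide)) (hc 6 8 (by decide))
    (hc 7 8 (by decide))
  obtain ⟨i, hi⟩ := exists_eq_gStarCol (c := fun a => π (c a))
    (fun a b hab h => hc a b hab (π.injective h)) h6 h7 h8
  exact ⟨π, i, fun a => congrFun hi a⟩

/-- Whether `t` is reached from `a` by at most `n` steps inside a Kempe chain. -/
def chainReach (c : Fin 12 → Fin 4) (j k : Fin 4) (t : Fin 12) : ℕ → Fin 12 → Bool
  | 0, a => a = t
  | n + 1, a => a = t || decide (∃ b, gStar.Adj a b ∧ (c b = j ∨ c b = k) ∧ chainReach c j k t n b)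

theorem linked_of_chainReach {c : Fin 12 → Fin 4} {j k : Fin 4} {t : Fin 12} (n : ℕ) {a : Fin 12}
    (ha : c a = j ∨ c a = k) (h : chainReach c j k t n a = true) : Linked gStar c j k a t := by
  induction n generalizing a with
  | zero =>
    have : a = t := by simpa [chainReach] using h
    rw [this]
    exact Relation.ReflTransGen.refl
  | succ n ih =>
    rw [chainReach, Bool.or_eq_true, decide_eq_true_eq, decide_eq_true_eq] at h
    rcases h with rfl | ⟨b, hab, hb, hr⟩
    · exact Relation.ReflTransGen.refl
    · exact Relation.ReflTransGen.head ⟨hab, ha, hb⟩ (ih hb hr)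

set_option maxRecDepth 10000 in
theorem gStarCol_chainReach : ∀ i : Fin 18, gStarCol i 0 = gStarCol i 3 → ∀ k, k ≠ gStarCol i 0 →
    chainReach (gStarCol i) (gStarCol i 0) k 3 6 0 = true := by
  decide

/-- In `G*` the vertices `x*` and `y*` are locked. -/
theorem gStar_not_unlocked : ¬ Unlocked gStar 0 3 := by
  rintro ⟨c, hc, hxy, k, hk, hl⟩
  obtain ⟨π, i, hi⟩ := exists_perm_eq_gStarCol hc
  have h1 := linked_of_chainReach 6 (Or.inl rfl) (gStarCol_chainReach i
    (by rw [← hi, ← hi, hxy]) (π k) (by rw [← hi]; exact fun h => hk (π.injective h)))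
  refine hl (h1.map id fun p q hpq hp hq => Or.inr ⟨hpq, ?_, ?_⟩)
  all_goals
    simp only [← hi, π.injective.eq_iff] at hp hq
    assumption

/-- The states of `G*`. -/
def gStarState (i : Fin 18) : State gStar :=
  stateOf (SimpleGraph.Coloring.mk (gStarCol i) fun {a b} h => gStarCol_isProper i a b h)

theorem gStarState_iff (i : Fin 18) (a b : Fin 12) :
    (gStarState i).1 a b ↔ gStarCol i a = gStarCol i b := Iff.rfl

theorem gStarState_injective : Function.Injective gStarState := by
  have h : ∀ i j : Fin 18, (∀ a b, gStarCol i a = gStarCol i b ↔ gStarCol j a = gStarCol j b) →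
      i = j := by
    decide
  intro i j hij
  refine h i j fun a b => ?_
  rw [← gStarState_iff, ← gStarState_iff, hij]

theorem gStarState_surjective : Function.Surjective gStarState := by
  intro s
  obtain ⟨c, rfl⟩ := exists_stateOf s
  obtain ⟨π, i, hi⟩ := exists_perm_eq_gStarCol (coloring_isProper c)
  refine ⟨i, Subtype.ext (Setoid.ext fun a b => ?_)⟩
  rw [gStarState_iff, stateOf_iff, ← hi, ← hi, π.injective.eq_iff]

/-- Two colourings that agree on the triangle `6`, `7`, `8` and differ by an interchange of two
colours on some vertices belong to the same Kempe class: one of the two colours occurs on the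
triangle, so the vertices are not all vertices of these colours. -/
theorem gStarState_reachable {i p : Fin 18} {j k : Fin 4} (hjk : j ≠ k)
    (h : ∀ w, gStarCol p w = gStarCol i w ∨
      gStarCol i w ≠ gStarCol p w ∧ gStarCol p w = Equiv.swap j k (gStarCol i w)) :
    (stateGraph gStar).Reachable (gStarState i) (gStarState p) := by
  by_cases hip : i = p
  · rw [hip]
  have hne : ∃ a, gStarCol i a ≠ gStarCol p a := by
    by_contra! hcon
    refine hip (gStarState_injective (Subtype.ext (Setoid.ext fun a b => ?_)))
    rw [gStarState_iff, gStarState_iff, hcon, hcon]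
  have hsw : ∀ w, gStarCol i w ≠ gStarCol p w → gStarCol p w = Equiv.swap j k (gStarCol i w) :=
    fun w hw => (h w).elim (fun h => absurd h.symm hw) fun h => h.2
  refine KempeExchange.reachable ((kempeExchange_iff _ _).2 ⟨j, k, hjk,
    fun w => gStarCol i w ≠ gStarCol p w, ?_, ?_, ?_, ?_⟩)
  · intro a b hab ha hb haA hbA
    -- otherwise `a` would get the colour of `b`
    change gStarCol i a = j ∨ gStarCol i a = k at ha
    change gStarCol i b = j ∨ gStarCol i b = k at hb
    have h1 := gStarCol_isProper i a b hab
    have h2 := gStarCol_isProper p a b hab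
    rw [hsw a haA, ← hbA] at h2
    rcases ha with ha | ha <;> rcases hb with hb | hb <;> simp_all
  · obtain ⟨a, ha⟩ := hne
    refine ⟨a, ?_, ha⟩
    change gStarCol i a = j ∨ gStarCol i a = k
    by_contra! hcon
    refine ha ?_
    rw [hsw a ha, Equiv.swap_apply_of_ne_of_ne hcon.1 hcon.2]
  · have htri : ∀ i : Fin 18, ∀ j k : Fin 4, j ≠ k →
        ∃ b : Fin 12, (b = 6 ∨ b = 7 ∨ b = 8) ∧ (gStarCol i b = j ∨ gStarCol i b = k) := by
      intro i j k hjk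
      obtain ⟨h6, h7, h8⟩ := gStarCol_triangle i
      have : ∀ j k : Fin 4, j ≠ k → (0 = j ∨ 0 = k) ∨ (1 = j ∨ 1 = k) ∨ (2 = j ∨ 2 = k) := by decide
      rcases this j k hjk with h | h | h
      · exact ⟨6, Or.inl rfl, by rwa [h6]⟩
      · exact ⟨7, Or.inr (Or.inl rfl), by rwa [h7]⟩
      · exact ⟨8, Or.inr (Or.inr rfl), by rwa [h8]⟩
    obtain ⟨b, hb, hbc⟩ := htri i j k hjk
    refine ⟨b, hbc, not_not.2 ?_⟩
    obtain ⟨h6, h7, h8⟩ := gStarCol_triangle i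
    obtain ⟨h6', h7', h8'⟩ := gStarCol_triangle p
    rcases hb with rfl | rfl | rfl
    exacts [h6.trans h6'.symm, h7.trans h7'.symm, h8.trans h8'.symm]
  · intro w
    by_cases hw : gStarCol i w ≠ gStarCol p w
    · exact (hsw w hw).trans (if_pos hw).symm
    · exact (not_not.1 hw).symm.trans (if_neg hw).symm

theorem gStarParent_spec : ∀ i : Fin 18, i ≠ 0 → i ≠ 6 → gStarParent i < i ∧
    (gStarCol i 0 = gStarCol i 3 ↔ gStarCol (gStarParent i) 0 = gStarCol (gStarParent i) 3) ∧
    ∃ j k : Fin 4, j ≠ k ∧ ∀ w, gStarCol (gStarParent i) w = gStarCol i w ∨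
      gStarCol i w ≠ gStarCol (gStarParent i) w ∧
        gStarCol (gStarParent i) w = Equiv.swap j k (gStarCol i w) := by
  decide

theorem gStarState_reachable_root (i : Fin 18) : (stateGraph gStar).Reachable (gStarState i)
    (gStarState (if gStarCol i 0 = gStarCol i 3 then 0 else 6)) := by
  induction i using WellFoundedLT.induction with
  | _ i ih =>
  by_cases h0 : i = 0
  · subst h0
    exact SimpleGraph.Reachable.refl _
  by_cases h6 : i = 6
  · subst h6
    exact SimpleGraph.Reachable.refl _
  obtain ⟨hlt, hiff, j, k, hjk, h⟩ := gStarParent_spec i h0 h6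
  simp only [hiff]
  exact (gStarState_reachable hjk h).trans (ih _ hlt)

/-- The class of the states of `G*` in which `x*` and `y*` have the same colour. -/
def gStarN : KempeClass gStar := (stateGraph gStar).connectedComponentMk (gStarState 0)

/-- The class of the states of `G*` in which `x*` and `y*` have different colours. -/
def gStarS : KempeClass gStar := (stateGraph gStar).connectedComponentMk (gStarState 6)

theorem gStarState_mem (i : Fin 18) :
    gStarState i ∈ (if gStarCol i 0 = gStarCol i 3 then gStarN else gStarS).supp := by
  rw [SimpleGraph.ConnectedComponent.mem_supp_iff]
  have := SimpleGraph.ConnectedComponent.sound (gStarState_reachable_root i)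
  split_ifs at this ⊢ <;> exact this

theorem gStarN_isNClass : IsNClass gStarN 0 3 := by
  intro s hs
  by_contra h
  exact not_isNSClass_of_not_unlocked gStar_not_unlocked gStarN
    ⟨⟨gStarState 0, gStarState_mem 0, rfl⟩, s, hs, h⟩

theorem gStarS_isSClass : IsSClass gStarS 0 3 := by
  intro s hs h
  exact not_isNSClass_of_not_unlocked gStar_not_unlocked gStarS
    ⟨⟨s, hs, h⟩, gStarState 6, gStarState_mem 6, by rw [gStarState_iff]; decide⟩

theorem gStarN_supp : gStarN.supp = gStarState '' {i | gStarCol i 0 = gStarCol i 3} := by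
  ext s
  constructor
  · intro hs
    obtain ⟨i, rfl⟩ := gStarState_surjective s
    exact ⟨i, gStarN_isNClass _ hs, rfl⟩
  · rintro ⟨i, hi, rfl⟩
    have := gStarState_mem i
    rwa [if_pos (show gStarCol i 0 = gStarCol i 3 from hi)] at this

theorem gStarS_supp : gStarS.supp = gStarState '' {i | gStarCol i 0 ≠ gStarCol i 3} := by
  ext s
  constructor
  · intro hs
    obtain ⟨i, rfl⟩ := gStarState_surjective s
    exact ⟨i, gStarS_isSClass _ hs, rfl⟩
  · rintro ⟨i, hi, rfl⟩
    have := gStarState_mem i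
    rwa [if_neg (show gStarCol i 0 ≠ gStarCol i 3 from hi)] at this

theorem gStarN_ncard : gStarN.supp.ncard = 6 := by
  rw [gStarN_supp, Set.ncard_image_of_injective _ gStarState_injective,
    Set.ncard_eq_toFinset_card', Set.toFinset_ofPred]
  decide

theorem gStarS_ncard : gStarS.supp.ncard = 12 := by
  rw [gStarS_supp, Set.ncard_image_of_injective _ gStarState_injective,
    Set.ncard_eq_toFinset_card', Set.toFinset_ofPred]
  decide

theorem gStar_kempeClass (E : KempeClass gStar) : E = gStarN ∨ E = gStarS := by
  induction E using SimpleGraph.ConnectedComponent.ind with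
  | _ s =>
  obtain ⟨i, rfl⟩ := gStarState_surjective s
  have := (SimpleGraph.ConnectedComponent.mem_supp_iff _ _).1 (gStarState_mem i)
  split_ifs at this
  exacts [Or.inl this, Or.inr this]

theorem gStarN_ne_gStarS : gStarN ≠ gStarS := fun h => gStarS_isSClass (gStarState 0)
  (h ▸ gStarState_mem 0) rfl

theorem gStarN_isNSClass_uv : IsNSClass gStarN 10 11 :=
  ⟨⟨gStarState 0, gStarState_mem 0, rfl⟩,
    gStarState 2, gStarState_mem 2, by rw [gStarState_iff]; decide⟩

theorem gStarS_isNSClass_uv : IsNSClass gStarS 10 11 :=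
  ⟨⟨gStarState 7, gStarState_mem 7, rfl⟩,
    gStarState 6, gStarState_mem 6, by rw [gStarState_iff]; decide⟩

instance : DecidableRel birkhoffDiamond.Adj :=
  inferInstanceAs (DecidableRel (SimpleGraph.fromRel fun a b : Fin 10 => (a, b) ∈ _).Adj)

theorem gStar_nonempty_iso_birkhoffDiamond :
    Nonempty (gStar.induce {uStar, vStar}ᶜ ≃g birkhoffDiamond) := by
  have hmem : ∀ i : Fin 10, Fin.castLE (by norm_num : 10 ≤ 12) i ∉ ({uStar, vStar} : Set (Fin 12)) := by
    intro i h
    rcases h with h | h <;> revert i <;> decide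
  let f : Fin 10 → ({uStar, vStar}ᶜ : Set (Fin 12)) := fun i => ⟨Fin.castLE (by norm_num) i, hmem i⟩
  have hf : Function.Bijective f := by
    refine ⟨fun i j h => Fin.castLE_injective (by norm_num : 10 ≤ 12) (congrArg Subtype.val h), ?_⟩
    rintro ⟨z, hz⟩
    have hz' : z ≠ 10 ∧ z ≠ 11 := ⟨fun h => hz (Or.inl h), fun h => hz (Or.inr h)⟩
    have hz'' : (z : ℕ) < 10 := by
      clear hz
      revert z
      decide
    exact ⟨⟨z, hz''⟩, rfl⟩
  have hadj : ∀ i j : Fin 10, gStar.Adj (Fin.castLE (by norm_num) i) (Fin.castLE (by norm_num) j) ↔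
      birkhoffDiamond.Adj i j := by
    decide
  exact ⟨(⟨Equiv.ofBijective f hf, fun {i j} => hadj i j⟩ :
    birkhoffDiamond ≃g gStar.induce {uStar, vStar}ᶜ).symm⟩

instance : DecidableRel icosahedron.Adj := fun p q =>
  decidable_of_iff _ (SimpleGraph.fromRel_adj _ p q).symm
theorem gStarUV_nonempty_iso_icosahedron : Nonempty (gStarUV ≃g icosahedron) := by
  let f : Fin 12 → Bool × Option (ZMod 5) :=
    ![(false, some 1), (false, some 2), (false, some 3), (false, some 4), (true, some 0),
      (true, some 1), (true, some 3), (true, none), (true, some 2), (true, some 4),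
      (false, none), (false, some 0)]
  have hinj : ∀ i j, f i = f j → i = j := by decide
  have hf : Function.Bijective f :=
    (Fintype.bijective_iff_injective_and_card f).2 ⟨hinj, by decide⟩
  have hadj : ∀ i j, icosahedron.Adj (f i) (f j) ↔ gStarUV.Adj i j := by decide
  exact ⟨⟨Equiv.ofBijective f hf, fun {i j} => hadj i j⟩⟩

end AGraph

theorem mainTheorem7 :
    -- every member of the family has order at least 12, and the only one of order 12 is `G*_xy`
    (∀ (V : Type*) [Finite V] (G : SimpleGraph V) (u x v y : V), InAStar G u x v y →
      12 ≤ Nat.card V ∧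
      (Nat.card V = 12 → ∃ φ : G ≃g gStar,
        φ u = uStar ∧ φ x = xStar ∧ φ v = vStar ∧ φ y = yStar)) ∧
    -- `G*` contains the Birkhoff diamond, and `G*_xy` is a member
    Nonempty (gStar.induce {uStar, vStar}ᶜ ≃g birkhoffDiamond) ∧
    InAStar gStar uStar xStar vStar yStar ∧
    -- `G*_uv` is a parented a-graph with the icosahedron as parent, but not a member
    IsParentedAGraph gStar xStar uStar yStar vStar ∧
    Nonempty ((gStar ⊔ SimpleGraph.edge uStar vStar) ≃g icosahedron) ∧
    ¬ InAStar gStar xStar uStar yStar vStar ∧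
    -- the two Kempe classes of `G*`
    (∃ C D : KempeClass gStar, C ≠ D ∧ (∀ E : KempeClass gStar, E = C ∨ E = D) ∧
      C.supp.ncard = 6 ∧ D.supp.ncard = 12 ∧
      IsNClass C xStar yStar ∧ IsSClass D xStar yStar ∧
      IsNSClass C uStar vStar ∧ IsNSClass D uStar vStar) := by
  refine ⟨fun V _ G u x v y h => ?_, gStar_nonempty_iso_birkhoffDiamond,
    ⟨gStar_isParentedAGraph_xy, not_isNSClass_of_not_unlocked gStar_not_unlocked⟩,
    gStar_isParentedAGraph_uv, gStarUV_nonempty_iso_icosahedron,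
    fun h => h.2 gStarN gStarN_isNSClass_uv,
    gStarN, gStarS, gStarN_ne_gStarS, gStar_kempeClass, gStarN_ncard, gStarS_ncard,
    gStarN_isNClass, gStarS_isSClass, gStarN_isNSClass_uv, gStarS_isNSClass_uv⟩
  have := Fintype.ofFinite V
  rw [Nat.card_eq_fintype_card]
  exact h.twelve_le
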